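/- Let $A,B,M\in\mathbb R^{n\times n}$ ($n\ge 2$) be symmetric with $B$ and $M$ positive definite. Let $\lambda_1<\lambda_2\le\dots\le\lambda_n$ be the eigenvalues of the pencil $(A,B)$, with $B$-orthonormal eigenvectors $v_1,\dots,v_n$, $Av_i=\lambda_iBv_i$. Write $\|x\|_B=(x^TBx)^{1/2}$, $\rho(x)=x^TAx/x^TBx$, and $\angle(x,y)_B=\arccos\frac{x^TBy}{\|x\|_B\|y\|_B}$. Let $m\ge1$ and let $K$ be a natural number. **Method (preconditioned Lanczos+1, $K$ steps).** Start from $x_0$ with $\|x_0\|_B=1$ (and the sign normalization $x_0^TBv_1\ge0$). For $0\le k<K$ put $\rho_k=\rho(x_k)$, $r_k=(A-\rho_kB)x_k$, and let $\mathcal K_k=\mathrm{span}\{M((A-\rho_kB)M)^ir_k:0\le i<m\}$. Take a Ritz vector $z_k\neq0$ of $(A,B)$ for the lowest Ritz value on $\mathrm{span}\{x_k\}+\mathcal K_k+\mathrm{span}\{p_{k-1}\}$ (without the last summand if $k=0$), written as $z_k=\alpha_kx_k+g_k+\beta_kp_{k-1}$ with $g_k\in\mathcal K_k$, and set $x_{k+1}=z_k/\|z_k\|_B$.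 Let $\tilde p_0=g_0$, $\tilde p_k=g_k-\frac{p_{k-1}^T(A-\rho_{k-1}B)g_k}{p_{k-1}^T(A-\rho_{k-1}B)p_{k-1}}p_{k-1}$ for $k>0$, and $p_k=\tilde p_k/\|\tilde p_k\|_B$. Put $W_k=\mathrm{span}\{g_0,\dots,g_{k-1}\}$, $U_k=\mathrm{span}\{x_0\}+W_k$, $\theta_k=\angle(x_k,v_1)_B$, and let $y_k^*$ be a minimizer of $\rho$ over $U_k\setminus\{0\}$. **Assumptions.** With $A,B,M,m,K$ fixed, consider any family of such runs for which there are constants, common to all runs of the family, such that: 1. (Precisely linear convergence.) There are $0<\underline\xi<\bar\xi<1$ such that $\rho_0\in(\lambda_1,\lambda_2)$ and $\underline\xi^{\,k-j}(\rho_j-\lambda_1)\le\rho_k-\lambda_1\le\bar\xi^{\,k-j}(\rho_j-\lambda_1)$ for $0\le j<k\le K$. 2. (Angle.) There is $\delta>0$ such that, for $1\le k\le K$, the (Euclidean) angle between $v_1$ and every nonzero vector of $W_k$ is at least $\delta$. 3. (Same polynomial.) There are $\varepsilon,\eta>0$ and $\kappa$ such that every run with $\theta_0<\varepsilon$ admits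 real polynomials $q_0,\dots,q_{K-1}$ of degree at most $m-1$ and scalars $c_0,\dots,c_{K-1}$ for which the matrices $N_k=Mq_k((A-\rho_kB)M)$ satisfy $g_k=c_kN_kr_k$, the largest absolute value of an entry of $N_k$ is at least $\eta$ (which fixes the scale of $q_k$), and every entry of $N_k-N_j$ is at most $\kappa\sin\theta_j$ in absolute value for $0\le j<k<K$. For $m=1$ (LOPCG) assumption 3 always holds, with $q_k=1$ and $N_k=M$. **Theorem.** There are constants $C_3,C_4,\dots$, the same for all runs of the family, such that for every run $$\rho(x_{k+1})-\rho(y_{k+1}^*)\le\rho(x_k)-\rho(y_k^*)+C_{k+1}\sin\theta_{k+1}\sin^2\theta_0\qquad(2\le k<K),$$ and for every $3\le k\le K$ $$\rho(x_k)-\rho(y_k^*)\le\sum_{j=3}^kC_j\sin\theta_j\,\sin^2\theta_0,\qquad \frac{\rho(x_k)-\rho(y_k^*)}{\rho(x_k)-\lambda_1}\le\frac{\underline\xi^{-k}\sum_{j=3}^kC_j\sin\theta_j}{\lambda_2-\lambda_1}.$$ The last right-hand side tends to $0$ as $\theta_0\to0$ within the family, and therefore $$\lim_{\theta_0\to0}\frac{\rho(x_k)-\rho(y_k^*)}{\rho(x_k)-\lambda_1}=0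 .$$ -/

import Mathlib

open Filter Topology Matrix

/-- The bilinear form `(x, y)_B = xᵀ B y`. -/
def bInner {n : ℕ} (B : Matrix (Fin n) (Fin n) ℝ) (x y : Fin n → ℝ) : ℝ :=
  x ⬝ᵥ (B *ᵥ y)

/-- The norm `‖x‖_B = (xᵀ B x)^{1/2}`. -/
noncomputable def bNorm {n : ℕ} (B : Matrix (Fin n) (Fin n) ℝ) (x : Fin n → ℝ) : ℝ :=
  Real.sqrt (bInner B x x)

/-- The angle `∠(x, y)_B ∈ [0, π]`; for `B = 1` it is the Euclidean angle. -/
noncomputable def bAngle {n : ℕ} (B : Matrix (Fin n) (Fin n) ℝ) (x y : Fin n → ℝ) : ℝ :=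
  Real.arccos (bInner B x y / (bNorm B x * bNorm B y))

/-- The Rayleigh quotient `ρ(x) = xᵀ A x / xᵀ B x`. -/
noncomputable def rayleigh {n : ℕ} (A B : Matrix (Fin n) (Fin n) ℝ) (x : Fin n → ℝ) : ℝ :=
  bInner A x x / bInner B x x

/-- The shifted matrix `A - ρ(x) B`. -/
noncomputable def shifted {n : ℕ} (A B : Matrix (Fin n) (Fin n) ℝ) (x : Fin n → ℝ) :
    Matrix (Fin n) (Fin n) ℝ :=
  A - rayleigh A B x • B

/-- The eigenresidual `r = (A - ρ(x) B) x`. -/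
noncomputable def eigResidual {n : ℕ} (A B : Matrix (Fin n) (Fin n) ℝ) (x : Fin n → ℝ) :
    Fin n → ℝ :=
  shifted A B x *ᵥ x

/-- All eigenvalues `lam 0 ≤ lam 1 ≤ …` of the pencil `(A, B)`, listed with multiplicity, and a
`B`-orthonormal basis `v` of eigenvectors. -/
structure IsEigensystem {n : ℕ} (A B : Matrix (Fin n) (Fin n) ℝ) (lam : Fin n → ℝ)
    (v : Fin n → Fin n → ℝ) : Prop where
  mono : Monotone lam
  eigen : ∀ i, A *ᵥ v i = lam i • (B *ᵥ v i)
  orthonormal : ∀ i j, bInner B (v i) (v j) = if i = j then 1 else 0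

/-- The preconditioned Krylov space `M 𝒦_m((A - ρ(x) B) M, r)`, spanned by
`M ((A - ρ(x) B) M)^i r`, `0 ≤ i < m`. -/
noncomputable def precKrylov {n : ℕ} (A B M : Matrix (Fin n) (Fin n) ℝ) (m : ℕ)
    (x : Fin n → ℝ) : Submodule ℝ (Fin n → ℝ) :=
  Submodule.span ℝ (Set.range fun i : Fin m =>
    M *ᵥ (((shifted A B x * M) ^ (i : ℕ)) *ᵥ eigResidual A B x))

/-- `(μ, z)` is a Ritz pair of `(A, B)` on the subspace `Q`. If `Q` is the range of a matrix, also
called `Q`, and `z = Q w`, this says `Qᵀ A Q w = μ Qᵀ B Q w` and `Q w ≠ 0`. -/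
def IsRitzPair {n : ℕ} (A B : Matrix (Fin n) (Fin n) ℝ) (Q : Submodule ℝ (Fin n → ℝ))
    (μ : ℝ) (z : Fin n → ℝ) : Prop :=
  z ∈ Q ∧ z ≠ 0 ∧ ∀ q ∈ Q, q ⬝ᵥ (A *ᵥ z - μ • (B *ᵥ z)) = 0

/-- `(μ, z)` is a Ritz pair on `Q` with the lowest Ritz value. -/
def IsLowestRitzPair {n : ℕ} (A B : Matrix (Fin n) (Fin n) ℝ) (Q : Submodule ℝ (Fin n → ℝ))
    (μ : ℝ) (z : Fin n → ℝ) : Prop :=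
  IsRitzPair A B Q μ z ∧ ∀ μ' z', IsRitzPair A B Q μ' z' → μ ≤ μ'

/-- The previous search direction `p_{k-1}`; for `k = 0` there is none and the value is `0`, which
removes it from every formula below. -/
def prevDir {n : ℕ} (p : ℕ → Fin n → ℝ) : ℕ → Fin n → ℝ
  | 0 => 0
  | k + 1 => p k

/-- The unnormalized search direction `p̃_k`, that is, `g_0` for `k = 0` and
`g_k - (p_{k-1}ᵀ (A - ρ_{k-1} B) g_k / p_{k-1}ᵀ (A - ρ_{k-1} B) p_{k-1}) p_{k-1}` for `k > 0`. -/
noncomputable def rawDir {n : ℕ} (A B : Matrix (Fin n) (Fin n) ℝ) (x g p : ℕ → Fin n → ℝ)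
    (k : ℕ) : Fin n → ℝ :=
  g k - (bInner (shifted A B (x (k - 1))) (prevDir p k) (g k) /
      bInner (shifted A B (x (k - 1))) (prevDir p k) (prevDir p k)) • prevDir p k

/-- `K` outer steps (those with index `k < K`) of the preconditioned Lanczos+1 method with
preconditioner `M` and inner dimension `m`: iterates `x_0, …, x_K`, Krylov parts
`g_0, …, g_{K-1}` and search directions `p_0, …, p_{K-1}`.

In step `k` the lowest Ritz vector `z` on `span{x_k} + M 𝒦_m((A - ρ_k B) M, r_k) + span{p_{k-1}}`
is split as `z = α x_k + g_k + β p_{k-1}`, where `g_k` is the component belonging to the columns of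
a basis `G_k` of the Krylov space (its value does not depend on the basis that is used). The
scaling of `z` is free, as the scaling of an eigenvector is. -/
structure IsPLRun {n : ℕ} (A B M : Matrix (Fin n) (Fin n) ℝ) (m K : ℕ)
    (x g p : ℕ → Fin n → ℝ) : Prop where
  init : bNorm B (x 0) = 1
  step : ∀ k < K, ∃ (μ : ℝ) (z : Fin n → ℝ) (α β : ℝ),
    IsLowestRitzPair A B
      (Submodule.span ℝ {x k} ⊔ precKrylov A B M m (x k) ⊔ Submodule.span ℝ {prevDir p k}) μ z ∧
    g k ∈ precKrylov A B M m (x k) ∧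
    z = α • x k + g k + β • prevDir p k ∧
    x (k + 1) = (bNorm B z)⁻¹ • z
  dir : ∀ k < K, p k = (bNorm B (rawDir A B x g p k))⁻¹ • rawDir A B x g p k

/-- `W_k = span{g_0, …, g_{k-1}}`. -/
def spaceW {n : ℕ} (g : ℕ → Fin n → ℝ) (k : ℕ) : Submodule ℝ (Fin n → ℝ) :=
  Submodule.span ℝ (g '' Set.Iio k)

/-- `U_k = span{x_0} + W_k`. -/
def spaceU {n : ℕ} (x g : ℕ → Fin n → ℝ) (k : ℕ) : Submodule ℝ (Fin n → ℝ) :=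
  Submodule.span ℝ {x 0} ⊔ spaceW g k

/-- `y` is a global minimizer of the Rayleigh quotient over the nonzero vectors of `U`. -/
def IsRayleighMin {n : ℕ} (A B : Matrix (Fin n) (Fin n) ℝ) (U : Submodule ℝ (Fin n → ℝ))
    (y : Fin n → ℝ) : Prop :=
  y ∈ U ∧ y ≠ 0 ∧ ∀ u ∈ U, u ≠ 0 → rayleigh A B y ≤ rayleigh A B u

/-- Precisely linear convergence of the Ritz values `ρ_0, …, ρ_K` to `lam1`, with factors between
`ξ` and `ξ'`, from a starting value in `(lam1, lam2)`. -/
def LinearConvergence {n : ℕ} (A B : Matrix (Fin n) (Fin n) ℝ) (lam1 lam2 ξ ξ' : ℝ) (K : ℕ)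
    (x : ℕ → Fin n → ℝ) : Prop :=
  rayleigh A B (x 0) ∈ Set.Ioo lam1 lam2 ∧
  ∀ j k, j < k → k ≤ K →
    ξ ^ (k - j) * (rayleigh A B (x j) - lam1) ≤ rayleigh A B (x k) - lam1 ∧
    rayleigh A B (x k) - lam1 ≤ ξ' ^ (k - j) * (rayleigh A B (x j) - lam1)

/-- `∠(v, W_k) ≥ δ` for `1 ≤ k ≤ K`, the angle between a vector and a subspace being the smallest
angle that the vector makes with a nonzero vector of the subspace. -/
def AngleBound {n : ℕ} (v : Fin n → ℝ) (δ : ℝ) (K : ℕ) (g : ℕ → Fin n → ℝ) : Prop :=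
  ∀ k, 1 ≤ k → k ≤ K → ∀ w ∈ spaceW g k, w ≠ 0 → δ ≤ bAngle 1 v w

/-- The matrix `M q((A - ρ(x) B) M)`. -/
noncomputable def polyPrec {n : ℕ} (A B M : Matrix (Fin n) (Fin n) ℝ) (q : Polynomial ℝ)
    (x : Fin n → ℝ) : Matrix (Fin n) (Fin n) ℝ :=
  M * Polynomial.aeval (shifted A B x * M) q

/-- The "same polynomial" property: up to scalar factors `c_k`, `g_k = M q_k((A - ρ_k B) M) r_k`
with polynomials `q_k` of degree at most `m - 1`, and
`M q_k((A - ρ_k B) M) = M q_j((A - ρ_j B) M) + O(sin θ_j)` for `j < k`, with constant `κ`.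
As the factors `c_k` are free, the scale of the matrices is fixed by the lower bound `η` on their
largest entry: matrices that are themselves `O(sin θ_j)` would satisfy the relation for no reason. -/
def SamePolynomial {n : ℕ} (A B M : Matrix (Fin n) (Fin n) ℝ) (v : Fin n → ℝ) (m : ℕ)
    (η κ : ℝ) (K : ℕ) (x g : ℕ → Fin n → ℝ) : Prop :=
  ∃ (q : ℕ → Polynomial ℝ) (c : ℕ → ℝ),
    (∀ k < K, (q k).degree < (m : WithBot ℕ) ∧
      g k = c k • (polyPrec A B M (q k) (x k) *ᵥ eigResidual A B (x k)) ∧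
      ∃ a b, η ≤ |polyPrec A B M (q k) (x k) a b|) ∧
    ∀ j k, j < k → k < K → ∀ a b,
      |polyPrec A B M (q k) (x k) a b - polyPrec A B M (q j) (x j) a b|
        ≤ κ * Real.sin (bAngle B (x j) v)

/-! ### Bounded and small families along a filter. -/

section AsymptoticCalculus

open Asymptotics
open scoped Matrix.Norms.Operator

/-! Put H = A - λ₁B and s = sin θ₀, and write x_k = (x_k, v₁)_B (v₁ + s t_k) with t_k B-orthogonal
to v₁. Since H v₁ = 0, the Rayleigh quotient satisfies ρ(x_k) - λ₁ = s² t_kᵀHt_k / (1 + s²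
t_kᵀBt_k). The t_k stay bounded as s → 0, so minimizing ρ becomes minimizing the quadratic form of
H. In the limit the method is a conjugate gradient iteration for Ht = 0: the residual is e_k = Ht_k,
the "same polynomial" assumption supplies one fixed symmetric preconditioner N, consecutive
directions are conjugate, and the Ritz condition makes e_{k+1} orthogonal to p_{k-1} and p_k. All of
this holds up to O(s).

The classical induction turns these local relations into global ones: e_k is orthogonal to all of
W_k up to O(s) (`AsymptoticCG.orth`). If s_k denotes the scaled error of the minimizer y_k*, then
t_k - s_k lies in W_k up to a multiple of v₁ and O(s). As H is positive semidefinite, t_kᵀHt_k -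
s_kᵀHs_k ≤ 2 (t_k - s_k)ᵀHt_k = O(s), that is, ρ(x_k) - ρ(y_k*) = O(s³). The lower convergence rate
gives sin θ_k ≥ c s, which converts this into O(sin θ_k sin²θ₀).

The difficulty is uniformity: the vectors g_j may become nearly dependent, so coefficients in them
are uncontrolled. Orthogonality is therefore stated for arbitrary bounded families of vectors of
W_k, and boundedness of the parts of a sum is drawn from near conjugacy (`Bdd.of_add_smul`). Three
lower bounds keep the divisions harmless. The angle assumption makes H coercive on W_k. The upper
rate keeps the scaled steps away from zero (`PLFamily.decrease`). The lower rate keeps the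
preconditioned residuals away from zero (`exists_scaledKrylov_lower`): a degenerate Krylov space
would contain an exact solution. Definiteness of N is never needed. -/

theorem norm_dotProduct_le_card {d : ℕ} (x y : Fin d → ℝ) : ‖x ⬝ᵥ y‖ ≤ d * (‖x‖ * ‖y‖) := by
  unfold dotProduct
  calc ‖∑ i, x i * y i‖ ≤ ∑ i : Fin d, ‖x i * y i‖ := norm_sum_le _ _
    _ ≤ ∑ _i : Fin d, ‖x‖ * ‖y‖ := by
        refine Finset.sum_le_sum fun i _ => ?_
        rw [norm_mul]
        exact mul_le_mul (norm_le_pi_norm x i) (norm_le_pi_norm y i) (norm_nonneg _) (norm_nonneg _)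
    _ = d * (‖x‖ * ‖y‖) := by simp

variable {ι : Type*} {l : Filter ι} {d : ℕ}

theorem isBigO_dotProduct {x y : ι → Fin d → ℝ} {a b : ι → ℝ} (hx : x =O[l] a) (hy : y =O[l] b) :
    (fun i => x i ⬝ᵥ y i) =O[l] fun i => a i * b i := by
  have h1 : (fun i => x i ⬝ᵥ y i) =O[l] fun i => ‖x i‖ * ‖y i‖ :=
    IsBigO.of_bound (d : ℝ) (Eventually.of_forall fun i => by
      have := norm_dotProduct_le_card (x i) (y i)
      simpa [abs_mul] using this)
  exact h1.trans (hx.norm_left.mul hy.norm_left)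

theorem isBigO_mulVec {N : ι → Matrix (Fin d) (Fin d) ℝ} {x : ι → Fin d → ℝ} {a b : ι → ℝ}
    (hN : N =O[l] a) (hx : x =O[l] b) : (fun i => N i *ᵥ x i) =O[l] fun i => a i * b i := by
  have h1 : (fun i => N i *ᵥ x i) =O[l] fun i => ‖N i‖ * ‖x i‖ :=
    IsBigO.of_bound 1 (Eventually.of_forall fun i => by
      simpa [abs_mul] using linfty_opNorm_mulVec (N i) (x i))
  exact h1.trans (hN.norm_left.mul hx.norm_left)

/-- Boundedness of a family along a filter. -/
abbrev Bdd {E : Type*} [Norm E] (l : Filter ι) (f : ι → E) : Prop := f =O[l] fun _ => (1 : ℝ)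

section Rules
variable {E : Type*} [NormedAddCommGroup E]
variable {τ : ι → ℝ} {c : ι → ℝ} {f : ι → E} {x y : ι → Fin d → ℝ}
  {N : ι → Matrix (Fin d) (Fin d) ℝ}

theorem Bdd.const (a : E) : Bdd l (fun _ => a) := isBigO_const_const a one_ne_zero l

theorem Bdd.of_small (hτ : Tendsto τ l (𝓝 0)) (h : f =O[l] τ) : Bdd l f :=
  h.trans (hτ.isBigO_one ℝ)

/-- Absorption of a small multiple of the norm. -/
theorem Bdd.of_le_add_mul_norm {u : ι → E} (hτ : Tendsto τ l (𝓝 0)) {C : ℝ}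
    (h : ∀ᶠ i in l, ‖u i‖ ≤ C * (1 + ‖τ i‖ * ‖u i‖)) : Bdd l u := by
  -- Below this threshold the term containing ‖u‖ is at most ‖u‖ / 2 and can be absorbed on the
  -- left.
  have ht : ∀ᶠ i in l, ‖τ i‖ < (2 * (|C| + 1))⁻¹ := by
    have := hτ.norm
    rw [norm_zero] at this
    exact this.eventually_lt_const (by positivity)
  refine IsBigO.of_bound (2 * (|C| + 1)) ?_
  filter_upwards [h, ht] with i hi ht
  have h1 : (|C| + 1) * ‖τ i‖ ≤ 1 / 2 := by
    calc (|C| + 1) * ‖τ i‖ ≤ (|C| + 1) * (2 * (|C| + 1))⁻¹ := by gcongr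
      _ = 1 / 2 := by field_simp
  have h2 : C * (1 + ‖τ i‖ * ‖u i‖) ≤ (|C| + 1) * (1 + ‖τ i‖ * ‖u i‖) := by
    gcongr
    linarith [le_abs_self C]
  have h3 : (|C| + 1) * ‖τ i‖ * ‖u i‖ ≤ 1 / 2 * ‖u i‖ := by gcongr
  rw [norm_one, mul_one]
  nlinarith

variable [NormedSpace ℝ E]

theorem Bdd.smul (hc : Bdd l c) (hf : Bdd l f) : Bdd l (fun i => c i • f i) := by
  simpa using IsBigO.smul hc hf

theorem Bdd.smul_small (hc : Bdd l c) (hf : f =O[l] τ) : (fun i => c i • f i) =O[l] τ := by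
  simpa using IsBigO.smul hc hf

theorem Bdd.small_smul (hc : c =O[l] τ) (hf : Bdd l f) : (fun i => c i • f i) =O[l] τ := by
  simpa using IsBigO.smul hc hf

theorem Bdd.mul {b : ι → ℝ} (hc : Bdd l c) (hb : Bdd l b) : Bdd l (fun i => c i * b i) := by
  simpa using IsBigO.mul hc hb

theorem Bdd.mul_small {b : ι → ℝ} (hc : Bdd l c) (hb : b =O[l] τ) :
    (fun i => c i * b i) =O[l] τ := by
  simpa using IsBigO.mul hc hb

theorem Bdd.small_mul {b : ι → ℝ} (hc : c =O[l] τ) (hb : Bdd l b) :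
    (fun i => c i * b i) =O[l] τ := by
  simpa using IsBigO.mul hc hb

theorem Bdd.dot (hx : Bdd l x) (hy : Bdd l y) : Bdd l (fun i => x i ⬝ᵥ y i) := by
  simpa using isBigO_dotProduct hx hy

theorem Bdd.dot_small (hx : Bdd l x) (hy : y =O[l] τ) : (fun i => x i ⬝ᵥ y i) =O[l] τ := by
  simpa using isBigO_dotProduct hx hy

theorem Bdd.small_dot (hx : x =O[l] τ) (hy : Bdd l y) : (fun i => x i ⬝ᵥ y i) =O[l] τ := by
  simpa using isBigO_dotProduct hx hy

theorem Bdd.mulVec (hN : Bdd l N) (hy : Bdd l y) : Bdd l (fun i => N i *ᵥ y i) := by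
  simpa using isBigO_mulVec hN hy

theorem Bdd.mulVec_small (hN : Bdd l N) (hy : y =O[l] τ) : (fun i => N i *ᵥ y i) =O[l] τ := by
  simpa using isBigO_mulVec hN hy

theorem Bdd.small_mulVec (hN : N =O[l] τ) (hy : Bdd l y) : (fun i => N i *ᵥ y i) =O[l] τ := by
  simpa using isBigO_mulVec hN hy

/-- If `f` is bounded below and equal to `χ z` up to a small error, `z` being bounded, then `χ` is
bounded below. -/
theorem Bdd.inv_of_sub_smul {χ : ι → ℝ} {f z : ι → E} (hτ : Tendsto τ l (𝓝 0))
    (hf : (fun _ => (1 : ℝ)) =O[l] f) (hz : Bdd l z) (h : (fun i => f i - χ i • z i) =O[l] τ) :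
    (∀ᶠ i in l, χ i ≠ 0) ∧ Bdd l (fun i => (χ i)⁻¹) := by
  obtain ⟨C1, hC1, h1⟩ := hf.exists_pos
  obtain ⟨C2, hC2, h2⟩ := hz.exists_pos
  obtain ⟨C3, hC3, h3⟩ := h.exists_pos
  rw [isBigOWith_iff] at h1 h2 h3
  have ht : ∀ᶠ i in l, ‖τ i‖ < (2 * C1 * C3)⁻¹ := by
    have := hτ.norm
    rw [norm_zero] at this
    exact this.eventually_lt_const (by positivity)
  -- From 1 ≤ C1 ‖f‖ ≤ C1 (C3 ‖τ‖ + C2 ‖χ‖), where C1 C3 ‖τ‖ ≤ 1/2 eventually.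
  have key : ∀ᶠ i in l, 1 ≤ 2 * C1 * C2 * ‖χ i‖ := by
    filter_upwards [h1, h2, h3, ht] with i h1 h2 h3 ht
    rw [norm_one] at h1
    rw [norm_one, mul_one] at h2
    have h4 : ‖f i‖ ≤ ‖f i - χ i • z i‖ + ‖χ i‖ * ‖z i‖ := by
      rw [← norm_smul]; exact norm_le_norm_sub_add _ _
    have h5 : C1 * C3 * ‖τ i‖ ≤ 1 / 2 := by
      calc C1 * C3 * ‖τ i‖ ≤ C1 * C3 * (2 * C1 * C3)⁻¹ := by gcongr
        _ = 1 / 2 := by field_simp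
    have h6 : ‖χ i‖ * ‖z i‖ ≤ ‖χ i‖ * C2 := by gcongr
    have h7 : C1 * ‖f i‖ ≤ C1 * (C3 * ‖τ i‖ + ‖χ i‖ * C2) := by gcongr; linarith
    nlinarith
  constructor
  · filter_upwards [key] with i hi h0
    rw [h0] at hi
    norm_num at hi
  · refine IsBigO.of_bound (2 * C1 * C2) ?_
    filter_upwards [key] with i hi
    have hpos : 0 < ‖χ i‖ := by
      by_contra h0
      have : ‖χ i‖ = 0 := le_antisymm (not_lt.1 h0) (norm_nonneg _)
      rw [this] at hi
      norm_num at hi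
    rw [norm_inv, norm_one, mul_one, inv_le_iff_one_le_mul₀ hpos]
    exact hi

/-- Decomposition along almost conjugate directions: if `p` is almost conjugate to all bounded
families in `W`, then the two parts of a bounded family `u + χ p`, with `u` in `W`, are bounded. -/
theorem Bdd.of_add_smul {H : Matrix (Fin d) (Fin d) ℝ} {W : ι → Submodule ℝ (Fin d → ℝ)}
    {p u : ι → Fin d → ℝ} {χ D : ι → ℝ} (hτ : Tendsto τ l (𝓝 0)) (hp : Bdd l p) (hD : Bdd l D)
    (hDp : ∀ i, (D i * (p i ⬝ᵥ H *ᵥ p i)) • p i = p i)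
    (hW : ∀ w : ι → Fin d → ℝ, (∀ᶠ i in l, w i ∈ W i) → Bdd l w →
      (fun i => w i ⬝ᵥ H *ᵥ p i) =O[l] τ)
    (hu : ∀ᶠ i in l, u i ∈ W i) (hsum : Bdd l (fun i => u i + χ i • p i)) :
    Bdd l u ∧ Bdd l (fun i => χ i • p i) ∧ Bdd l (fun i => D i * (χ i * (p i ⬝ᵥ H *ᵥ p i))) := by
  have hHp : Bdd l (fun i => H *ᵥ p i) := (Bdd.const H).mulVec hp
  -- `hW` speaks of bounded families only and u is not yet known to be one; normalizing by 1 + ‖u‖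
  -- costs a factor that multiplies a small term and is absorbed at the end.
  have hw : Bdd l (fun i => (1 + ‖u i‖)⁻¹ • u i) := by
    refine IsBigO.of_bound 1 (Eventually.of_forall fun i => ?_)
    rw [norm_smul, norm_inv, Real.norm_of_nonneg (by positivity), norm_one, mul_one,
      inv_mul_le_iff₀ (by positivity)]
    linarith
  have h1 := hW _ (hu.mono fun i hi => Submodule.smul_mem _ _ hi) hw
  have h2 : Bdd l (fun i => (u i + χ i • p i) - (D i * ((u i + χ i • p i) ⬝ᵥ H *ᵥ p i)) • p i) :=
    hsum.sub ((hD.mul (hsum.dot hHp)).smul hp)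
  have h3 : (fun i => D i • ((((1 + ‖u i‖)⁻¹ • u i) ⬝ᵥ H *ᵥ p i) • p i)) =O[l] τ :=
    hD.smul_small (Bdd.small_smul h1 hp)
  obtain ⟨C2, hC2, h2⟩ := h2.exists_pos
  obtain ⟨C3, hC3, h3⟩ := h3.exists_pos
  rw [isBigOWith_iff] at h2 h3
  have hub : Bdd l u := by
    have ht : ∀ᶠ i in l, ‖τ i‖ < 1 := by
      have := hτ.norm
      rw [norm_zero] at this
      exact this.eventually_lt_const (by positivity)
    refine Bdd.of_le_add_mul_norm hτ (C := C2 + C3) ?_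
    filter_upwards [h2, h3, ht] with i h2 h3 ht
    -- Subtracting the H-projection onto p removes χ p entirely, so u is the projected sum plus its
    -- own projection, and the latter is (1 + ‖u‖) O(τ).
    have e1 : u i = ((u i + χ i • p i) - (D i * ((u i + χ i • p i) ⬝ᵥ H *ᵥ p i)) • p i)
        + (1 + ‖u i‖) • (D i • ((((1 + ‖u i‖)⁻¹ • u i) ⬝ᵥ H *ᵥ p i) • p i)) := by
      have hne : (1 + ‖u i‖) ≠ 0 := by positivity
      have e2 : (1 + ‖u i‖) • (D i • ((((1 + ‖u i‖)⁻¹ • u i) ⬝ᵥ H *ᵥ p i) • p i))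
          = (D i * (u i ⬝ᵥ H *ᵥ p i)) • p i := by
        rw [smul_dotProduct, smul_smul, smul_smul, smul_eq_mul]
        congr 1
        field_simp
      rw [e2, add_dotProduct, mul_add, add_smul, smul_dotProduct, smul_eq_mul, mul_left_comm,
        mul_smul (χ i), hDp]
      module
    have e3 : ‖u i‖ ≤ C2 + (1 + ‖u i‖) * (C3 * ‖τ i‖) := by
      calc ‖u i‖ = _ := congrArg _ e1
        _ ≤ _ := norm_add_le _ _
        _ ≤ _ := by
          rw [norm_smul, Real.norm_of_nonneg (by positivity : 0 ≤ 1 + ‖u i‖)]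
          rw [norm_one, mul_one] at h2
          gcongr
    have : C3 * ‖τ i‖ ≤ C3 * 1 := by gcongr
    have : 0 ≤ C2 * (‖τ i‖ * ‖u i‖) := by positivity
    nlinarith
  have h4 : Bdd l (fun i => χ i • p i) := by
    have := hsum.sub hub
    simpa using this
  refine ⟨hub, h4, ?_⟩
  -- Where p = 0 nothing controls χ itself; D χ pᵀHp is the coefficient that is bounded everywhere
  -- and gives the same multiple of p.
  have := hD.mul (h4.dot hHp)
  simpa [smul_dotProduct] using this

end Rules

end AsymptoticCalculus

/-! ### Conjugate gradients with O(τ) errors: from local to global orthogonality. -/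

section AsymptoticConjugateGradient

open Asymptotics
open scoped Matrix.Norms.Operator

variable {ι : Type*} {d : ℕ}

/-- A family of processes that are conjugate gradient iterations for `H` with preconditioner `N` up
to errors `O(τ)`: scaled errors with residuals `e k`, directions `p (k + 1)` with predecessor `p k`
(`p 0 = 0`), preconditioned residuals `r k`, and search spaces `W k` spanned by the vectors `g k`,
which are multiples of `r k`. -/
structure AsymptoticCG (l : Filter ι) (τ : ι → ℝ) (H : Matrix (Fin d) (Fin d) ℝ) (K : ℕ)
    (e g r p : ℕ → ι → Fin d → ℝ) (W : ℕ → ι → Submodule ℝ (Fin d → ℝ))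
    (N : ι → Matrix (Fin d) (Fin d) ℝ) : Prop where
  tendsto : Tendsto τ l (𝓝 0)
  symm : H.IsSymm
  space_zero : ∀ i, W 0 i = ⊥
  space_succ : ∀ k i, W (k + 1) i = W k i ⊔ Submodule.span ℝ {g k i}
  dir_zero : ∀ i, p 0 i = 0
  dir_mem : ∀ k ≤ K, ∀ i, p k i ∈ W k i
  dir_bdd : ∀ k ≤ K, Bdd l (p k)
  dir_inv : ∀ k ≤ K, Bdd l fun i => (p k i ⬝ᵥ H *ᵥ p k i)⁻¹
  dir_eq_zero : ∀ k ≤ K, ∀ i, p k i ⬝ᵥ H *ᵥ p k i = 0 → p k i = 0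
  conj : ∀ k < K, (fun i => p k i ⬝ᵥ H *ᵥ p (k + 1) i) =O[l] τ
  decomp : ∀ k < K, ∃ ζ β : ι → ℝ, ∀ i, g k i = ζ i • p (k + 1) i + β i • p k i
  dir_of_zero : ∀ k < K, ∀ i, g k i = 0 → p (k + 1) i = 0
  res_bdd : ∀ k ≤ K, Bdd l (e k)
  ritz_prev : ∀ k < K, (fun i => p k i ⬝ᵥ e (k + 1) i) =O[l] τ
  ritz_dir : ∀ k < K, (fun i => p (k + 1) i ⬝ᵥ e (k + 1) i) =O[l] τ
  step : ∀ k < K, ∃ (γ b : ι → ℝ) (w : ι → Fin d → ℝ), (∀ᶠ i in l, w i = γ i • g k i + b i • p k i) ∧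
    Bdd l w ∧ (fun _ => (1 : ℝ)) =O[l] w ∧
    (fun i => e (k + 1) i - e k i - H *ᵥ w i) =O[l] τ
  prec_bdd : Bdd l N
  prec_symm : ∀ᶠ i in l, (N i).IsSymm
  krylov : ∀ k < K, ∃ c : ι → ℝ, ∀ᶠ i in l, g k i = c i • r k i
  res_prec : ∀ k < K, (fun i => r k i - N i *ᵥ e k i) =O[l] τ
  res_lower : ∀ k < K, (fun _ => (1 : ℝ)) =O[l] r k

theorem dotProduct_mulVec_comm {N : Matrix (Fin d) (Fin d) ℝ} (hN : N.IsSymm) (x y : Fin d → ℝ) :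
    x ⬝ᵥ N *ᵥ y = y ⬝ᵥ N *ᵥ x := by
  rw [dotProduct_mulVec, ← mulVec_transpose, hN.eq, dotProduct_comm]

namespace AsymptoticCG

variable {l : Filter ι} {τ : ι → ℝ} {H : Matrix (Fin d) (Fin d) ℝ} {K : ℕ}
    {e g r p : ℕ → ι → Fin d → ℝ} {W : ℕ → ι → Submodule ℝ (Fin d → ℝ)}
    {N : ι → Matrix (Fin d) (Fin d) ℝ}

/-- The induction hypothesis for asymptotic conjugacy. -/
structure Invariant (l : Filter ι) (τ : ι → ℝ) (H : Matrix (Fin d) (Fin d) ℝ)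
    (e p : ι → Fin d → ℝ) (W : ι → Submodule ℝ (Fin d → ℝ))
    (N : ι → Matrix (Fin d) (Fin d) ℝ) : Prop where
  orth : ∀ w : ι → Fin d → ℝ, (∀ᶠ i in l, w i ∈ W i) → Bdd l w → (fun i => w i ⬝ᵥ e i) =O[l] τ
  split : ∀ w : ι → Fin d → ℝ, (∀ᶠ i in l, w i ∈ W i) → Bdd l w →
    ∃ (w' u : ι → Fin d → ℝ) (c : ι → ℝ), Bdd l w' ∧ Bdd l u ∧ Bdd l c ∧
      (∀ᶠ i in l, w i = w' i + c i • p i) ∧ (fun i => w' i ⬝ᵥ H *ᵥ p i) =O[l] τ ∧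
      (∀ᶠ i in l, u i ∈ W i) ∧ (fun i => N i *ᵥ H *ᵥ w' i - u i) =O[l] τ
  image : ∃ (s : ι → ℝ) (u : ι → Fin d → ℝ), Bdd l s ∧ Bdd l u ∧ (∀ᶠ i in l, u i ∈ W i) ∧
    (fun i => N i *ᵥ H *ᵥ p i - s i • N i *ᵥ e i - u i) =O[l] τ

theorem invariant_zero (h : AsymptoticCG l τ H K e g r p W N) :
    Invariant l τ H (e 0) (p 0) (W 0) N := by
  have hz : ∀ w : ι → Fin d → ℝ, (∀ᶠ i in l, w i ∈ W 0 i) → ∀ᶠ i in l, w i = 0 := by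
    intro w hw
    filter_upwards [hw] with i hi
    rwa [h.space_zero, Submodule.mem_bot] at hi
  refine ⟨fun w hw _ => ?_, fun w hw _ => ⟨0, 0, 0, ?_, ?_, ?_, ?_, ?_, ?_, ?_⟩,
    ⟨0, 0, ?_, ?_, ?_, ?_⟩⟩
  · refine IsBigO.of_bound 1 ?_
    filter_upwards [hz w hw] with i hi
    simp [hi]
  · exact Bdd.const 0
  · exact Bdd.const 0
  · exact Bdd.const 0
  · filter_upwards [hz w hw] with i hi
    simp [hi]
  · simpa using isBigO_zero τ l
  · exact Eventually.of_forall fun i => by simp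
  · exact IsBigO.congr_left (f₁ := fun _ => (0 : Fin d → ℝ)) (isBigO_zero _ _) fun i => by simp
  · exact Bdd.const 0
  · exact Bdd.const 0
  · exact Eventually.of_forall fun i => by simp
  · exact IsBigO.congr_left (f₁ := fun _ => (0 : Fin d → ℝ)) (isBigO_zero _ _)
      fun i => by simp [h.dir_zero]

theorem mem_succ (h : AsymptoticCG l τ H K e g r p W N) {k : ℕ} {i : ι} {w : Fin d → ℝ}
    (hw : w ∈ W k i) : w ∈ W (k + 1) i := by
  rw [h.space_succ]
  exact Submodule.mem_sup_left hw

theorem g_mem (h : AsymptoticCG l τ H K e g r p W N) (k : ℕ) (i : ι) : g k i ∈ W (k + 1) i := by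
  rw [h.space_succ]
  exact Submodule.mem_sup_right (Submodule.mem_span_singleton_self _)

/-- The convention 0⁻¹ = 0 covers vanishing directions, so H-projections onto p_k need no case
distinction later. -/
theorem inv_mul_smul (h : AsymptoticCG l τ H K e g r p W N) {k : ℕ} (hk : k ≤ K) (i : ι) :
    ((p k i ⬝ᵥ H *ᵥ p k i)⁻¹ * (p k i ⬝ᵥ H *ᵥ p k i)) • p k i = p k i := by
  by_cases h0 : p k i ⬝ᵥ H *ᵥ p k i = 0
  · rw [h.dir_eq_zero k hk i h0, smul_zero]
  · rw [inv_mul_cancel₀ h0, one_smul]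

/-- A bounded family of multiples of p_k can have wild coefficients where p_k = 0. Replacing the
coefficient by (p_kᵀHp_k)⁻¹ wᵀHp_k makes it bounded, and then `conj` applies. This is the hypothesis
`hW` of `Bdd.of_add_smul` for the span of p_k. -/
theorem prev_conj (h : AsymptoticCG l τ H K e g r p W N) {k : ℕ} (hk : k < K) :
    ∀ w : ι → Fin d → ℝ, (∀ᶠ i in l, w i ∈ Submodule.span ℝ {p k i}) → Bdd l w →
      (fun i => w i ⬝ᵥ H *ᵥ p (k + 1) i) =O[l] τ := by
  intro w hw hb
  have hH : Bdd l (fun i => H *ᵥ p k i) := (Bdd.const H).mulVec (h.dir_bdd k hk.le)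
  have h1 := ((h.dir_inv k hk.le).mul (hb.dot hH)).mul_small (h.conj k hk)
  refine h1.congr' ?_ EventuallyEq.rfl
  filter_upwards [hw] with i hi
  obtain ⟨c, hc⟩ := Submodule.mem_span_singleton.1 hi
  have e1 : w i = ((p k i ⬝ᵥ H *ᵥ p k i)⁻¹ * (w i ⬝ᵥ H *ᵥ p k i)) • p k i := by
    conv_lhs => rw [← hc, ← h.inv_mul_smul hk.le i]
    rw [← hc, smul_dotProduct, smul_eq_mul, smul_smul]
    congr 1
    ring
  conv_rhs => rw [e1, smul_dotProduct, smul_eq_mul]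

/-- The step is dominated by a multiple of the new direction. -/
theorem step_eq (h : AsymptoticCG l τ H K e g r p W N) {k : ℕ} (hk : k < K)
    (inv : Invariant l τ H (e k) (p k) (W k) N) :
    ∃ a : ι → ℝ, Bdd l a ∧ Bdd l (fun i => (a i)⁻¹) ∧ (∀ᶠ i in l, a i ≠ 0) ∧
      (∀ᶠ i in l, p (k + 1) i ≠ 0) ∧
      (fun i => e (k + 1) i - e k i - a i • H *ᵥ p (k + 1) i) =O[l] τ := by
  obtain ⟨γ, b, w, hw, hwb, hw1, hstep⟩ := h.step k hk
  obtain ⟨ζ, β, hg⟩ := h.decomp k hk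
  have hw' : ∀ᶠ i in l, w i = (γ i * β i + b i) • p k i + (γ i * ζ i) • p (k + 1) i := by
    filter_upwards [hw] with i hi
    rw [hi, hg]
    module
  have hcd : Bdd l (fun i => (γ i * β i + b i) • p k i + (γ i * ζ i) • p (k + 1) i) :=
    hwb.congr' hw' EventuallyEq.rfl
  -- The step is rewritten in the almost conjugate pair p_k, p_{k+1}, because its parts along g_k
  -- and p_k could be large and cancel.
  obtain ⟨hu, hv, ha⟩ := Bdd.of_add_smul h.tendsto (h.dir_bdd (k + 1) hk) (h.dir_inv (k + 1) hk)
    (h.inv_mul_smul hk) (h.prev_conj hk)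
    (Eventually.of_forall fun i => Submodule.smul_mem _ _ (Submodule.mem_span_singleton_self _)) hcd
  set a : ι → ℝ := fun i => (p (k + 1) i ⬝ᵥ H *ᵥ p (k + 1) i)⁻¹ *
    (γ i * ζ i * (p (k + 1) i ⬝ᵥ H *ᵥ p (k + 1) i)) with ha_def
  have hap : ∀ i, (γ i * ζ i) • p (k + 1) i = a i • p (k + 1) i := by
    intro i
    conv_lhs => rw [← h.inv_mul_smul hk i]
    rw [smul_smul, ha_def]
    congr 1
    ring
  -- the component along the old direction is small
  have h1 : (fun i => p k i ⬝ᵥ H *ᵥ w i) =O[l] τ := by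
    -- Hw is e_{k+1} - e_k up to O(τ), and p_k is almost orthogonal to the new residual by the Ritz
    -- condition and to the old one by the invariant.
    have h2 := (h.ritz_prev k hk).sub (inv.orth (p k)
      (Eventually.of_forall (h.dir_mem k hk.le)) (h.dir_bdd k hk.le))
    have h3 := (h.dir_bdd k hk.le).dot_small hstep
    refine (h2.sub h3).congr_left fun i => ?_
    simp only [dotProduct_sub]
    ring
  have h2 : (fun i => (γ i * β i + b i) • p k i) =O[l] τ := by
    have h3 : (fun i => (γ i * β i + b i) * (p k i ⬝ᵥ H *ᵥ p k i)) =O[l] τ := by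
      refine (h1.sub (ha.mul_small (h.conj k hk))).congr' ?_ EventuallyEq.rfl
      filter_upwards [hw'] with i hi
      rw [hi, hap, mulVec_add, dotProduct_add, mulVec_smul, mulVec_smul, dotProduct_smul,
        dotProduct_smul, smul_eq_mul, smul_eq_mul]
      ring
    refine (Bdd.small_smul ((h.dir_inv k hk.le).mul_small h3) (h.dir_bdd k hk.le)).congr_left
      fun i => ?_
    conv_rhs => rw [← h.inv_mul_smul hk.le i]
    rw [smul_smul]
    congr 1
    ring
  have h3 : (fun i => w i - a i • p (k + 1) i) =O[l] τ := by
    refine h2.congr' ?_ EventuallyEq.rfl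
    filter_upwards [hw'] with i hi
    rw [hi, hap, add_sub_cancel_right]
  -- The step is bounded below and equals a p_{k+1} up to O(τ), so a cannot be small; as a = 0
  -- wherever p_{k+1} = 0, the new direction is eventually nonzero.
  obtain ⟨hne, hinv⟩ := Bdd.inv_of_sub_smul h.tendsto hw1 (h.dir_bdd (k + 1) hk) h3
  refine ⟨a, ha, hinv, hne, ?_, ?_⟩
  · filter_upwards [hne] with i hi h0
    apply hi
    simp [ha_def, h0]
  · refine (hstep.add ((Bdd.const H).mulVec_small h3)).congr_left fun i => ?_
    rw [mulVec_sub, mulVec_smul]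
    abel

/-- Multiples of the preconditioned residual belong to the next space. -/
theorem r_mem (h : AsymptoticCG l τ H K e g r p W N) {k : ℕ} (hk : k < K)
    (hp : ∀ᶠ i in l, p (k + 1) i ≠ 0) : ∀ᶠ i in l, r k i ∈ W (k + 1) i := by
  obtain ⟨c, hc⟩ := h.krylov k hk
  filter_upwards [hc, hp] with i hi hpi
  have hc0 : c i ≠ 0 := fun h0 => hpi (h.dir_of_zero k hk i (by rw [hi, h0, zero_smul]))
  have : r k i = (c i)⁻¹ • g k i := by rw [hi, smul_smul, inv_mul_cancel₀ hc0, one_smul]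
  rw [this]
  exact Submodule.smul_mem _ _ (h.g_mem k i)

theorem r_bdd (h : AsymptoticCG l τ H K e g r p W N) {k : ℕ} (hk : k < K) : Bdd l (r k) := by
  have := (Bdd.of_small h.tendsto (h.res_prec k hk)).add (h.prec_bdd.mulVec (h.res_bdd k hk.le))
  simpa using this

/-- The new direction is a bounded combination of the preconditioned residual and the old
direction. -/
theorem dir_eq (h : AsymptoticCG l τ H K e g r p W N) {k : ℕ} (hk : k < K)
    (inv : Invariant l τ H (e k) (p k) (W k) N) (hp : ∀ᶠ i in l, p (k + 1) i ≠ 0) :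
    ∃ σ b : ι → ℝ, Bdd l σ ∧ Bdd l b ∧
      ∀ᶠ i in l, p (k + 1) i = σ i • r k i + b i • p k i := by
  obtain ⟨c, hc⟩ := h.krylov k hk
  obtain ⟨ζ, β, hg⟩ := h.decomp k hk
  have hr : ∀ᶠ i in l, r k i = ((c i)⁻¹ * β i) • p k i + ((c i)⁻¹ * ζ i) • p (k + 1) i := by
    filter_upwards [hc, hp] with i hi hpi
    have hc0 : c i ≠ 0 := fun h0 => hpi (h.dir_of_zero k hk i (by rw [hi, h0, zero_smul]))
    have : r k i = (c i)⁻¹ • g k i := by rw [hi, smul_smul, inv_mul_cancel₀ hc0, one_smul]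
    rw [this, hg]
    module
  have hsum := (h.r_bdd hk).congr' hr EventuallyEq.rfl
  obtain ⟨hu, -, ha⟩ := Bdd.of_add_smul h.tendsto (h.dir_bdd (k + 1) hk) (h.dir_inv (k + 1) hk)
    (h.inv_mul_smul hk) (h.prev_conj hk)
    (Eventually.of_forall fun i => Submodule.smul_mem _ _ (Submodule.mem_span_singleton_self _))
    hsum
  have hHp : Bdd l (fun i => H *ᵥ p k i) := (Bdd.const H).mulVec (h.dir_bdd k hk.le)
  set χ : ι → ℝ := fun i => (p (k + 1) i ⬝ᵥ H *ᵥ p (k + 1) i)⁻¹ *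
    ((c i)⁻¹ * ζ i * (p (k + 1) i ⬝ᵥ H *ᵥ p (k + 1) i)) with hχ
  set b : ι → ℝ := fun i => (p k i ⬝ᵥ H *ᵥ p k i)⁻¹ *
    ((((c i)⁻¹ * β i) • p k i) ⬝ᵥ H *ᵥ p k i) with hb
  have hbb : Bdd l b := (h.dir_inv k hk.le).mul (hu.dot hHp)
  -- b and χ are projection coefficients onto the two directions; unlike the original coefficients
  -- they are known to be bounded.
  have hr' : ∀ᶠ i in l, r k i = b i • p k i + χ i • p (k + 1) i := by
    filter_upwards [hr] with i hi
    rw [hi]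
    congr 1
    · conv_lhs => rw [← h.inv_mul_smul hk.le i]
      rw [smul_smul, hb]
      simp only [smul_dotProduct, smul_eq_mul]
      congr 1
      ring
    · conv_lhs => rw [← h.inv_mul_smul hk i]
      rw [smul_smul, hχ]
      congr 1
      ring
  obtain ⟨s, u, hs, hub, humem, himg⟩ := inv.image
  have hprev : (fun i => p k i ⬝ᵥ e k i) =O[l] τ :=
    inv.orth (p k) (Eventually.of_forall (h.dir_mem k hk.le)) (h.dir_bdd k hk.le)
  -- the coefficient of the old direction
  have h1 : (fun i => b i * (p k i ⬝ᵥ H *ᵥ p k i) - χ i * (s i * (p (k + 1) i ⬝ᵥ e k i)))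
      =O[l] τ := by
    -- Without the errors the chain is b p_kᵀHp_k = p_kᵀHr_k = p_kᵀHNe_k = e_kᵀNHp_k = s e_kᵀr_k = s
    -- χ p_{k+1}ᵀe_k. It uses symmetry of N and H, the image of p_k given by the invariant, and
    -- orthogonality of e_k to u and p_k.
    have t1 : (fun i => χ i * (p k i ⬝ᵥ H *ᵥ p (k + 1) i)) =O[l] τ := ha.mul_small (h.conj k hk)
    have t2 : (fun i => (H *ᵥ p k i) ⬝ᵥ (r k i - N i *ᵥ e k i)) =O[l] τ :=
      hHp.dot_small (h.res_prec k hk)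
    have t3 := (h.res_bdd k hk.le).dot_small himg
    have t4 := inv.orth u humem hub
    have t5 : (fun i => s i * (e k i ⬝ᵥ (r k i - N i *ᵥ e k i))) =O[l] τ :=
      hs.mul_small ((h.res_bdd k hk.le).dot_small (h.res_prec k hk))
    have t6 : (fun i => s i * b i * (p k i ⬝ᵥ e k i)) =O[l] τ := (hs.mul hbb).mul_small hprev
    refine (((((t3.add t2).add t4).sub t5).add t6).sub t1).congr' ?_ EventuallyEq.rfl
    filter_upwards [hr', h.prec_symm] with i hi hN
    have f1 : (H *ᵥ p k i) ⬝ᵥ r k i =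
        b i * (p k i ⬝ᵥ H *ᵥ p k i) + χ i * (p k i ⬝ᵥ H *ᵥ p (k + 1) i) := by
      rw [hi, dotProduct_add, dotProduct_smul, dotProduct_smul, smul_eq_mul, smul_eq_mul,
        dotProduct_comm, dotProduct_comm _ (p (k + 1) i),
        dotProduct_mulVec_comm h.symm (p (k + 1) i)]
    have f2 : (H *ᵥ p k i) ⬝ᵥ N i *ᵥ e k i = e k i ⬝ᵥ N i *ᵥ H *ᵥ p k i :=
      dotProduct_mulVec_comm hN _ _
    have f3 : e k i ⬝ᵥ r k i = b i * (p k i ⬝ᵥ e k i) + χ i * (p (k + 1) i ⬝ᵥ e k i) := by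
      rw [dotProduct_comm, hi, add_dotProduct, smul_dotProduct, smul_dotProduct, smul_eq_mul,
        smul_eq_mul]
    simp only [dotProduct_sub, f1, f2, dotProduct_smul, smul_eq_mul, f3, dotProduct_comm (u i)]
    ring
  -- Both coefficients of r_k are thus controlled by χ. Since r_k is bounded below, χ⁻¹ is bounded,
  -- and the relation can be solved for p_{k+1}.
  have h2 : (fun i => r k i - χ i • (p (k + 1) i + ((p k i ⬝ᵥ H *ᵥ p k i)⁻¹ *
      (s i * (p (k + 1) i ⬝ᵥ e k i))) • p k i)) =O[l] τ := by
    refine (Bdd.small_smul ((h.dir_inv k hk.le).mul_small h1) (h.dir_bdd k hk.le)).congr' ?_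
      EventuallyEq.rfl
    filter_upwards [hr'] with i hi
    have : b i • p k i = ((p k i ⬝ᵥ H *ᵥ p k i)⁻¹ * (b i * (p k i ⬝ᵥ H *ᵥ p k i))) • p k i := by
      conv_lhs => rw [← h.inv_mul_smul hk.le i, smul_smul]
      congr 1
      ring
    rw [hi, this]
    module
  have hz : Bdd l (fun i => p (k + 1) i + ((p k i ⬝ᵥ H *ᵥ p k i)⁻¹ *
      (s i * (p (k + 1) i ⬝ᵥ e k i))) • p k i) :=
    (h.dir_bdd (k + 1) hk).add (((h.dir_inv k hk.le).mul
      (hs.mul ((h.dir_bdd (k + 1) hk).dot (h.res_bdd k hk.le)))).smul (h.dir_bdd k hk.le))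
  obtain ⟨hne, hχinv⟩ := Bdd.inv_of_sub_smul h.tendsto (h.res_lower k hk) hz h2
  refine ⟨fun i => (χ i)⁻¹, fun i => -((χ i)⁻¹ * b i), hχinv, (hχinv.mul hbb).neg_left, ?_⟩
  filter_upwards [hne, hr'] with i hi hr
  rw [hr, smul_add, smul_smul, smul_smul, inv_mul_cancel₀ hi]
  module

/-- For the part w' of the splitting, w'ᵀHr_k ≈ e_kᵀNHw' is small because NHw' is almost in W_k. As
p_{k+1} combines r_k and p_k, it is therefore almost conjugate to all of W_k. Orthogonality of
e_{k+1} ≈ e_k + a Hp_{k+1} to W_k follows, and the Ritz condition handles p_{k+1}. -/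
theorem invariant_succ (h : AsymptoticCG l τ H K e g r p W N) {k : ℕ} (hk : k < K)
    (inv : Invariant l τ H (e k) (p k) (W k) N) :
    Invariant l τ H (e (k + 1)) (p (k + 1)) (W (k + 1)) N := by
  obtain ⟨a, ha, hainv, hane, hp, hstep⟩ := h.step_eq hk inv
  obtain ⟨σ, b, hσ, hb, hdir⟩ := h.dir_eq hk inv hp
  obtain ⟨s, u, hs, hub, humem, himg⟩ := inv.image
  have hHp : Bdd l (fun i => H *ᵥ p (k + 1) i) := (Bdd.const H).mulVec (h.dir_bdd (k + 1) hk)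
  have hr := h.r_mem hk hp
  -- the new direction is almost conjugate to the old space
  have hconj : ∀ w : ι → Fin d → ℝ, (∀ᶠ i in l, w i ∈ W k i) → Bdd l w →
      (fun i => w i ⬝ᵥ H *ᵥ p (k + 1) i) =O[l] τ := by
    intro w hw hwb
    obtain ⟨w', u', c, hw', hu', hc, hweq, hwconj, hu'mem, hu'img⟩ := inv.split w hw hwb
    have hHw' : Bdd l (fun i => H *ᵥ w' i) := (Bdd.const H).mulVec hw'
    have t1 : (fun i => (H *ᵥ w' i) ⬝ᵥ (r k i - N i *ᵥ e k i)) =O[l] τ :=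
      hHw'.dot_small (h.res_prec k hk)
    have t2 := (h.res_bdd k hk.le).dot_small hu'img
    have t3 := inv.orth u' hu'mem hu'
    have t4 := hσ.mul_small ((t1.add t2).add t3)
    have t5 := hb.mul_small hwconj
    have t6 := hc.mul_small (h.conj k hk)
    refine ((t4.add t5).add t6).congr' ?_ EventuallyEq.rfl
    filter_upwards [hweq, hdir, h.prec_symm] with i h1 h2 hN
    have f1 : w' i ⬝ᵥ H *ᵥ p (k + 1) i
        = σ i * ((H *ᵥ w' i) ⬝ᵥ r k i) + b i * (w' i ⬝ᵥ H *ᵥ p k i) := by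
      rw [h2, mulVec_add, mulVec_smul, mulVec_smul, dotProduct_add, dotProduct_smul,
        dotProduct_smul, smul_eq_mul, smul_eq_mul, dotProduct_mulVec_comm h.symm (w' i) (r k i),
        dotProduct_comm (r k i)]
    have f2 : (H *ᵥ w' i) ⬝ᵥ N i *ᵥ e k i = e k i ⬝ᵥ N i *ᵥ H *ᵥ w' i :=
      dotProduct_mulVec_comm hN _ _
    rw [h1, add_dotProduct, smul_dotProduct, smul_eq_mul, f1, dotProduct_sub, dotProduct_sub, f2,
      dotProduct_comm (u' i)]
    ring
  -- bounded families in the new space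
  have hsplit : ∀ w : ι → Fin d → ℝ, (∀ᶠ i in l, w i ∈ W (k + 1) i) → Bdd l w →
      ∃ (w' : ι → Fin d → ℝ) (c : ι → ℝ), (∀ᶠ i in l, w' i ∈ W k i) ∧ Bdd l w' ∧ Bdd l c ∧
        ∀ᶠ i in l, w i = w' i + c i • p (k + 1) i := by
    intro w hw hwb
    obtain ⟨ζ, β, hg⟩ := h.decomp k hk
    have hex : ∀ i, ∃ (w' : Fin d → ℝ) (c : ℝ), w i ∈ W (k + 1) i →
        w' ∈ W k i ∧ w i = w' + c • p (k + 1) i := by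
      intro i
      by_cases hi : w i ∈ W (k + 1) i
      · rw [h.space_succ] at hi
        obtain ⟨y, hy, z, hz, hyz⟩ := Submodule.mem_sup.1 hi
        obtain ⟨c, rfl⟩ := Submodule.mem_span_singleton.1 hz
        refine ⟨y + (c * β i) • p k i, c * ζ i, fun _ =>
          ⟨Submodule.add_mem _ hy (Submodule.smul_mem _ _ (h.dir_mem k hk.le i)), ?_⟩⟩
        rw [← hyz, hg]
        module
      · exact ⟨0, 0, fun h' => absurd h' hi⟩
    choose w' c hwc using hex
    have hw'mem : ∀ᶠ i in l, w' i ∈ W k i := hw.mono fun i hi => (hwc i hi).1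
    have hweq : ∀ᶠ i in l, w i = w' i + c i • p (k + 1) i := hw.mono fun i hi => (hwc i hi).2
    -- Boundedness of the two parts comes from the conjugacy `hconj` just obtained.
    obtain ⟨h1, -, h3⟩ := Bdd.of_add_smul h.tendsto (h.dir_bdd (k + 1) hk) (h.dir_inv (k + 1) hk)
      (h.inv_mul_smul hk) hconj hw'mem (hwb.congr' hweq EventuallyEq.rfl)
    refine ⟨w', _, hw'mem, h1, h3, ?_⟩
    filter_upwards [hweq] with i hi
    rw [hi]
    congr 1
    conv_lhs => rw [← h.inv_mul_smul hk i]
    rw [smul_smul]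
    congr 1
    ring
  refine ⟨?_, ?_, ?_⟩
  · intro w hw hwb
    obtain ⟨w', c, hw'mem, hw'b, hcb, hweq⟩ := hsplit w hw hwb
    have t1 := inv.orth w' hw'mem hw'b
    have t2 := hw'b.dot_small hstep
    have t3 := ha.mul_small (hconj w' hw'mem hw'b)
    have t4 := hcb.mul_small (h.ritz_dir k hk)
    refine (((t1.add t2).add t3).add t4).congr' ?_ EventuallyEq.rfl
    filter_upwards [hweq] with i hi
    rw [hi, add_dotProduct, smul_dotProduct, smul_eq_mul, dotProduct_sub, dotProduct_sub,
      dotProduct_smul, smul_eq_mul]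
    ring
  · intro w hw hwb
    obtain ⟨w', c, hw'mem, hw'b, hcb, hweq⟩ := hsplit w hw hwb
    obtain ⟨w'', u', c', hw'', hu', hc', hw''eq, -, hu'mem, hu'img⟩ := inv.split w' hw'mem hw'b
    -- With w' = w'' + c' p_k one has NHw'' ≈ u' and NHp_k ≈ s Ne_k + u ≈ s r_k + u; the vector r_k
    -- is what enlarges W_k to W_{k+1}.
    refine ⟨w', fun i => u' i + c' i • u i + (c' i * s i) • r k i, c, hw'b,
      (hu'.add (hc'.smul hub)).add ((hc'.mul hs).smul (h.r_bdd hk)), hcb, hweq,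
      hconj w' hw'mem hw'b, ?_, ?_⟩
    · filter_upwards [hu'mem, humem, hr] with i h1 h2 h3
      exact Submodule.add_mem _ (Submodule.add_mem _ (h.mem_succ h1)
        (Submodule.smul_mem _ _ (h.mem_succ h2))) (Submodule.smul_mem _ _ h3)
    · refine ((hu'img.add (hc'.smul_small himg)).sub
        ((hc'.mul hs).smul_small (h.res_prec k hk))).congr' ?_ EventuallyEq.rfl
      filter_upwards [hw''eq] with i hi
      rw [hi, mulVec_add, mulVec_add, mulVec_smul, mulVec_smul]
      module
  -- Applying N to the residual update and dividing by a gives NHp_{k+1} ≈ a⁻¹ (Ne_{k+1} - Ne_k),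
  -- and Ne_k ≈ r_k lies in W_{k+1}.
  · refine ⟨fun i => (a i)⁻¹, fun i => -((a i)⁻¹ • r k i), hainv, (hainv.smul (h.r_bdd hk)).neg_left,
      ?_, ?_⟩
    · filter_upwards [hr] with i hi
      exact Submodule.neg_mem _ (Submodule.smul_mem _ _ hi)
    · refine ((hainv.smul_small (h.res_prec k hk)).sub
        (hainv.smul_small (h.prec_bdd.mulVec_small hstep))).congr' ?_ EventuallyEq.rfl
      filter_upwards [hane] with i hi
      rw [mulVec_sub, mulVec_sub, mulVec_smul, smul_sub, smul_sub, smul_sub, smul_smul,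
        inv_mul_cancel₀ hi]
      module

/-- The residuals are asymptotically orthogonal to the whole search space. -/
theorem orth (h : AsymptoticCG l τ H K e g r p W N) {k : ℕ} (hk : k ≤ K) :
    Invariant l τ H (e k) (p k) (W k) N := by
  induction k with
  | zero => exact h.invariant_zero
  | succ k ih => exact h.invariant_succ hk (ih (by omega))

end AsymptoticCG

end AsymptoticConjugateGradient

/-! ### The pencil (A, B): spectral bounds, Ritz pairs and coercivity. -/

section Pencil

theorem bInner_add_left {n : ℕ} (B : Matrix (Fin n) (Fin n) ℝ) (x y z : Fin n → ℝ) :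
    bInner B (x + y) z = bInner B x z + bInner B y z := add_dotProduct _ _ _

theorem bInner_add_right {n : ℕ} (B : Matrix (Fin n) (Fin n) ℝ) (x y z : Fin n → ℝ) :
    bInner B x (y + z) = bInner B x y + bInner B x z := by
  simp [bInner, mulVec_add, dotProduct_add]

theorem bInner_sub_left {n : ℕ} (B : Matrix (Fin n) (Fin n) ℝ) (x y z : Fin n → ℝ) :
    bInner B (x - y) z = bInner B x z - bInner B y z := sub_dotProduct _ _ _

theorem bInner_sub_right {n : ℕ} (B : Matrix (Fin n) (Fin n) ℝ) (x y z : Fin n → ℝ) :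
    bInner B x (y - z) = bInner B x y - bInner B x z := by
  simp [bInner, mulVec_sub, dotProduct_sub]

theorem bInner_smul_left {n : ℕ} (B : Matrix (Fin n) (Fin n) ℝ) (c : ℝ) (x y : Fin n → ℝ) :
    bInner B (c • x) y = c * bInner B x y := smul_dotProduct _ _ _

theorem bInner_smul_right {n : ℕ} (B : Matrix (Fin n) (Fin n) ℝ) (c : ℝ) (x y : Fin n → ℝ) :
    bInner B x (c • y) = c * bInner B x y := by
  simp [bInner, mulVec_smul, dotProduct_smul]

theorem bInner_comm {n : ℕ} {B : Matrix (Fin n) (Fin n) ℝ} (hB : B.IsSymm) (x y : Fin n → ℝ) :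
    bInner B x y = bInner B y x := dotProduct_mulVec_comm hB x y

theorem bInner_sub_matrix {n : ℕ} (A B : Matrix (Fin n) (Fin n) ℝ) (x y : Fin n → ℝ) :
    bInner (A - B) x y = bInner A x y - bInner B x y := by
  simp [bInner, sub_mulVec, dotProduct_sub]

theorem bInner_smul_matrix {n : ℕ} (B : Matrix (Fin n) (Fin n) ℝ) (c : ℝ) (x y : Fin n → ℝ) :
    bInner (c • B) x y = c * bInner B x y := by
  simp [bInner, smul_mulVec, dotProduct_smul]

theorem bInner_pos {n : ℕ} {B : Matrix (Fin n) (Fin n) ℝ} (hB : B.PosDef) {x : Fin n → ℝ}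
    (hx : x ≠ 0) : 0 < bInner B x x := by
  simpa [bInner] using hB.dotProduct_mulVec_pos hx

theorem bInner_self_nonneg {n : ℕ} {B : Matrix (Fin n) (Fin n) ℝ} (hB : B.PosDef)
    (x : Fin n → ℝ) : 0 ≤ bInner B x x := by
  by_cases hx : x = 0
  · simp [hx, bInner]
  · exact (bInner_pos hB hx).le

theorem isSymm_of_posDef {n : ℕ} {B : Matrix (Fin n) (Fin n) ℝ} (hB : B.PosDef) : B.IsSymm := by
  have := hB.isHermitian
  rwa [Matrix.IsHermitian, conjTranspose_eq_transpose_of_trivial] at this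

theorem norm_sq_le_dotProduct {n : ℕ} (x : Fin n → ℝ) : ‖x‖ ^ 2 ≤ x ⬝ᵥ x := by
  have h0 : 0 ≤ x ⬝ᵥ x := Finset.sum_nonneg fun i _ => mul_self_nonneg _
  have : ‖x‖ ≤ Real.sqrt (x ⬝ᵥ x) := by
    refine (pi_norm_le_iff_of_nonneg (Real.sqrt_nonneg _)).2 fun i => ?_
    refine Real.le_sqrt_of_sq_le ?_
    rw [Real.norm_eq_abs, sq_abs, sq]
    exact Finset.single_le_sum (f := fun j => x j * x j) (fun j _ => mul_self_nonneg _)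
      (Finset.mem_univ i)
  calc ‖x‖ ^ 2 ≤ Real.sqrt (x ⬝ᵥ x) ^ 2 := by gcongr
    _ = _ := Real.sq_sqrt h0

theorem dotProduct_self_le_card {n : ℕ} (x : Fin n → ℝ) : x ⬝ᵥ x ≤ n * ‖x‖ ^ 2 := by
  have := norm_dotProduct_le_card x x
  rw [sq]
  exact (le_abs_self _).trans this

variable {n : ℕ} {A B : Matrix (Fin (n + 2)) (Fin (n + 2)) ℝ} {lam : Fin (n + 2) → ℝ}
  {v : Fin (n + 2) → Fin (n + 2) → ℝ}

/-- Orthonormality says that VᵀB is a left inverse of the square matrix V of eigenvectors, hence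
also a right inverse. -/
theorem IsEigensystem.expansion (h : IsEigensystem A B lam v) (hB : B.IsSymm)
    (x : Fin (n + 2) → ℝ) : x = ∑ i, bInner B x (v i) • v i := by
  let V : Matrix (Fin (n + 2)) (Fin (n + 2)) ℝ := Matrix.of fun a i => v i a
  have h1 : (Vᵀ * B) * V = 1 := by
    ext i j
    rw [Matrix.mul_assoc, Matrix.one_apply, ← h.orthonormal i j]
    simp only [mul_apply, bInner, dotProduct, mulVec, transpose_apply, V, of_apply]
  have h2 : V * (Vᵀ * B) = 1 := mul_eq_one_comm.1 h1
  have h3 : x = V *ᵥ (Vᵀ *ᵥ (B *ᵥ x)) := by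
    rw [mulVec_mulVec, mulVec_mulVec, Matrix.mul_assoc, h2, one_mulVec]
  conv_lhs => rw [h3]
  ext a
  rw [Finset.sum_apply]
  simp only [mulVec, dotProduct, V, of_apply, transpose_apply, Pi.smul_apply, smul_eq_mul]
  refine Finset.sum_congr rfl fun i _ => ?_
  rw [bInner_comm hB, mul_comm]
  rfl

theorem IsEigensystem.bInner_expansion (h : IsEigensystem A B lam v) (hB : B.IsSymm)
    (C : Matrix (Fin (n + 2)) (Fin (n + 2)) ℝ) (x : Fin (n + 2) → ℝ) :
    bInner C x x = ∑ i, bInner B x (v i) * bInner C x (v i) := by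
  have h1 : bInner C x x = bInner C x (∑ i, bInner B x (v i) • v i) := by
    rw [← h.expansion hB x]
  rw [h1]
  simp only [bInner, mulVec_sum, dotProduct_sum, mulVec_smul, dotProduct_smul, smul_eq_mul]

theorem IsEigensystem.bInner_eq_sum (h : IsEigensystem A B lam v) (hB : B.IsSymm)
    (x : Fin (n + 2) → ℝ) : bInner B x x = ∑ i, bInner B x (v i) ^ 2 := by
  rw [h.bInner_expansion hB B x]
  exact Finset.sum_congr rfl fun i _ => (sq _).symm

theorem IsEigensystem.bInner_gap_eq_sum (h : IsEigensystem A B lam v) (hB : B.IsSymm)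
    (x : Fin (n + 2) → ℝ) :
    bInner (A - lam 0 • B) x x = ∑ i, (lam i - lam 0) * bInner B x (v i) ^ 2 := by
  rw [h.bInner_expansion hB]
  refine Finset.sum_congr rfl fun i _ => ?_
  have : bInner (A - lam 0 • B) x (v i) = (lam i - lam 0) * bInner B x (v i) := by
    simp only [bInner, sub_mulVec, smul_mulVec, h.eigen i, dotProduct_sub, dotProduct_smul,
      smul_eq_mul]
    ring
  rw [this]
  ring

theorem IsEigensystem.gap_mulVec (h : IsEigensystem A B lam v) :
    (A - lam 0 • B) *ᵥ v 0 = 0 := by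
  rw [sub_mulVec, smul_mulVec, h.eigen 0, sub_self]

theorem isSymm_sub_smul (hA : A.IsSymm) (hB : B.IsSymm) (c : ℝ) : (A - c • B).IsSymm := by
  rw [Matrix.IsSymm, transpose_sub, transpose_smul, hA.eq, hB.eq]

theorem IsEigensystem.gap_lower (h : IsEigensystem A B lam v) (hB : B.IsSymm)
    (x : Fin (n + 2) → ℝ) :
    (lam 1 - lam 0) * (bInner B x x - bInner B x (v 0) ^ 2) ≤ bInner (A - lam 0 • B) x x := by
  rw [h.bInner_gap_eq_sum hB, h.bInner_eq_sum hB,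
    Fin.sum_univ_succ fun i => (lam i - lam 0) * bInner B x (v i) ^ 2,
    Fin.sum_univ_succ fun i => bInner B x (v i) ^ 2, add_sub_cancel_left, sub_self, zero_mul, zero_add, Finset.mul_sum]
  refine Finset.sum_le_sum fun i _ => ?_
  have : lam 1 ≤ lam i.succ := h.mono (by
    rw [Fin.le_def, Fin.val_succ, Fin.val_one]
    omega)
  gcongr

theorem IsEigensystem.gap_upper (h : IsEigensystem A B lam v) (hB : B.IsSymm)
    (x : Fin (n + 2) → ℝ) :
    bInner (A - lam 0 • B) x x ≤
      (lam (Fin.last _) - lam 0) * (bInner B x x - bInner B x (v 0) ^ 2) := by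
  rw [h.bInner_gap_eq_sum hB, h.bInner_eq_sum hB,
    Fin.sum_univ_succ fun i => (lam i - lam 0) * bInner B x (v i) ^ 2,
    Fin.sum_univ_succ fun i => bInner B x (v i) ^ 2, add_sub_cancel_left, sub_self, zero_mul, zero_add, Finset.mul_sum]
  refine Finset.sum_le_sum fun i _ => ?_
  have : lam i.succ ≤ lam (Fin.last _) := h.mono (Fin.le_last _)
  gcongr

theorem IsEigensystem.gap_nonneg (h : IsEigensystem A B lam v) (hB : B.IsSymm)
    (x : Fin (n + 2) → ℝ) : 0 ≤ bInner (A - lam 0 • B) x x := by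
  rw [h.bInner_gap_eq_sum hB]
  refine Finset.sum_nonneg fun i _ => mul_nonneg ?_ (sq_nonneg _)
  have : lam 0 ≤ lam i := h.mono (Fin.zero_le _)
  linarith

theorem IsEigensystem.exists_norm_sq_le (h : IsEigensystem A B lam v) (hB : B.IsSymm) :
    ∃ C : ℝ, 0 < C ∧ ∀ x, ‖x‖ ^ 2 ≤ C * bInner B x x := by
  refine ⟨(∑ i, ‖v i‖) ^ 2 + 1, by positivity, fun x => ?_⟩
  have h0 : 0 ≤ bInner B x x := by
    rw [h.bInner_eq_sum hB]
    positivity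
  have h1 : ‖x‖ ≤ Real.sqrt (bInner B x x) * ∑ i, ‖v i‖ := by
    calc ‖x‖ = ‖∑ i, bInner B x (v i) • v i‖ := by rw [← h.expansion hB x]
      _ ≤ ∑ i, ‖bInner B x (v i) • v i‖ := norm_sum_le _ _
      _ ≤ ∑ i, Real.sqrt (bInner B x x) * ‖v i‖ := by
        refine Finset.sum_le_sum fun i _ => ?_
        rw [norm_smul]
        refine mul_le_mul_of_nonneg_right ?_ (norm_nonneg _)
        refine Real.le_sqrt_of_sq_le ?_
        rw [Real.norm_eq_abs, sq_abs, h.bInner_eq_sum hB]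
        exact Finset.single_le_sum (f := fun j => bInner B x (v j) ^ 2)
          (fun j _ => sq_nonneg _) (Finset.mem_univ i)
      _ = _ := by rw [Finset.mul_sum]
  calc ‖x‖ ^ 2 ≤ (Real.sqrt (bInner B x x) * ∑ i, ‖v i‖) ^ 2 := by gcongr
    _ = (∑ i, ‖v i‖) ^ 2 * bInner B x x := by rw [mul_pow, Real.sq_sqrt h0, mul_comm]
    _ ≤ _ := by nlinarith

theorem rayleigh_sub_eq (hB : B.PosDef) {x : Fin (n + 2) → ℝ} (hx : x ≠ 0) (c : ℝ) :
    rayleigh A B x - c = bInner (A - c • B) x x / bInner B x x := by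
  have := (bInner_pos hB hx).ne'
  rw [rayleigh, bInner_sub_matrix, bInner_smul_matrix]
  field_simp

theorem rayleigh_smul {n : ℕ} (A B : Matrix (Fin n) (Fin n) ℝ) (x : Fin n → ℝ) {c : ℝ}
    (hc : c ≠ 0) : rayleigh A B (c • x) = rayleigh A B x := by
  simp only [rayleigh, bInner_smul_left, bInner_smul_right]
  rw [← mul_assoc, ← mul_assoc, mul_div_mul_left _ _ (mul_ne_zero hc hc)]

/-- All cross terms vanish, by Hv₁ = 0 and by B-orthogonality. This identity turns the eigenproblem
near v₁ into the minimization of a quadratic form. -/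
theorem IsEigensystem.rayleigh_add_smul (h : IsEigensystem A B lam v) (hA : A.IsSymm)
    (hB : B.PosDef) {t : Fin (n + 2) → ℝ} (ht : bInner B t (v 0) = 0) (s : ℝ) :
    rayleigh A B (v 0 + s • t) - lam 0 =
      s ^ 2 * bInner (A - lam 0 • B) t t / (1 + s ^ 2 * bInner B t t) := by
  have hBs := isSymm_of_posDef hB
  have e1 : bInner B (v 0 + s • t) (v 0 + s • t) = 1 + s ^ 2 * bInner B t t := by
    have h1 := h.orthonormal 0 0
    rw [if_pos rfl] at h1
    simp only [bInner_add_left, bInner_add_right, bInner_smul_left, bInner_smul_right,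
      bInner_comm hBs (v 0) t, ht, h1]
    ring
  have e2 : bInner (A - lam 0 • B) (v 0 + s • t) (v 0 + s • t) =
      s ^ 2 * bInner (A - lam 0 • B) t t := by
    have h1 : ∀ y, bInner (A - lam 0 • B) y (v 0) = 0 := fun y => by
      rw [bInner, h.gap_mulVec, dotProduct_zero]
    simp only [bInner_add_left, bInner_add_right, bInner_smul_left, bInner_smul_right, h1,
      bInner_comm (isSymm_sub_smul hA hBs _) (v 0) t]
    ring
  have hne : v 0 + s • t ≠ 0 := by
    intro h0
    rw [h0] at e1
    have h2 : 0 ≤ s ^ 2 * bInner B t t := mul_nonneg (sq_nonneg _) (bInner_self_nonneg hB t)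
    simp [bInner] at e1
    simp only [bInner] at h2
    linarith
  rw [rayleigh_sub_eq hB hne, e1, e2]

theorem sin_bAngle_nonneg {n : ℕ} (B : Matrix (Fin n) (Fin n) ℝ) (x y : Fin n → ℝ) :
    0 ≤ Real.sin (bAngle B x y) :=
  Real.sin_nonneg_of_nonneg_of_le_pi (Real.arccos_nonneg _) (Real.arccos_le_pi _)

theorem bNorm_eq_one_iff {n : ℕ} (B : Matrix (Fin n) (Fin n) ℝ) (x : Fin n → ℝ) :
    bNorm B x = 1 ↔ bInner B x x = 1 := by
  rw [bNorm, Real.sqrt_eq_one]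

theorem IsEigensystem.sin_sq (h : IsEigensystem A B lam v) (hB : B.IsSymm)
    {x : Fin (n + 2) → ℝ} (hx : bNorm B x = 1) :
    Real.sin (bAngle B x (v 0)) ^ 2 = 1 - bInner B x (v 0) ^ 2 := by
  have h1 := h.orthonormal 0 0
  rw [if_pos rfl] at h1
  have h2 : bNorm B (v 0) = 1 := (bNorm_eq_one_iff _ _).2 h1
  have h3 : bInner B x (v 0) ^ 2 ≤ 1 := by
    have h4 := (bNorm_eq_one_iff _ _).1 hx
    rw [← h4, h.bInner_eq_sum hB x]
    exact Finset.single_le_sum (f := fun j => bInner B x (v j) ^ 2)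
      (fun j _ => sq_nonneg _) (Finset.mem_univ 0)
  rw [bAngle, hx, h2, mul_one, div_one, Real.sin_arccos, Real.sq_sqrt (by linarith)]

/-- Two-sided bound of the Rayleigh quotient by the squared sine. -/
theorem IsEigensystem.rayleigh_bounds (h : IsEigensystem A B lam v) (hB : B.PosDef)
    {x : Fin (n + 2) → ℝ} (hx : bNorm B x = 1) :
    (lam 1 - lam 0) * Real.sin (bAngle B x (v 0)) ^ 2 ≤ rayleigh A B x - lam 0 ∧
    rayleigh A B x - lam 0 ≤
      (lam (Fin.last _) - lam 0) * Real.sin (bAngle B x (v 0)) ^ 2 := by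
  have hBs := isSymm_of_posDef hB
  have h4 := (bNorm_eq_one_iff _ _).1 hx
  have hne : x ≠ 0 := by
    rintro rfl
    simp [bInner] at h4
  have h1 := h.gap_lower hBs x
  have h2 := h.gap_upper hBs x
  rw [rayleigh_sub_eq hB hne, h4, div_one, h.sin_sq hBs hx]
  rw [h4] at h1 h2
  exact ⟨h1, h2⟩

theorem exists_isRayleighMin (hB : B.PosDef) (Q : Submodule ℝ (Fin (n + 2) → ℝ))
    {u : Fin (n + 2) → ℝ} (hu : u ∈ Q) (hu0 : u ≠ 0) : ∃ y, IsRayleighMin A B Q y := by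
  have hc : IsCompact ((Q : Set (Fin (n + 2) → ℝ)) ∩ Metric.sphere 0 1) :=
    (isCompact_sphere 0 1).inter_left Q.closed_of_finiteDimensional
  have hne : ((Q : Set (Fin (n + 2) → ℝ)) ∩ Metric.sphere 0 1).Nonempty := by
    refine ⟨‖u‖⁻¹ • u, Q.smul_mem _ hu, ?_⟩
    rw [mem_sphere_zero_iff_norm, norm_smul, norm_inv, norm_norm,
      inv_mul_cancel₀ (norm_ne_zero_iff.2 hu0)]
  have hcont : ContinuousOn (rayleigh A B) ((Q : Set (Fin (n + 2) → ℝ)) ∩ Metric.sphere 0 1) := by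
    unfold rayleigh bInner
    refine ContinuousOn.div (by fun_prop) (by fun_prop) fun x hx => ?_
    have hx0 : x ≠ 0 := by
      rintro rfl
      simpa using hx.2
    exact (bInner_pos hB hx0).ne'
  obtain ⟨y, ⟨hyQ, hy1⟩, hy⟩ := hc.exists_isMinOn hne hcont
  have hy0 : y ≠ 0 := by
    rintro rfl
    simp at hy1
  refine ⟨y, hyQ, hy0, fun w hw hw0 => ?_⟩
  have hw' : ‖w‖⁻¹ • w ∈ (Q : Set (Fin (n + 2) → ℝ)) ∩ Metric.sphere 0 1 := by
    refine ⟨Q.smul_mem _ hw, ?_⟩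
    rw [mem_sphere_zero_iff_norm, norm_smul, norm_inv, norm_norm,
      inv_mul_cancel₀ (norm_ne_zero_iff.2 hw0)]
  have := hy hw'
  simpa [rayleigh_smul A B w (inv_ne_zero (norm_ne_zero_iff.2 hw0))] using this

/-- The form of A - ρ(y)B is nonnegative on Q and vanishes at y; the discriminant of t ↦ form(y + t
q) then forces the mixed term to be zero. -/
theorem IsRayleighMin.isRitzPair (hA : A.IsSymm) (hB : B.PosDef)
    {Q : Submodule ℝ (Fin (n + 2) → ℝ)} {y : Fin (n + 2) → ℝ} (hy : IsRayleighMin A B Q y) :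
    IsRitzPair A B Q (rayleigh A B y) y := by
  refine ⟨hy.1, hy.2.1, fun q hq => ?_⟩
  have hBs := isSymm_of_posDef hB
  set μ := rayleigh A B y with hμ
  set S := A - μ • B with hS
  have hSs : S.IsSymm := isSymm_sub_smul hA hBs μ
  have hpos : ∀ w ∈ Q, 0 ≤ bInner S w w := by
    intro w hw
    by_cases hw0 : w = 0
    · simp [hw0, bInner]
    · have h1 := hy.2.2 w hw hw0
      have h2 := rayleigh_sub_eq (A := A) hB hw0 μ
      have h3 := bInner_pos hB hw0
      rw [eq_div_iff h3.ne'] at h2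
      rw [hS, ← h2]
      exact mul_nonneg (by linarith) h3.le
  have h0 : bInner S y y = 0 := by
    have h2 := rayleigh_sub_eq (A := A) hB hy.2.1 μ
    rw [eq_div_iff (bInner_pos hB hy.2.1).ne', sub_self, zero_mul] at h2
    exact h2.symm
  have hquad : ∀ t : ℝ, 0 ≤ bInner S q q * (t * t) + 2 * bInner S q y * t + 0 := by
    intro t
    have := hpos (y + t • q) (Q.add_mem hy.1 (Q.smul_mem t hq))
    simp only [bInner_add_left, bInner_add_right, bInner_smul_left, bInner_smul_right, h0,
      bInner_comm hSs y q] at this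
    linarith
  have hd := discrim_le_zero hquad
  rw [discrim] at hd
  have hz : bInner S q y = 0 := by
    have : (bInner S q y) ^ 2 ≤ 0 := by nlinarith
    exact pow_eq_zero_iff (two_ne_zero) |>.1 (le_antisymm this (sq_nonneg _))
  rw [← hz, bInner, hS, sub_mulVec, smul_mulVec]

theorem IsRitzPair.rayleigh_eq (hB : B.PosDef) {Q : Submodule ℝ (Fin (n + 2) → ℝ)} {μ : ℝ}
    {z : Fin (n + 2) → ℝ} (h : IsRitzPair A B Q μ z) : rayleigh A B z = μ := by
  have h1 := h.2.2 z h.1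
  rw [dotProduct_sub, dotProduct_smul, smul_eq_mul, sub_eq_zero] at h1
  rw [rayleigh, bInner, h1]
  exact mul_div_cancel_right₀ _ (bInner_pos hB h.2.1).ne'

/-- The definition compares μ only with other Ritz values. A minimizer of the Rayleigh quotient
exists by compactness and is itself a Ritz vector. -/
theorem IsLowestRitzPair.le_rayleigh (hA : A.IsSymm) (hB : B.PosDef)
    {Q : Submodule ℝ (Fin (n + 2) → ℝ)} {μ : ℝ} {z : Fin (n + 2) → ℝ}
    (h : IsLowestRitzPair A B Q μ z) {u : Fin (n + 2) → ℝ} (hu : u ∈ Q) (hu0 : u ≠ 0) :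
    μ ≤ rayleigh A B u := by
  obtain ⟨y, hy⟩ := exists_isRayleighMin (A := A) hB Q hu hu0
  exact (h.2 _ _ (hy.isRitzPair hA hB)).trans (hy.2.2 u hu hu0)

theorem dotProduct_le_of_le_bAngle {n : ℕ} {v w : Fin n → ℝ} {δ : ℝ} (hδ : 0 < δ)
    (hδ' : δ ≤ Real.pi / 2) (hv : v ≠ 0) (hw : w ≠ 0) (h : δ ≤ bAngle 1 v w) :
    v ⬝ᵥ w ≤ Real.cos δ * (Real.sqrt (v ⬝ᵥ v) * Real.sqrt (w ⬝ᵥ w)) := by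
  have hpos : ∀ x : Fin n → ℝ, x ≠ 0 → 0 < Real.sqrt (x ⬝ᵥ x) := fun x hx =>
    Real.sqrt_pos.2 (lt_of_lt_of_le (by have := norm_pos_iff.2 hx; positivity)
      (norm_sq_le_dotProduct x))
  have h1 := mul_pos (hpos v hv) (hpos w hw)
  simp only [bAngle, bInner, bNorm, one_mulVec] at h
  set r := v ⬝ᵥ w / (Real.sqrt (v ⬝ᵥ v) * Real.sqrt (w ⬝ᵥ w)) with hr
  have hc : 0 ≤ Real.cos δ := Real.cos_nonneg_of_mem_Icc ⟨by linarith, hδ'⟩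
  -- `arccos` is constant outside [-1, 1]; treating those ranges separately avoids the
  -- Cauchy-Schwarz inequality.
  have h2 : r ≤ Real.cos δ := by
    rcases le_or_gt r (-1) with h3 | h3
    · linarith
    rcases le_or_gt 1 r with h4 | h4
    · rw [Real.arccos_eq_zero.2 h4] at h
      linarith
    rw [← Real.cos_arccos h3.le h4.le]
    exact Real.cos_le_cos_of_nonneg_of_le_pi hδ.le (Real.arccos_le_pi _) h
  rwa [hr, div_le_iff₀ h1] at h2

/-- A lower bound on the angle to the first eigenvector makes the shifted form coercive. -/
theorem IsEigensystem.exists_coercive (h : IsEigensystem A B lam v) (hA : A.IsSymm)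
    (hB : B.PosDef) (hgap : lam 0 < lam 1) {δ : ℝ} (hδ : 0 < δ) :
    ∃ c : ℝ, 0 < c ∧ ∀ W : Submodule ℝ (Fin (n + 2) → ℝ),
      (∀ w ∈ W, w ≠ 0 → δ ≤ bAngle 1 (v 0) w) →
      ∀ w ∈ W, c * ‖w‖ ^ 2 ≤ bInner (A - lam 0 • B) w w := by
  have hBs := isSymm_of_posDef hB
  obtain ⟨C, hC, hCle⟩ := h.exists_norm_sq_le hBs
  -- Capping δ keeps its cosine nonnegative, as is needed to square the bound on v₁ᵀw.
  set δ' := min δ (Real.pi / 2) with hδ'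
  have hδ0 : 0 < δ' := lt_min hδ (by positivity)
  have hδ2 : δ' ≤ Real.pi / 2 := min_le_right _ _
  have hcos0 : 0 ≤ Real.cos δ' := Real.cos_nonneg_of_mem_Icc ⟨by linarith, hδ2⟩
  have hcos1 : Real.cos δ' < 1 := by
    rw [← Real.cos_zero]
    exact Real.cos_lt_cos_of_nonneg_of_le_pi_div_two le_rfl hδ2 hδ0
  have hs : 0 < 1 - Real.cos δ' ^ 2 := by nlinarith
  have hg : 0 < lam 1 - lam 0 := by linarith
  have hv1 := h.orthonormal 0 0
  rw [if_pos rfl] at hv1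
  have hv0 : v 0 ≠ 0 := by
    intro h0
    simp [h0, bInner] at hv1
  refine ⟨(lam 1 - lam 0) * (1 - Real.cos δ' ^ 2) / ((n + 2 : ℕ) * C), by positivity,
    fun W hW w hw => ?_⟩
  by_cases hw0 : w = 0
  · simp [hw0, bInner]
  have h1 := dotProduct_le_of_le_bAngle hδ0 hδ2 hv0 hw0 ((min_le_left _ _).trans (hW w hw hw0))
  -- W also contains -w, so the bound on v₁ᵀw is two-sided.
  have h2 := dotProduct_le_of_le_bAngle hδ0 hδ2 hv0 (neg_ne_zero.2 hw0)
    ((min_le_left _ _).trans (hW (-w) (W.neg_mem hw) (neg_ne_zero.2 hw0)))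
  rw [dotProduct_neg, neg_dotProduct_neg] at h2
  have hvv : 0 < v 0 ⬝ᵥ v 0 := lt_of_lt_of_le (by have := norm_pos_iff.2 hv0; positivity)
    (norm_sq_le_dotProduct _)
  have hww : 0 < w ⬝ᵥ w := lt_of_lt_of_le (by have := norm_pos_iff.2 hw0; positivity)
    (norm_sq_le_dotProduct _)
  have h3 : (v 0 ⬝ᵥ w) ^ 2 ≤ Real.cos δ' ^ 2 * (v 0 ⬝ᵥ v 0 * (w ⬝ᵥ w)) := by
    have h4 := sq_le_sq' (by linarith) h1
    rwa [mul_pow, mul_pow, Real.sq_sqrt hvv.le, Real.sq_sqrt hww.le] at h4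
  set a := bInner B w (v 0) with ha
  set w' := w - a • v 0 with hw'
  -- w' differs from w by a multiple of v₁, so it is at least as long as the distance from w to the
  -- line of v₁, which the angle bounds from below by sin δ' times the length of w. The form of H
  -- does not see the difference, and on the B-complement of v₁ the spectral gap applies.
  have h5 : (1 - Real.cos δ' ^ 2) * (w ⬝ᵥ w) ≤ w' ⬝ᵥ w' := by
    have e1 : w' ⬝ᵥ w' = w ⬝ᵥ w - 2 * a * (v 0 ⬝ᵥ w) + a ^ 2 * (v 0 ⬝ᵥ v 0) := by
      rw [hw', sub_dotProduct, dotProduct_sub, dotProduct_sub, smul_dotProduct, dotProduct_smul,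
        smul_dotProduct, dotProduct_smul, dotProduct_comm w (v 0)]
      simp only [smul_eq_mul]
      ring
    have h6 : 0 ≤ (v 0 ⬝ᵥ v 0) * (w' ⬝ᵥ w' - (1 - Real.cos δ' ^ 2) * (w ⬝ᵥ w)) := by
      rw [e1]
      nlinarith [sq_nonneg (a * (v 0 ⬝ᵥ v 0) - v 0 ⬝ᵥ w)]
    have := nonneg_of_mul_nonneg_right h6 hvv
    linarith
  have h6 : bInner (A - lam 0 • B) w w = bInner (A - lam 0 • B) w' w' := by
    have h1 : ∀ y, bInner (A - lam 0 • B) y (v 0) = 0 := fun y => by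
      rw [bInner, h.gap_mulVec, dotProduct_zero]
    rw [hw']
    simp only [bInner_sub_left, bInner_sub_right, bInner_smul_left, bInner_smul_right, h1,
      bInner_comm (isSymm_sub_smul hA hBs _) (v 0) w]
    ring
  have h7 : bInner B w' (v 0) = 0 := by
    rw [hw', bInner_sub_left, bInner_smul_left, hv1, ← ha]
    ring
  have h8 := h.gap_lower hBs w'
  rw [h7] at h8
  have h9 := dotProduct_self_le_card w'
  have h10 := hCle w'
  have h11 := norm_sq_le_dotProduct w
  rw [h6, div_mul_eq_mul_div, div_le_iff₀ (by positivity)]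
  have hN : (0 : ℝ) < ((n + 2 : ℕ) : ℝ) := by positivity
  calc (lam 1 - lam 0) * (1 - Real.cos δ' ^ 2) * ‖w‖ ^ 2
      ≤ (lam 1 - lam 0) * (1 - Real.cos δ' ^ 2) * (w ⬝ᵥ w) := by gcongr
    _ = (lam 1 - lam 0) * ((1 - Real.cos δ' ^ 2) * (w ⬝ᵥ w)) := by ring
    _ ≤ (lam 1 - lam 0) * (((n + 2 : ℕ) : ℝ) * (C * bInner B w' w')) := by
        exact mul_le_mul_of_nonneg_left (h5.trans (h9.trans (by gcongr))) hg.le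
    _ = ((lam 1 - lam 0) * (bInner B w' w' - 0 ^ 2)) * (((n + 2 : ℕ) : ℝ) * C) := by ring
    _ ≤ bInner (A - lam 0 • B) w' w' * (((n + 2 : ℕ) : ℝ) * C) := by gcongr

end Pencil

/-! ### Krylov spaces do not degenerate unless they contain an exact solution. -/

section Nondegeneracy

theorem Continuous.bInner {X : Type*} [TopologicalSpace X] {d : ℕ} {f g : X → Fin d → ℝ}
    (hf : Continuous f) (B : Matrix (Fin d) (Fin d) ℝ) (hg : Continuous g) :
    Continuous fun x => bInner B (f x) (g x) :=
  hf.dotProduct (continuous_const.matrix_mulVec hg)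

/-- The polynomial with coefficients `q` at the matrix `Y`. -/
noncomputable def krylovPoly {d m : ℕ} (Y : Matrix (Fin d) (Fin d) ℝ) (q : Fin m → ℝ) :
    Matrix (Fin d) (Fin d) ℝ :=
  ∑ i, q i • Y ^ (i : ℕ)

theorem aeval_eq_krylovPoly {d m : ℕ} (Y : Matrix (Fin d) (Fin d) ℝ) {q : Polynomial ℝ}
    (hq : q.degree < (m : WithBot ℕ)) :
    Polynomial.aeval Y q = krylovPoly Y fun i : Fin m => q.coeff i := by
  rw [krylovPoly, Fin.sum_univ_eq_sum_range (fun i => q.coeff i • Y ^ i)]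
  by_cases h0 : q = 0
  · simp [h0]
  · exact Polynomial.aeval_eq_sum_range' ((Polynomial.natDegree_lt_iff_degree_lt h0).2 hq) Y

theorem exists_degree_lt_of_coeff {m : ℕ} (q : Fin m → ℝ) :
    ∃ P : Polynomial ℝ, P.degree < (m : WithBot ℕ) ∧ ∀ i : Fin m, P.coeff i = q i := by
  refine ⟨∑ i : Fin m, Polynomial.monomial (i : ℕ) (q i), ?_, fun i => ?_⟩
  · refine (Polynomial.degree_sum_le _ _).trans_lt ?_
    refine (Finset.sup_lt_iff (WithBot.bot_lt_coe m)).2 fun i _ => ?_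
    exact (Polynomial.degree_monomial_le _ _).trans_lt (WithBot.coe_lt_coe.2 i.2)
  · rw [Polynomial.finsetSum_coeff]
    simp only [Polynomial.coeff_monomial, Fin.val_inj]
    simp

/-- (HM)^k H = H (MH)^k. Membership in the range of H is what allows a factor HM to be cancelled in
`exists_krylov_solution`. -/
theorem aeval_mul_mulVec_mem_range {d : ℕ} (H M : Matrix (Fin d) (Fin d) ℝ) (P : Polynomial ℝ)
    (t : Fin d → ℝ) : ∃ u, Polynomial.aeval (H * M) P *ᵥ (H *ᵥ t) = H *ᵥ u := by
  induction P using Polynomial.induction_on' with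
  | add p q hp hq =>
    obtain ⟨u, hu⟩ := hp
    obtain ⟨w, hw⟩ := hq
    exact ⟨u + w, by rw [map_add, add_mulVec, hu, hw, mulVec_add]⟩
  | monomial k a =>
    have hk : (H * M) ^ k * H = H * (M * H) ^ k := by
      induction k with
      | zero => simp
      | succ k ih => rw [pow_succ', mul_assoc, ih, pow_succ']; simp only [mul_assoc]
    refine ⟨a • ((M * H) ^ k *ᵥ t), ?_⟩
    rw [Polynomial.aeval_monomial, Algebra.algebraMap_eq_smul_one, smul_mul_assoc, one_mul,
      smul_mulVec, mulVec_mulVec, hk, mulVec_smul, mulVec_mulVec]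

theorem mulVec_eq_zero_of_posDef {d : ℕ} {M : Matrix (Fin d) (Fin d) ℝ} (hM : M.PosDef)
    {y : Fin d → ℝ} (h : y ⬝ᵥ M *ᵥ y = 0) : y = 0 := by
  by_contra hy
  exact (bInner_pos hM hy).ne' h

/-- An annihilating polynomial of low degree yields an exact solution in the Krylov space. -/
theorem exists_krylov_solution {d : ℕ} {H M : Matrix (Fin d) (Fin d) ℝ} (hH : H.IsSymm)
    (hM : M.PosDef) (t : Fin d → ℝ) {m : ℕ} {P : Polynomial ℝ} (hP : P ≠ 0)
    (hdeg : P.degree < (m : WithBot ℕ)) (h0 : Polynomial.aeval (H * M) P *ᵥ (H *ᵥ t) = 0) :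
    ∃ Q : Polynomial ℝ, Q.degree < (m : WithBot ℕ) ∧
      H *ᵥ (t + M *ᵥ (Polynomial.aeval (H * M) Q *ᵥ (H *ᵥ t))) = 0 := by
  induction m generalizing P with
  | zero =>
    exfalso
    apply hP
    rw [← Polynomial.degree_lt_iff_coeff_zero P 0 |>.mp hdeg |> fun h => Polynomial.ext (q := 0)
      (fun n => by simpa using h n (Nat.zero_le n))]
  | succ m ih =>
    have hdiv := Polynomial.divX_mul_X_add P
    have hdX : P.divX.degree < (m : WithBot ℕ) := by
      refine (Polynomial.degree_lt_iff_coeff_zero _ _).2 fun k hk => ?_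
      rw [Polynomial.coeff_divX]
      exact (Polynomial.degree_lt_iff_coeff_zero P (m + 1)).1 hdeg (k + 1) (by omega)
    have haeval : Polynomial.aeval (H * M) P *ᵥ (H *ᵥ t) =
        (H * M) *ᵥ (Polynomial.aeval (H * M) P.divX *ᵥ (H *ᵥ t)) + P.coeff 0 • (H *ᵥ t) := by
      conv_lhs => rw [← hdiv, mul_comm]
      rw [map_add, map_mul, Polynomial.aeval_X, Polynomial.aeval_C,
        Algebra.algebraMap_eq_smul_one, add_mulVec, smul_mulVec, one_mulVec]
      simp only [mulVec_mulVec, mul_assoc]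
    by_cases hc : P.coeff 0 = 0
    · have hX : P.divX ≠ 0 := by
        intro h1
        apply hP
        rw [← hdiv, h1, hc]
        simp
      rw [h0, hc, zero_smul, add_zero] at haeval
      -- The factor X of P can be dropped: HMHu = 0 gives (Hu)ᵀM(Hu) = 0, hence Hu = 0, and the
      -- quotient of lower degree annihilates as well.
      obtain ⟨u, hu⟩ := aeval_mul_mulVec_mem_range H M P.divX t
      have h1 : H *ᵥ u = 0 := by
        refine mulVec_eq_zero_of_posDef hM ?_
        rw [hu, ← mulVec_mulVec] at haeval
        rw [dotProduct_comm, dotProduct_mulVec_comm hH, ← haeval, dotProduct_zero]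
      obtain ⟨Q, hQ, hQ0⟩ := ih hX hdX (hu.trans h1)
      exact ⟨Q, hQ.trans (by exact_mod_cast Nat.lt_succ_self m), hQ0⟩
    -- With P = X P' + c and c ≠ 0, annihilation reads Ht = -c⁻¹ HM P'(HM) Ht, so the correction by
    -- c⁻¹ M P'(HM) Ht cancels Ht.
    · refine ⟨(P.coeff 0)⁻¹ • P.divX, ?_, ?_⟩
      · exact (Polynomial.degree_smul_le _ _).trans_lt
          (hdX.trans (by exact_mod_cast Nat.lt_succ_self m))
      · rw [h0] at haeval
        rw [map_smul, smul_mulVec, mulVec_smul, mulVec_add, mulVec_smul, mulVec_mulVec,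
          eq_neg_of_add_eq_zero_left haeval.symm, smul_neg, smul_smul, inv_mul_cancel₀ hc, one_smul,
          add_neg_cancel]

variable {d : ℕ} (H B M : Matrix (Fin d) (Fin d) ℝ) (v : Fin d → ℝ)

/-- `(ρ(v + s t) - λ) / s ^ 2`. -/
noncomputable def scaledValue (s : ℝ) (t : Fin d → ℝ) : ℝ :=
  bInner H t t / (1 + s ^ 2 * bInner B t t)

/-- `A - ρ(v + s t) B`, where `H = A - λ B`. -/
noncomputable def scaledShift (s : ℝ) (t : Fin d → ℝ) : Matrix (Fin d) (Fin d) ℝ :=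
  H - (s ^ 2 * scaledValue H B s t) • B

/-- The eigenresidual of `v + s t`, divided by `s`. -/
noncomputable def scaledResidual (s : ℝ) (t : Fin d → ℝ) : Fin d → ℝ :=
  H *ᵥ t - (s * scaledValue H B s t) • (B *ᵥ (v + s • t))

/-- The preconditioned Krylov vector with coefficients `q`, divided by `s`. -/
noncomputable def scaledKrylov {m : ℕ} (s : ℝ) (t : Fin d → ℝ) (q : Fin m → ℝ) : Fin d → ℝ :=
  M *ᵥ (krylovPoly (scaledShift H B s t * M) q *ᵥ scaledResidual H B v s t)

/-- No vector of the affine Krylov space reduces the Rayleigh quotient by more than the factor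
`ξ`. -/
def NoFastDecrease (m : ℕ) (ξ s : ℝ) (t : Fin d → ℝ) : Prop :=
  ∀ q : Fin m → ℝ, ξ * scaledValue H B s t *
    bInner B (v + s • (t + scaledKrylov H B M v s t q)) (v + s • (t + scaledKrylov H B M v s t q)) ≤
    bInner H (t + scaledKrylov H B M v s t q) (t + scaledKrylov H B M v s t q)

variable {H B M}

/-- Continuity includes s = 0, where the scaled quantities become those of the linear problem Ht =
0; the compactness argument relies on this limit. -/
theorem continuous_scaledValue (hB : B.PosDef) {X : Type*} [TopologicalSpace X] {s : X → ℝ}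
    {t : X → Fin d → ℝ} (hs : Continuous s) (ht : Continuous t) :
    Continuous fun x => scaledValue H B (s x) (t x) := by
  unfold scaledValue
  refine Continuous.div (ht.bInner H ht)
    (continuous_const.add ((hs.pow 2).mul (ht.bInner B ht))) fun x => ?_
  have := mul_nonneg (sq_nonneg (s x)) (bInner_self_nonneg hB (t x))
  linarith

theorem continuous_scaledKrylov (hB : B.PosDef) {m : ℕ} {X : Type*} [TopologicalSpace X]
    {s : X → ℝ} {t : X → Fin d → ℝ} {q : X → Fin m → ℝ} (hs : Continuous s) (ht : Continuous t)
    (hq : Continuous q) : Continuous fun x => scaledKrylov H B M v (s x) (t x) (q x) := by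
  have h1 := continuous_scaledValue (H := H) hB hs ht
  unfold scaledKrylov krylovPoly scaledShift scaledResidual
  fun_prop

theorem isClosed_noFastDecrease (hB : B.PosDef) (m : ℕ) (ξ : ℝ) {X : Type*} [TopologicalSpace X]
    {s : X → ℝ} {t : X → Fin d → ℝ} (hs : Continuous s) (ht : Continuous t) :
    IsClosed {x | NoFastDecrease H B M v m ξ (s x) (t x)} := by
  unfold NoFastDecrease
  simp only [Set.ofPred_forall]
  refine isClosed_iInter fun q => ?_
  have h1 := continuous_scaledValue (H := H) hB hs ht
  have h2 := ht.add (continuous_scaledKrylov (H := H) (M := M) v hB hs ht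
    (continuous_const (y := q)))
  have h3 := continuous_const (y := v) |>.add (hs.smul h2)
  exact isClosed_le ((continuous_const.mul h1).mul (h3.bInner B h3)) (h2.bInner H h2)

/-- By compactness it suffices that s + ‖Krylov vector‖ is positive for unit coefficients q. If it
vanished, then s = 0 and a nonzero polynomial of low degree would annihilate Ht. By
`exists_krylov_solution` some trial vector would then have energy 0, although `NoFastDecrease`
demands at least ξ tᵀHt > 0. -/
theorem exists_scaledKrylov_lower (hH : H.IsSymm) (hB : B.PosDef) (hM : M.PosDef) (m : ℕ)
    {ξ : ℝ} (hξ : 0 < ξ) (hv : bInner B v v = 1) (C : ℝ) {a : ℝ} (ha : 0 < a) :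
    ∃ c : ℝ, 0 < c ∧ ∀ s : ℝ, 0 ≤ s → s ≤ c → ∀ t : Fin d → ℝ, ‖t‖ ≤ C → a ≤ bInner H t t →
      NoFastDecrease H B M v m ξ s t →
      ∀ q : Fin m → ℝ, c * ‖q‖ ≤ ‖scaledKrylov H B M v s t q‖ := by
  let S : Set (ℝ × (Fin d → ℝ) × (Fin m → ℝ)) :=
    (Set.Icc 0 1 ×ˢ Metric.closedBall 0 C ×ˢ Metric.sphere 0 1) ∩
      ({x | a ≤ bInner H x.2.1 x.2.1} ∩ {x | NoFastDecrease H B M v m ξ x.1 x.2.1})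
  have hcl1 : IsClosed {x : ℝ × (Fin d → ℝ) × (Fin m → ℝ) | a ≤ bInner H x.2.1 x.2.1} :=
    isClosed_le continuous_const
      ((continuous_fst.comp continuous_snd).bInner H (continuous_fst.comp continuous_snd))
  have hcl2 : IsClosed {x : ℝ × (Fin d → ℝ) × (Fin m → ℝ) |
      NoFastDecrease H B M v m ξ x.1 x.2.1} :=
    isClosed_noFastDecrease v hB m ξ continuous_fst (continuous_fst.comp continuous_snd)
  have hS : IsCompact S :=
    ((isCompact_Icc.prod ((isCompact_closedBall _ _).prod (isCompact_sphere _ _)))).inter_right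
      (hcl1.inter hcl2)
  have hpos : ∀ x ∈ S, 0 < x.1 + ‖scaledKrylov H B M v x.1 x.2.1 x.2.2‖ := by
    rintro ⟨s, t, q⟩ ⟨⟨⟨hs0, -⟩, -, hq⟩, hat, hnf⟩
    simp only [Set.mem_ofPred_eq] at hat hnf hs0 ⊢
    by_contra hle
    have hn := norm_nonneg (scaledKrylov H B M v s t q)
    have hs : s = 0 := by linarith
    have h0 : scaledKrylov H B M v s t q = 0 := norm_le_zero_iff.1 (by linarith)
    subst hs
    have hval : scaledValue H B 0 t = bInner H t t := by simp [scaledValue]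
    have hkr : ∀ q : Fin m → ℝ, scaledKrylov H B M v 0 t q =
        M *ᵥ (krylovPoly (H * M) q *ᵥ (H *ᵥ t)) := fun q => by
      simp [scaledKrylov, scaledShift, scaledResidual]
    obtain ⟨P, hPdeg, hPc⟩ := exists_degree_lt_of_coeff q
    have hPq : krylovPoly (H * M) q = Polynomial.aeval (H * M) P := by
      rw [aeval_eq_krylovPoly _ hPdeg]
      congr 1
      ext i
      exact (hPc i).symm
    have hP0 : P ≠ 0 := by
      rintro rfl
      have : q = 0 := by
        ext i
        simpa using (hPc i).symm
      rw [this] at hq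
      simp at hq
    rw [hkr, hPq] at h0
    have h1 : Polynomial.aeval (H * M) P *ᵥ (H *ᵥ t) = 0 :=
      mulVec_eq_zero_of_posDef hM (by rw [h0, dotProduct_zero])
    obtain ⟨Q, hQdeg, hQ0⟩ := exists_krylov_solution hH hM t hP0 hPdeg h1
    have h2 := hnf fun i => Q.coeff i
    rw [hval, hkr, ← aeval_eq_krylovPoly _ hQdeg] at h2
    rw [bInner, bInner, bInner, hQ0, dotProduct_zero, zero_smul, add_zero] at h2
    rw [bInner] at hv hat
    rw [hv] at h2
    have : 0 < ξ * (t ⬝ᵥ H *ᵥ t) := mul_pos hξ (by linarith)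
    linarith
  have hcont : ContinuousOn (fun x : ℝ × (Fin d → ℝ) × (Fin m → ℝ) =>
      x.1 + ‖scaledKrylov H B M v x.1 x.2.1 x.2.2‖) S :=
    (continuous_fst.add (continuous_scaledKrylov v hB continuous_fst
      (continuous_fst.comp continuous_snd) (continuous_snd.comp continuous_snd)).norm).continuousOn
  obtain ⟨c, hc0, hc⟩ : ∃ c : ℝ, 0 < c ∧ ∀ x ∈ S,
      c ≤ x.1 + ‖scaledKrylov H B M v x.1 x.2.1 x.2.2‖ := by
    rcases S.eq_empty_or_nonempty with hE | hne
    · exact ⟨1, one_pos, fun x hx => by simp [hE] at hx⟩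
    · obtain ⟨x0, hx0, hmin⟩ := hS.exists_isMinOn hne hcont
      exact ⟨_, hpos x0 hx0, fun x hx => hmin hx⟩
  -- s ≤ c / 2 leaves at least c / 2 for the Krylov vector, and s ≤ 1 places s in the compact set.
  refine ⟨min (c / 2) 1, by positivity, fun s hs0 hs t ht hat hnf q => ?_⟩
  have hs1 : s ≤ c / 2 := hs.trans (min_le_left _ _)
  have hs2 : s ≤ 1 := hs.trans (min_le_right _ _)
  by_cases hq : q = 0
  · simp [hq]
  have hqn : 0 < ‖q‖ := norm_pos_iff.2 hq
  have h1 := hc (s, t, ‖q‖⁻¹ • q) ⟨⟨⟨hs0, hs2⟩, by simpa using ht, by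
    rw [mem_sphere_zero_iff_norm, norm_smul, norm_inv, norm_norm, inv_mul_cancel₀ hqn.ne']⟩,
    hat, hnf⟩
  have h2 : scaledKrylov H B M v s t (‖q‖⁻¹ • q) = ‖q‖⁻¹ • scaledKrylov H B M v s t q := by
    simp only [scaledKrylov, krylovPoly, Pi.smul_apply, smul_assoc, ← Finset.smul_sum, smul_mulVec,
      mulVec_smul]
  simp only [h2, norm_smul, norm_inv, norm_norm] at h1
  have h3 : c / 2 ≤ ‖q‖⁻¹ * ‖scaledKrylov H B M v s t q‖ := by linarith
  calc min (c / 2) 1 * ‖q‖ ≤ c / 2 * ‖q‖ := by gcongr; exact min_le_left _ _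
    _ ≤ ‖q‖⁻¹ * ‖scaledKrylov H B M v s t q‖ * ‖q‖ := by gcongr
    _ = _ := by field_simp

end Nondegeneracy

/-! ### Scaled errors, residuals and Krylov vectors near the first eigenvector. -/

section ScaledError

variable {n : ℕ} {A B M : Matrix (Fin (n + 2)) (Fin (n + 2)) ℝ} {lam : Fin (n + 2) → ℝ}
  {v : Fin (n + 2) → Fin (n + 2) → ℝ}

/-- The vector `t` with `y = (y, v)_B (v + s t)`. -/
noncomputable def scaledError {d : ℕ} (B : Matrix (Fin d) (Fin d) ℝ) (v : Fin d → ℝ) (s : ℝ)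
    (y : Fin d → ℝ) : Fin d → ℝ :=
  s⁻¹ • ((bInner B y v)⁻¹ • y - v)

/-- A vector B-orthogonal to v₁ has Rayleigh quotient at least λ₂. -/
theorem IsEigensystem.bInner_ne_zero (h : IsEigensystem A B lam v) (hB : B.PosDef)
    {y : Fin (n + 2) → ℝ} (hy : y ≠ 0) (hlt : rayleigh A B y < lam 1) :
    bInner B y (v 0) ≠ 0 := by
  intro h0
  have h1 := h.gap_lower (isSymm_of_posDef hB) y
  have h2 := bInner_pos hB hy
  have h3 := rayleigh_sub_eq (A := A) hB hy (lam 0)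
  rw [eq_div_iff h2.ne'] at h3
  rw [h0, ← h3] at h1
  nlinarith

theorem add_smul_scaledError {d : ℕ} (B : Matrix (Fin d) (Fin d) ℝ) (v : Fin d → ℝ) {s : ℝ}
    (hs : s ≠ 0) (y : Fin d → ℝ) :
    v + s • scaledError B v s y = (bInner B y v)⁻¹ • y := by
  rw [scaledError, smul_smul, mul_inv_cancel₀ hs, one_smul, add_sub_cancel]

theorem IsEigensystem.bInner_scaledError (h : IsEigensystem A B lam v) (s : ℝ)
    {y : Fin (n + 2) → ℝ} (hy : bInner B y (v 0) ≠ 0) :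
    bInner B (scaledError B (v 0) s y) (v 0) = 0 := by
  have h1 := h.orthonormal 0 0
  rw [if_pos rfl] at h1
  rw [scaledError, bInner_smul_left, bInner_sub_left, bInner_smul_left, h1, inv_mul_cancel₀ hy,
    sub_self, mul_zero]

theorem IsEigensystem.rayleigh_eq_scaledValue (h : IsEigensystem A B lam v) (hA : A.IsSymm)
    (hB : B.PosDef) {s : ℝ} (hs : s ≠ 0) {y : Fin (n + 2) → ℝ} (hy : bInner B y (v 0) ≠ 0) :
    rayleigh A B y - lam 0 =
      s ^ 2 * scaledValue (A - lam 0 • B) B s (scaledError B (v 0) s y) := by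
  have h1 := h.rayleigh_add_smul hA hB (h.bInner_scaledError s hy) s
  rw [add_smul_scaledError B (v 0) hs, rayleigh_smul A B y (inv_ne_zero hy)] at h1
  rw [h1, scaledValue, mul_div_assoc]

/-- This solves `rayleigh_eq_scaledValue` for the energy tᵀHt. Along the runs the second summand is
negligible, so energies and Rayleigh errors divided by s² can be exchanged. -/
theorem IsEigensystem.bInner_gap_scaledError (h : IsEigensystem A B lam v) (hA : A.IsSymm)
    (hB : B.PosDef) {s : ℝ} (hs : s ≠ 0) {y : Fin (n + 2) → ℝ} (hy : bInner B y (v 0) ≠ 0) :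
    bInner (A - lam 0 • B) (scaledError B (v 0) s y) (scaledError B (v 0) s y) =
      (rayleigh A B y - lam 0) / s ^ 2 + (rayleigh A B y - lam 0) *
        bInner B (scaledError B (v 0) s y) (scaledError B (v 0) s y) := by
  rw [h.rayleigh_eq_scaledValue hA hB hs hy, scaledValue]
  have := mul_nonneg (sq_nonneg s) (bInner_self_nonneg hB (scaledError B (v 0) s y))
  have h2 : 1 + s ^ 2 * bInner B (scaledError B (v 0) s y) (scaledError B (v 0) s y) ≠ 0 := by
    positivity
  field_simp

theorem IsEigensystem.exists_scaledError_le (h : IsEigensystem A B lam v) (hA : A.IsSymm)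
    (hB : B.PosDef) (hgap : lam 0 < lam 1) : ∃ C s₀ : ℝ, 0 < s₀ ∧ ∀ s : ℝ, s ≠ 0 → |s| ≤ s₀ →
      ∀ y : Fin (n + 2) → ℝ, bInner B y (v 0) ≠ 0 →
      rayleigh A B y - lam 0 ≤ (lam (Fin.last _) - lam 0) * s ^ 2 →
      ‖scaledError B (v 0) s y‖ ≤ C := by
  have hBs := isSymm_of_posDef hB
  obtain ⟨C, hC, hCle⟩ := h.exists_norm_sq_le hBs
  set Λ := lam (Fin.last _) - lam 0 with hΛ
  set γ := lam 1 - lam 0 with hγ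
  have hγ0 : 0 < γ := by linarith
  have hΛ0 : 0 < Λ := by
    have : lam 1 ≤ lam (Fin.last _) := h.mono (Fin.le_last _)
    linarith
  -- The threshold for s makes Λ s² ≤ γ / 2. Then γ b ≤ Λ + Λ s² b ≤ Λ + γ b / 2 for the squared
  -- B-norm b of the scaled error.
  refine ⟨Real.sqrt (C * (2 * Λ / γ)), Real.sqrt (γ / (2 * Λ)), by positivity,
    fun s hs hs0 y hy hle => ?_⟩
  have h1 := h.bInner_gap_scaledError hA hB hs hy
  have h2 := h.gap_lower hBs (scaledError B (v 0) s y)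
  rw [h.bInner_scaledError s hy] at h2
  have hb := bInner_self_nonneg hB (scaledError B (v 0) s y)
  set b := bInner B (scaledError B (v 0) s y) (scaledError B (v 0) s y)
  have hs2 : 0 < s ^ 2 := by positivity
  have h3 : (rayleigh A B y - lam 0) / s ^ 2 ≤ Λ := by rwa [div_le_iff₀ hs2]
  have h4 : s ^ 2 ≤ γ / (2 * Λ) := by
    rw [← sq_abs, ← Real.sq_sqrt (by positivity : 0 ≤ γ / (2 * Λ))]
    gcongr
  have h5 : Λ * s ^ 2 ≤ γ / 2 := by
    calc Λ * s ^ 2 ≤ Λ * (γ / (2 * Λ)) := by gcongr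
      _ = γ / 2 := by field_simp
  have h6 : (rayleigh A B y - lam 0) * b ≤ γ / 2 * b := by
    gcongr
    linarith
  have h7 : b ≤ 2 * Λ / γ := by
    rw [le_div_iff₀ hγ0]
    nlinarith
  refine Real.le_sqrt_of_sq_le ((hCle _).trans ?_)
  gcongr

theorem IsEigensystem.eigResidual_eq (h : IsEigensystem A B lam v) (hA : A.IsSymm)
    (hB : B.PosDef) {s : ℝ} (hs : s ≠ 0) {y : Fin (n + 2) → ℝ} (hy : bInner B y (v 0) ≠ 0) :
    eigResidual A B y = (bInner B y (v 0) * s) •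
      scaledResidual (A - lam 0 • B) B (v 0) s (scaledError B (v 0) s y) := by
  have hρ := h.rayleigh_eq_scaledValue hA hB hs hy
  have e1 : y = bInner B y (v 0) • (v 0 + s • scaledError B (v 0) s y) := by
    rw [add_smul_scaledError B (v 0) hs, smul_smul, mul_inv_cancel₀ hy, one_smul]
  set t := scaledError B (v 0) s y
  have e2 : shifted A B y = (A - lam 0 • B) - (s ^ 2 * scaledValue (A - lam 0 • B) B s t) • B := by
    rw [shifted, ← hρ]
    module
  rw [eigResidual, e2]
  conv_lhs => arg 2; rw [e1]
  rw [scaledResidual, mulVec_smul, sub_mulVec, mulVec_add, h.gap_mulVec, zero_add, mulVec_smul,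
    smul_mulVec]
  module

theorem IsEigensystem.shifted_eq (h : IsEigensystem A B lam v) (hA : A.IsSymm)
    (hB : B.PosDef) {s : ℝ} (hs : s ≠ 0) {y : Fin (n + 2) → ℝ} (hy : bInner B y (v 0) ≠ 0) :
    shifted A B y = scaledShift (A - lam 0 • B) B s (scaledError B (v 0) s y) := by
  have hρ := h.rayleigh_eq_scaledValue hA hB hs hy
  rw [shifted, scaledShift, ← hρ]
  module

/-- The Krylov part of the trial vectors, in scaled form. -/
theorem IsEigensystem.polyPrec_mulVec (h : IsEigensystem A B lam v) (hA : A.IsSymm)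
    (hB : B.PosDef) {s : ℝ} (hs : s ≠ 0) {y : Fin (n + 2) → ℝ} (hy : bInner B y (v 0) ≠ 0)
    {m : ℕ} {q : Polynomial ℝ} (hq : q.degree < (m : WithBot ℕ)) :
    polyPrec A B M q y *ᵥ scaledResidual (A - lam 0 • B) B (v 0) s (scaledError B (v 0) s y) =
      scaledKrylov (A - lam 0 • B) B M (v 0) s (scaledError B (v 0) s y)
        fun i : Fin m => q.coeff i := by
  rw [polyPrec, scaledKrylov, aeval_eq_krylovPoly _ hq, h.shifted_eq hA hB hs hy, mulVec_mulVec]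

theorem IsEigensystem.scaledKrylov_mem (h : IsEigensystem A B lam v) (hA : A.IsSymm)
    (hB : B.PosDef) {s : ℝ} (hs : s ≠ 0) {y : Fin (n + 2) → ℝ} (hy : bInner B y (v 0) ≠ 0)
    {m : ℕ} (q : Fin m → ℝ) :
    s • scaledKrylov (A - lam 0 • B) B M (v 0) s (scaledError B (v 0) s y) q ∈
      precKrylov A B M m y := by
  have e : s • scaledKrylov (A - lam 0 • B) B M (v 0) s (scaledError B (v 0) s y) q =
      (bInner B y (v 0))⁻¹ • ∑ i : Fin m,
        q i • (M *ᵥ (((shifted A B y * M) ^ (i : ℕ)) *ᵥ eigResidual A B y)) := by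
    rw [h.eigResidual_eq hA hB hs hy, h.shifted_eq hA hB hs hy, scaledKrylov, krylovPoly]
    simp only [sum_mulVec, mulVec_sum, smul_mulVec, mulVec_smul, Finset.smul_sum]
    refine Finset.sum_congr rfl fun i _ => ?_
    rw [smul_smul, smul_smul, smul_smul]
    congr 1
    field_simp
  rw [e]
  refine Submodule.smul_mem _ _ (Submodule.sum_mem _ fun i _ => Submodule.smul_mem _ _ ?_)
  exact Submodule.subset_span ⟨i, rfl⟩

/-- Every v₁ + s w considered is a trial vector in Q, so its Rayleigh quotient is at least μ;
clearing the denominator and the factor s² gives the claim. -/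
theorem IsEigensystem.noFastDecrease (h : IsEigensystem A B lam v) (hA : A.IsSymm)
    (hB : B.PosDef) {s : ℝ} (hs : s ≠ 0) {y : Fin (n + 2) → ℝ} (hy : bInner B y (v 0) ≠ 0)
    {m : ℕ} {ξ μ : ℝ} (hμ : ξ * (rayleigh A B y - lam 0) ≤ μ - lam 0)
    {Q : Submodule ℝ (Fin (n + 2) → ℝ)} (hyQ : y ∈ Q) (hKQ : precKrylov A B M m y ≤ Q)
    (hQ : ∀ u ∈ Q, u ≠ 0 → μ ≤ rayleigh A B u) :
    NoFastDecrease (A - lam 0 • B) B M (v 0) m ξ s (scaledError B (v 0) s y) := by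
  intro q
  have hBs := isSymm_of_posDef hB
  have hmem := hKQ (h.scaledKrylov_mem (M := M) hA hB hs hy q)
  have hval := h.rayleigh_eq_scaledValue hA hB hs hy
  set t := scaledError B (v 0) s y with ht
  set w := t + scaledKrylov (A - lam 0 • B) B M (v 0) s t q with hw
  have hV : v 0 + s • w ∈ Q := by
    rw [hw, smul_add, ← add_assoc, ht, add_smul_scaledError B (v 0) hs]
    exact Q.add_mem (Q.smul_mem _ hyQ) hmem
  by_cases hV0 : v 0 + s • w = 0
  · rw [hV0]
    have := h.gap_nonneg hBs w
    simpa [bInner] using this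
  have h1 := hQ _ hV hV0
  have h2 := rayleigh_sub_eq (A := A) hB hV0 (lam 0)
  have h3 := bInner_pos hB hV0
  rw [eq_div_iff h3.ne'] at h2
  have e2 : bInner (A - lam 0 • B) (v 0 + s • w) (v 0 + s • w) =
      s ^ 2 * bInner (A - lam 0 • B) w w := by
    have h1 : ∀ y, bInner (A - lam 0 • B) y (v 0) = 0 := fun y => by
      rw [bInner, h.gap_mulVec, dotProduct_zero]
    simp only [bInner_add_left, bInner_add_right, bInner_smul_left, bInner_smul_right, h1,
      bInner_comm (isSymm_sub_smul hA hBs _) (v 0) w]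
    ring
  rw [e2] at h2
  have hs2 : 0 < s ^ 2 := by positivity
  have h4 : ξ * (s ^ 2 * scaledValue (A - lam 0 • B) B s t) * bInner B (v 0 + s • w) (v 0 + s • w)
      ≤ s ^ 2 * bInner (A - lam 0 • B) w w := by
    rw [← h2, ← hval]
    gcongr
    linarith
  refine le_of_mul_le_mul_left ?_ hs2
  calc _ = _ := by ring
    _ ≤ _ := h4

/-- The product M (SM)^k reads the same backwards. Symmetry is the only structural property of the
preconditioner that the conjugate gradient argument uses. -/
theorem polyPrec_isSymm {d : ℕ} {A B M : Matrix (Fin d) (Fin d) ℝ} (hA : A.IsSymm)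
    (hB : B.IsSymm) (hM : M.IsSymm) (q : Polynomial ℝ) (x : Fin d → ℝ) :
    (polyPrec A B M q x).IsSymm := by
  have hS : (shifted A B x)ᵀ = shifted A B x := by
    rw [shifted, transpose_sub, transpose_smul, hA.eq, hB.eq]
  rw [polyPrec]
  induction q using Polynomial.induction_on' with
  | add p q hp hq => rw [map_add, mul_add]; exact hp.add hq
  | monomial k a =>
    rw [Polynomial.aeval_monomial, Algebra.algebraMap_eq_smul_one, smul_mul_assoc, one_mul,
      mul_smul_comm]
    refine Matrix.IsSymm.smul ?_ a
    rw [Matrix.IsSymm, transpose_mul, transpose_pow, transpose_mul, hS, hM.eq]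
    induction k with
    | zero => simp
    | succ k ih => rw [pow_succ, mul_assoc, mul_assoc, ← mul_assoc _ _ M, ← mul_assoc,
        ← mul_assoc, ih, pow_succ]; simp only [mul_assoc]

end ScaledError

/-! ### Elementary properties of a single run. -/

section Runs

variable {n : ℕ} {A B M : Matrix (Fin n) (Fin n) ℝ} {m K : ℕ} {x g p : ℕ → Fin n → ℝ}

theorem spaceW_zero (g : ℕ → Fin n → ℝ) : spaceW g 0 = ⊥ := by
  have : Set.Iio 0 = (∅ : Set ℕ) := by ext; simp
  rw [spaceW, this, Set.image_empty, Submodule.span_empty]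

theorem spaceW_succ (g : ℕ → Fin n → ℝ) (k : ℕ) :
    spaceW g (k + 1) = spaceW g k ⊔ Submodule.span ℝ {g k} := by
  have : Set.Iio (k + 1) = insert k (Set.Iio k) := by
    ext j
    simp only [Set.mem_Iio, Set.mem_insert_iff]
    omega
  rw [spaceW, this, Set.image_insert_eq, Submodule.span_insert, sup_comm, spaceW]

theorem spaceW_mono (g : ℕ → Fin n → ℝ) {j k : ℕ} (h : j ≤ k) : spaceW g j ≤ spaceW g k :=
  Submodule.span_mono (Set.image_mono (Set.Iio_subset_Iio h))

theorem mem_spaceW (g : ℕ → Fin n → ℝ) {j k : ℕ} (h : j < k) : g j ∈ spaceW g k :=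
  Submodule.subset_span ⟨j, h, rfl⟩

theorem bNorm_inv_smul_self (hB : B.PosDef) {z : Fin n → ℝ} (hz : z ≠ 0) :
    bInner B ((bNorm B z)⁻¹ • z) ((bNorm B z)⁻¹ • z) = 1 := by
  have h1 := bInner_pos hB hz
  have h2 : bNorm B z ^ 2 = bInner B z z := Real.sq_sqrt h1.le
  have h3 : bNorm B z ≠ 0 := (Real.sqrt_pos.2 h1).ne'
  rw [bInner_smul_left, bInner_smul_right, ← h2]
  field_simp

theorem bNorm_pos (hB : B.PosDef) {z : Fin n → ℝ} (hz : z ≠ 0) : 0 < bNorm B z :=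
  Real.sqrt_pos.2 (bInner_pos hB hz)

theorem IsPLRun.bInner_self (h : IsPLRun A B M m K x g p) (hB : B.PosDef) {k : ℕ} (hk : k ≤ K) :
    bInner B (x k) (x k) = 1 := by
  cases k with
  | zero => exact (bNorm_eq_one_iff B _).1 h.init
  | succ k =>
    obtain ⟨μ, z, α, β, hz, -, -, hx⟩ := h.step k hk
    rw [hx]
    exact bNorm_inv_smul_self hB hz.1.2.1

theorem IsPLRun.ne_zero (h : IsPLRun A B M m K x g p) (hB : B.PosDef) {k : ℕ} (hk : k ≤ K) :
    x k ≠ 0 := by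
  intro h0
  have := h.bInner_self hB hk
  simp [h0, bInner] at this

theorem IsPLRun.rawDir_eq (h : IsPLRun A B M m K x g p) (hB : B.PosDef) {k : ℕ} (hk : k < K) :
    rawDir A B x g p k = bNorm B (rawDir A B x g p k) • p k := by
  by_cases h0 : rawDir A B x g p k = 0
  · rw [h.dir k hk, h0]
    simp
  · conv_rhs => rw [h.dir k hk]
    rw [smul_smul, mul_inv_cancel₀ (bNorm_pos hB h0).ne', one_smul]

theorem IsPLRun.dir_eq_zero_or (h : IsPLRun A B M m K x g p) (hB : B.PosDef) {k : ℕ}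
    (hk : k ≤ K) : prevDir p k = 0 ∨ bInner B (prevDir p k) (prevDir p k) = 1 := by
  cases k with
  | zero => exact Or.inl rfl
  | succ k =>
    have e : prevDir p (k + 1) = p k := rfl
    rw [e, h.dir k hk]
    by_cases h0 : rawDir A B x g p k = 0
    · exact Or.inl (by rw [h0, smul_zero])
    · exact Or.inr (bNorm_inv_smul_self hB h0)

theorem IsPLRun.prevDir_mem (h : IsPLRun A B M m K x g p) {k : ℕ} (hk : k ≤ K) :
    prevDir p k ∈ spaceW g k := by
  induction k with
  | zero => exact Submodule.zero_mem _
  | succ k ih =>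
    have e : prevDir p (k + 1) = p k := rfl
    rw [e, h.dir k hk, rawDir]
    exact Submodule.smul_mem _ _ (Submodule.sub_mem _ (mem_spaceW g k.lt_succ_self)
      (Submodule.smul_mem _ _ (spaceW_mono g k.le_succ (ih (by omega)))))

theorem IsPLRun.exists_step (h : IsPLRun A B M m K x g p) {k : ℕ} (hk : k < K) :
    ∃ α γ b : ℝ, x (k + 1) = α • x k + (γ • g k + b • prevDir p k) := by
  obtain ⟨μ, z, α, β, -, -, hz, hx⟩ := h.step k hk
  refine ⟨(bNorm B z)⁻¹ * α, (bNorm B z)⁻¹, (bNorm B z)⁻¹ * β, ?_⟩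
  rw [hx, hz]
  module

theorem IsPLRun.mem_spaceU (h : IsPLRun A B M m K x g p) {k : ℕ} (hk : k ≤ K) :
    x k ∈ spaceU x g k := by
  induction k with
  | zero => exact Submodule.mem_sup_left (Submodule.mem_span_singleton_self _)
  | succ k ih =>
    obtain ⟨α, γ, b, e⟩ := h.exists_step hk
    have hle : spaceU x g k ≤ spaceU x g (k + 1) :=
      sup_le_sup_left (spaceW_mono g k.le_succ) _
    rw [e]
    refine Submodule.add_mem _ (Submodule.smul_mem _ _ (hle (ih (by omega))))
      (Submodule.mem_sup_right (Submodule.add_mem _ (Submodule.smul_mem _ _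
        (mem_spaceW g k.lt_succ_self)) (Submodule.smul_mem _ _ ?_)))
    exact spaceW_mono g k.le_succ (h.prevDir_mem (by omega))

end Runs

/-- The trial space also contains p_k, a combination of g_k and p_{k-1}; hence the new residual is
orthogonal to both the old and the new direction. -/
theorem IsPLRun.ritz {n : ℕ} {A B M : Matrix (Fin (n + 2)) (Fin (n + 2)) ℝ} {m K : ℕ}
    {x g p : ℕ → Fin (n + 2) → ℝ} (h : IsPLRun A B M m K x g p) (hA : A.IsSymm)
    (hB : B.PosDef) {k : ℕ} (hk : k < K) : ∃ Q : Submodule ℝ (Fin (n + 2) → ℝ),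
      x k ∈ Q ∧ precKrylov A B M m (x k) ≤ Q ∧ prevDir p k ∈ Q ∧ p k ∈ Q ∧
      (∀ q ∈ Q, q ⬝ᵥ (shifted A B (x (k + 1)) *ᵥ x (k + 1)) = 0) ∧
      ∀ u ∈ Q, u ≠ 0 → rayleigh A B (x (k + 1)) ≤ rayleigh A B u := by
  obtain ⟨μ, z, α, β, hz, hg, -, hx⟩ := h.step k hk
  have hb : (bNorm B z)⁻¹ ≠ 0 := inv_ne_zero (bNorm_pos hB hz.1.2.1).ne'
  have hμ : rayleigh A B (x (k + 1)) = μ := by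
    rw [hx, rayleigh_smul A B z hb, hz.1.rayleigh_eq hB]
  set Q := Submodule.span ℝ {x k} ⊔ precKrylov A B M m (x k) ⊔ Submodule.span ℝ {prevDir p k}
  have hK : precKrylov A B M m (x k) ≤ Q := le_sup_right.trans le_sup_left
  have hp : prevDir p k ∈ Q := Submodule.mem_sup_right (Submodule.mem_span_singleton_self _)
  refine ⟨Q, Submodule.mem_sup_left (Submodule.mem_sup_left
    (Submodule.mem_span_singleton_self _)), hK, hp, ?_, fun q hq => ?_, fun u hu hu0 => ?_⟩
  · rw [h.dir k hk, rawDir]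
    exact Q.smul_mem _ (Q.sub_mem (hK hg) (Q.smul_mem _ hp))
  · have h1 := hz.1.2.2 q hq
    rw [shifted, hμ, hx, mulVec_smul, dotProduct_smul, sub_mulVec, smul_mulVec, h1, smul_zero]
  · rw [hμ]
    exact hz.le_rayleigh hA hB hu hu0

/-! ### Families of runs with common constants, and uniform bounds on scaled errors. -/

section Family

open Asymptotics
open scoped Matrix.Norms.Operator

/-- A family of runs satisfying the assumptions of the quasi-optimality theorem with common
constants. -/
structure PLFamily {n : ℕ} {ι : Type*} (A B M : Matrix (Fin (n + 2)) (Fin (n + 2)) ℝ)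
    (lam : Fin (n + 2) → ℝ) (v : Fin (n + 2) → Fin (n + 2) → ℝ) (m K : ℕ)
    (x g p : ι → ℕ → Fin (n + 2) → ℝ) (ξ ξ' δ η κ ε : ℝ) : Prop where
  symmA : A.IsSymm
  posB : B.PosDef
  posM : M.PosDef
  eig : IsEigensystem A B lam v
  gap : lam 0 < lam 1
  run : ∀ i, IsPLRun A B M m K (x i) (g i) (p i)
  rate_pos : 0 < ξ
  rate_lt : ξ < ξ'
  rate_lt_one : ξ' < 1
  lin : ∀ i, LinearConvergence A B (lam 0) (lam 1) ξ ξ' K (x i)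
  angle_pos : 0 < δ
  angle : ∀ i, AngleBound (v 0) δ K (g i)
  scale_pos : 0 < η
  eps_pos : 0 < ε
  poly : ∀ i, bAngle B (x i 0) (v 0) < ε → SamePolynomial A B M (v 0) m η κ K (x i) (g i)

/-- The filter of small initial angles. -/
noncomputable def angleFilter {d : ℕ} {ι : Type*} (B : Matrix (Fin d) (Fin d) ℝ) (v : Fin d → ℝ)
    (x : ι → ℕ → Fin d → ℝ) : Filter ι :=
  comap (fun i => bAngle B (x i 0) v) (𝓝 0)

/-- The sine of the initial angle. -/
noncomputable def initialSin {d : ℕ} {ι : Type*} (B : Matrix (Fin d) (Fin d) ℝ) (v : Fin d → ℝ)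
    (x : ι → ℕ → Fin d → ℝ) (i : ι) : ℝ :=
  Real.sin (bAngle B (x i 0) v)

theorem tendsto_initialSin {d : ℕ} {ι : Type*} (B : Matrix (Fin d) (Fin d) ℝ) (v : Fin d → ℝ)
    (x : ι → ℕ → Fin d → ℝ) : Tendsto (initialSin B v x) (angleFilter B v x) (𝓝 0) := by
  have h : Tendsto Real.sin (𝓝 0) (𝓝 0) := by
    simpa using Real.continuous_sin.tendsto 0
  exact h.comp tendsto_comap

theorem matrix_norm_le_of_entry {d : ℕ} (N : Matrix (Fin d) (Fin d) ℝ) {c : ℝ} (hc : 0 ≤ c)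
    (h : ∀ a b, |N a b| ≤ c) : ‖N‖ ≤ d * c := by
  lift c to NNReal using hc
  rw [linfty_opNorm_def]
  have : (Finset.univ.sup fun i : Fin d => ∑ j, ‖N i j‖₊) ≤ (d : NNReal) * c := by
    refine Finset.sup_le fun i _ => ?_
    have h1 : ∀ j, ‖N i j‖₊ ≤ c := fun j => NNReal.coe_le_coe.1 (h i j)
    calc ∑ j, ‖N i j‖₊ ≤ ∑ _j : Fin d, c := Finset.sum_le_sum fun j _ => h1 j
      _ = d * c := by simp
  exact_mod_cast this

theorem entry_le_matrix_norm {d : ℕ} (N : Matrix (Fin d) (Fin d) ℝ) (a b : Fin d) :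
    |N a b| ≤ ‖N‖ := by
  rw [linfty_opNorm_def]
  have h1 : ‖N a b‖₊ ≤ ∑ j, ‖N a j‖₊ :=
    Finset.single_le_sum (f := fun j => ‖N a j‖₊) (fun _ _ => zero_le) (Finset.mem_univ b)
  have h2 : (∑ j, ‖N a j‖₊) ≤ Finset.univ.sup fun i : Fin d => ∑ j, ‖N i j‖₊ :=
    Finset.le_sup (f := fun i => ∑ j, ‖N i j‖₊) (Finset.mem_univ a)
  exact_mod_cast h1.trans h2

theorem one_isBigO_of_sub {ι : Type*} {l : Filter ι} {τ f f' : ι → ℝ} (hτ : Tendsto τ l (𝓝 0))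
    (hf : (fun _ => (1 : ℝ)) =O[l] f) (h : (fun i => f i - f' i) =O[l] τ) :
    (fun _ => (1 : ℝ)) =O[l] f' := by
  obtain ⟨hne, hinv⟩ := Bdd.inv_of_sub_smul (χ := f') (z := fun _ => (1 : ℝ)) hτ hf
    (Bdd.const 1) (by simpa using h)
  have := IsBigO.mul hinv (isBigO_refl f' l)
  refine this.congr' ?_ (Eventually.of_forall fun i => one_mul _)
  filter_upwards [hne] with i hi
  exact inv_mul_cancel₀ hi

theorem isBigO_krylovPoly {ι : Type*} {l : Filter ι} {d m : ℕ}
    {Y : ι → Matrix (Fin d) (Fin d) ℝ} (hY : Bdd l Y) (q : ι → Fin m → ℝ) :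
    (fun i => krylovPoly (Y i) (q i)) =O[l] fun i => ‖q i‖ := by
  unfold krylovPoly
  refine IsBigO.fun_sum (A := fun (j : Fin m) i => q i j • Y i ^ (j : ℕ)) fun j _ => ?_
  have h1 : (fun i => q i j) =O[l] fun i => ‖q i‖ :=
    IsBigO.of_bound 1 (Eventually.of_forall fun i => by
      simpa using norm_le_pi_norm (q i) j)
  have h2 : Bdd l (fun i => Y i ^ (j : ℕ)) := by
    have h3 : ∀ k : ℕ, Bdd l (fun i => Y i ^ k) := by
      intro k
      induction k with
      | zero => simpa using Bdd.const (1 : Matrix (Fin d) (Fin d) ℝ)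
      | succ k ih =>
        have := IsBigO.mul ih hY
        simpa [pow_succ] using this
    exact h3 j
  simpa using h1.smul h2

variable {n : ℕ} {ι : Type*} {A B M : Matrix (Fin (n + 2)) (Fin (n + 2)) ℝ}
    {lam : Fin (n + 2) → ℝ} {v : Fin (n + 2) → Fin (n + 2) → ℝ} {m K : ℕ}
    {x g p : ι → ℕ → Fin (n + 2) → ℝ} {ξ ξ' δ η κ ε : ℝ}

namespace PLFamily

theorem symmB (h : PLFamily A B M lam v m K x g p ξ ξ' δ η κ ε) : B.IsSymm :=
  isSymm_of_posDef h.posB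

theorem bNorm_eq_one (h : PLFamily A B M lam v m K x g p ξ ξ' δ η κ ε) {k : ℕ} (hk : k ≤ K)
    (i : ι) : bNorm B (x i k) = 1 :=
  (bNorm_eq_one_iff _ _).2 ((h.run i).bInner_self h.posB hk)

theorem rate_pos' (h : PLFamily A B M lam v m K x g p ξ ξ' δ η κ ε) : 0 < ξ' :=
  h.rate_pos.trans h.rate_lt

theorem initial_pos (h : PLFamily A B M lam v m K x g p ξ ξ' δ η κ ε) (i : ι) :
    0 < rayleigh A B (x i 0) - lam 0 := by
  have := (h.lin i).1.1
  linarith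

theorem value_lower (h : PLFamily A B M lam v m K x g p ξ ξ' δ η κ ε) {k : ℕ} (hk : k ≤ K)
    (i : ι) : ξ ^ k * (rayleigh A B (x i 0) - lam 0) ≤ rayleigh A B (x i k) - lam 0 := by
  rcases Nat.eq_zero_or_pos k with rfl | h0
  · simp
  · simpa using ((h.lin i).2 0 k h0 hk).1

theorem value_upper (h : PLFamily A B M lam v m K x g p ξ ξ' δ η κ ε) {k : ℕ} (hk : k ≤ K)
    (i : ι) : rayleigh A B (x i k) - lam 0 ≤ rayleigh A B (x i 0) - lam 0 := by
  rcases Nat.eq_zero_or_pos k with rfl | h0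
  · exact le_rfl
  · refine ((h.lin i).2 0 k h0 hk).2.trans ?_
    exact mul_le_of_le_one_left (h.initial_pos i).le
      (pow_le_one₀ h.rate_pos'.le h.rate_lt_one.le)

theorem initial_lower (h : PLFamily A B M lam v m K x g p ξ ξ' δ η κ ε) (i : ι) :
    (lam 1 - lam 0) * initialSin B (v 0) x i ^ 2 ≤ rayleigh A B (x i 0) - lam 0 :=
  (h.eig.rayleigh_bounds h.posB (h.bNorm_eq_one (Nat.zero_le K) i)).1

theorem initial_upper (h : PLFamily A B M lam v m K x g p ξ ξ' δ η κ ε) (i : ι) :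
    rayleigh A B (x i 0) - lam 0 ≤ (lam (Fin.last _) - lam 0) * initialSin B (v 0) x i ^ 2 :=
  (h.eig.rayleigh_bounds h.posB (h.bNorm_eq_one (Nat.zero_le K) i)).2

/-- ρ₀ > λ₁ excludes a vanishing sine, so the scaling by sin θ₀ is legitimate for every run. -/
theorem initialSin_pos (h : PLFamily A B M lam v m K x g p ξ ξ' δ η κ ε) (i : ι) :
    0 < initialSin B (v 0) x i := by
  have h1 := h.initial_pos i
  have h2 := h.initial_upper i
  have h3 : 0 ≤ initialSin B (v 0) x i := sin_bAngle_nonneg B _ _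
  refine lt_of_le_of_ne h3 fun h0 => ?_
  rw [← h0] at h2
  simp at h2
  linarith

theorem coef_ne_zero (h : PLFamily A B M lam v m K x g p ξ ξ' δ η κ ε) {i : ι}
    {y : Fin (n + 2) → ℝ} (hy : y ≠ 0) (hle : rayleigh A B y ≤ rayleigh A B (x i 0)) :
    bInner B y (v 0) ≠ 0 :=
  h.eig.bInner_ne_zero h.posB hy (hle.trans_lt (h.lin i).1.2)

theorem coef_iterate_ne_zero (h : PLFamily A B M lam v m K x g p ξ ξ' δ η κ ε) {k : ℕ}
    (hk : k ≤ K) (i : ι) : bInner B (x i k) (v 0) ≠ 0 :=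
  h.coef_ne_zero ((h.run i).ne_zero h.posB hk) (by linarith [h.value_upper hk i])

theorem scaledError_bdd (h : PLFamily A B M lam v m K x g p ξ ξ' δ η κ ε)
    {y : ι → Fin (n + 2) → ℝ} (hy : ∀ i, y i ≠ 0)
    (hle : ∀ i, rayleigh A B (y i) ≤ rayleigh A B (x i 0)) :
    Bdd (angleFilter B (v 0) x)
      (fun i => scaledError B (v 0) (initialSin B (v 0) x i) (y i)) := by
  obtain ⟨C, s₀, hs₀, hC⟩ := h.eig.exists_scaledError_le h.symmA h.posB h.gap
  have h1 : ∀ᶠ i in angleFilter B (v 0) x, initialSin B (v 0) x i < s₀ :=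
    (tendsto_initialSin B (v 0) x).eventually_lt_const hs₀
  refine IsBigO.of_bound C ?_
  filter_upwards [h1] with i hi
  rw [norm_one, mul_one]
  refine hC _ (h.initialSin_pos i).ne' ?_ _ (h.coef_ne_zero (hy i) (hle i)) ?_
  · rw [abs_of_pos (h.initialSin_pos i)]
    exact hi.le
  · linarith [hle i, h.initial_upper i]

/-- The scaled error of the `k`-th iterates. -/
noncomputable abbrev err (B : Matrix (Fin (n + 2)) (Fin (n + 2)) ℝ)
    (v : Fin (n + 2) → Fin (n + 2) → ℝ) (x : ι → ℕ → Fin (n + 2) → ℝ) (k : ℕ) (i : ι) :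
    Fin (n + 2) → ℝ :=
  scaledError B (v 0) (initialSin B (v 0) x i) (x i k)

theorem err_bdd (h : PLFamily A B M lam v m K x g p ξ ξ' δ η κ ε) {k : ℕ} (hk : k ≤ K) :
    Bdd (angleFilter B (v 0) x) (err B v x k) :=
  h.scaledError_bdd (fun i => (h.run i).ne_zero h.posB hk)
    (fun i => by linarith [h.value_upper hk i])

theorem value_bdd (h : PLFamily A B M lam v m K x g p ξ ξ' δ η κ ε) {k : ℕ} (hk : k ≤ K) :
    Bdd (angleFilter B (v 0) x)
      (fun i => (rayleigh A B (x i k) - lam 0) / initialSin B (v 0) x i ^ 2) := by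
  refine IsBigO.of_bound (lam (Fin.last _) - lam 0) (Eventually.of_forall fun i => ?_)
  have h1 := h.value_lower hk i
  have h2 : 0 ≤ rayleigh A B (x i k) - lam 0 :=
    (mul_nonneg (pow_nonneg h.rate_pos.le k) (h.initial_pos i).le).trans h1
  have h3 := pow_pos (h.initialSin_pos i) 2
  rw [norm_one, mul_one, Real.norm_of_nonneg (div_nonneg h2 h3.le), div_le_iff₀ h3]
  exact (h.value_upper hk i).trans (h.initial_upper i)

theorem value_small (h : PLFamily A B M lam v m K x g p ξ ξ' δ η κ ε) {k : ℕ} (hk : k ≤ K) :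
    (fun i => rayleigh A B (x i k) - lam 0) =O[angleFilter B (v 0) x] initialSin B (v 0) x := by
  have hτ := tendsto_initialSin B (v 0) x
  have h1 := (((Bdd.of_small hτ (isBigO_refl _ _)).mul (h.value_bdd hk)).mul_small
    (isBigO_refl (initialSin B (v 0) x) (angleFilter B (v 0) x)))
  refine h1.congr_left fun i => ?_
  have := (h.initialSin_pos i).ne'
  field_simp

theorem exists_coercive (h : PLFamily A B M lam v m K x g p ξ ξ' δ η κ ε) :
    ∃ c : ℝ, 0 < c ∧ ∀ k ≤ K, ∀ i, ∀ w ∈ spaceW (g i) k,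
      c * ‖w‖ ^ 2 ≤ bInner (A - lam 0 • B) w w := by
  obtain ⟨c, hc, hW⟩ := h.eig.exists_coercive h.symmA h.posB h.gap h.angle_pos
  refine ⟨c, hc, fun k hk i w hw => ?_⟩
  rcases Nat.eq_zero_or_pos k with rfl | h0
  · rw [spaceW_zero, Submodule.mem_bot] at hw
    simp [hw, bInner]
  · exact hW _ (h.angle i k h0 hk) w hw

/-- Vectors whose differences lie in a search space, up to scaling. -/
theorem exists_increment (h : PLFamily A B M lam v m K x g p ξ ξ' δ η κ ε) {j k : ℕ} (hj : j ≤ K)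
    (hk : k ≤ K) {y : ι → Fin (n + 2) → ℝ} (hy : ∀ i, y i ≠ 0)
    (hle : ∀ i, rayleigh A B (y i) ≤ rayleigh A B (x i 0)) {α : ι → ℝ}
    {w : ι → Fin (n + 2) → ℝ} (hw : ∀ i, w i ∈ spaceW (g i) k)
    (hyw : ∀ i, y i = α i • x i j + w i) :
    ∃ b : ι → ℝ, Bdd (angleFilter B (v 0) x)
        (fun i => ((initialSin B (v 0) x i)⁻¹ * (bInner B (y i) (v 0))⁻¹) • w i) ∧
      Bdd (angleFilter B (v 0) x) b ∧
      (fun i => scaledError B (v 0) (initialSin B (v 0) x i) (y i) - err B v x j i -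
        ((initialSin B (v 0) x i)⁻¹ * (bInner B (y i) (v 0))⁻¹) • w i - b i • v 0)
        =O[angleFilter B (v 0) x] initialSin B (v 0) x := by
  set l := angleFilter B (v 0) x with hl
  set τ := initialSin B (v 0) x with hτdef
  have hτ : Tendsto τ l (𝓝 0) := tendsto_initialSin B (v 0) x
  set s := fun i => scaledError B (v 0) (τ i) (y i) with hs
  set t := err B v x j with ht
  set u := fun i => ((τ i)⁻¹ * (bInner B (y i) (v 0))⁻¹) • w i with hu
  have hsb : Bdd l s := h.scaledError_bdd hy hle
  have htb : Bdd l t := h.err_bdd hj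
  have hv1 := h.eig.orthonormal 0 0
  rw [if_pos rfl] at hv1
  obtain ⟨c, hc, hco⟩ := h.exists_coercive
  -- the exact relation
  have hrel : ∀ i, s i - t i = u i - bInner B (u i) (v 0) • (v 0 + τ i • t i) := by
    intro i
    have hτ0 : τ i ≠ 0 := (h.initialSin_pos i).ne'
    have hay := h.coef_ne_zero (hy i) (hle i)
    have hax := h.coef_iterate_ne_zero hj i
    have e1 : v 0 + τ i • s i = (bInner B (y i) (v 0))⁻¹ • y i := add_smul_scaledError B (v 0) hτ0 _
    have e2 : v 0 + τ i • t i = (bInner B (x i j) (v 0))⁻¹ • x i j :=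
      add_smul_scaledError B (v 0) hτ0 _
    have e3 : τ i • u i = (bInner B (y i) (v 0))⁻¹ • w i := by
      rw [hu]
      simp only [smul_smul]
      rw [mul_inv_cancel_left₀ hτ0]
    have e4 : v 0 + τ i • s i =
        ((bInner B (y i) (v 0))⁻¹ * α i * bInner B (x i j) (v 0)) • (v 0 + τ i • t i) +
          τ i • u i := by
      rw [e1, e2, e3, smul_smul, mul_assoc, mul_inv_cancel₀ hax, mul_one]
      have h0 := congrArg (fun z => (bInner B (y i) (v 0))⁻¹ • z) (hyw i)
      simpa only [smul_add, smul_smul] using h0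
    set a := (bInner B (y i) (v 0))⁻¹ * α i * bInner B (x i j) (v 0) with ha
    -- Both scaled errors are B-orthogonal to v₁, so the B-product of `e4` with v₁ determines a.
    have e5 : 1 = a + τ i * bInner B (u i) (v 0) := by
      have h1 := congrArg (fun z => bInner B z (v 0)) e4
      simp only [bInner_add_left, bInner_smul_left, hv1] at h1
      have h2 : bInner B (s i) (v 0) = 0 := h.eig.bInner_scaledError _ hay
      have h3 : bInner B (t i) (v 0) = 0 := h.eig.bInner_scaledError _ hax
      rw [h2, h3] at h1
      linarith
    have e6 : τ i • (s i - t i) = τ i • (u i - bInner B (u i) (v 0) • (v 0 + τ i • t i)) := by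
      have h1 : a = 1 - τ i * bInner B (u i) (v 0) := by linarith
      have h2 : τ i • s i = a • (v 0 + τ i • t i) + τ i • u i - v 0 := by
        rw [← e4]; abel
      rw [smul_sub, h2, h1]
      module
    exact smul_right_injective _ hτ0 e6
  have hHrel : ∀ i, (A - lam 0 • B) *ᵥ u i = (A - lam 0 • B) *ᵥ s i - (A - lam 0 • B) *ᵥ t i +
      (τ i * bInner B (u i) (v 0)) • (A - lam 0 • B) *ᵥ t i := by
    intro i
    have h1 := congrArg (fun z => (A - lam 0 • B) *ᵥ z) (hrel i)
    simp only [mulVec_sub, mulVec_smul, mulVec_add, h.eig.gap_mulVec, zero_add, smul_smul] at h1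
    rw [h1, mul_comm (τ i)]
    abel
  have hHs : Bdd l (fun i => (A - lam 0 • B) *ᵥ s i) := (Bdd.const _).mulVec hsb
  have hHt : Bdd l (fun i => (A - lam 0 • B) *ᵥ t i) := (Bdd.const _).mulVec htb
  -- Coercivity on the search space gives c ‖u‖ ≤ D ‖Hu‖. Under H the multiple of v₁ disappears, and
  -- what remains is bounded apart from τ (u, v₁)_B Ht, which is absorbed.
  have hub : Bdd l u := by
    obtain ⟨C1, hC1, h1⟩ := (hHs.sub hHt).exists_pos
    obtain ⟨C2, hC2, h2⟩ := hHt.exists_pos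
    rw [isBigOWith_iff] at h1 h2
    set D : ℝ := ((n + 2 : ℕ) : ℝ) with hD
    have hD0 : 0 < D := by positivity
    set E := D * ‖B *ᵥ v 0‖ with hE
    have hE0 : 0 ≤ E := by positivity
    refine Bdd.of_le_add_mul_norm hτ (C := D / c * (C1 + E * C2)) ?_
    filter_upwards [h1, h2] with i h1 h2
    rw [norm_one, mul_one] at h1 h2
    have h3 : c * ‖u i‖ ^ 2 ≤ D * (‖u i‖ * ‖(A - lam 0 • B) *ᵥ u i‖) :=
      (hco k hk i (u i) (Submodule.smul_mem _ _ (hw i))).trans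
        ((le_abs_self _).trans (norm_dotProduct_le_card _ _))
    have h4 : c * ‖u i‖ ≤ D * ‖(A - lam 0 • B) *ᵥ u i‖ := by
      rcases (norm_nonneg (u i)).eq_or_lt with h0 | h0
      · rw [← h0, mul_zero]
        positivity
      · refine le_of_mul_le_mul_left ?_ h0
        calc _ = c * ‖u i‖ ^ 2 := by ring
          _ ≤ _ := h3
          _ = _ := by ring
    have h5 : |bInner B (u i) (v 0)| ≤ E * ‖u i‖ := by
      refine (norm_dotProduct_le_card _ _).trans (le_of_eq ?_)
      rw [hE]
      ring
    have h6 : ‖(A - lam 0 • B) *ᵥ u i‖ ≤ C1 + ‖τ i‖ * (E * ‖u i‖) * C2 := by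
      rw [hHrel]
      refine (norm_add_le _ _).trans (add_le_add h1 ?_)
      rw [norm_smul, norm_mul]
      gcongr
      exact h5
    have h7 : ‖u i‖ ≤ D / c * (C1 + ‖τ i‖ * (E * ‖u i‖) * C2) := by
      rw [div_mul_eq_mul_div, le_div_iff₀ hc, mul_comm]
      exact h4.trans (by gcongr)
    refine h7.trans ?_
    rw [mul_assoc (D / c)]
    refine mul_le_mul_of_nonneg_left ?_ (by positivity)
    have : 0 ≤ C1 * (‖τ i‖ * ‖u i‖) := by positivity
    nlinarith [mul_nonneg hE0 hC2.le]
  have hb : Bdd l (fun i => bInner B (u i) (v 0)) := by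
    have := hub.dot (Bdd.const (B *ᵥ v 0))
    exact this
  -- By the exact relation, what is left over is -τ (u, v₁)_B t.
  refine ⟨fun i => -bInner B (u i) (v 0), hub, hb.neg_left, ?_⟩
  have h8 := (hb.mul_small (isBigO_refl τ l))
  refine (Bdd.small_smul h8 htb).neg_left.congr_left fun i => ?_
  have := hrel i
  change _ = s i - t i - u i - _
  rw [this]
  module

end PLFamily

end Family

/-! ### The scaled runs satisfy the asymptotic conjugate gradient relations. -/

section Verification

open Asymptotics
open scoped Matrix.Norms.Operator

variable {n : ℕ} {ι : Type*} {A B M : Matrix (Fin (n + 2)) (Fin (n + 2)) ℝ}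
    {lam : Fin (n + 2) → ℝ} {v : Fin (n + 2) → Fin (n + 2) → ℝ} {m K : ℕ}
    {x g p : ι → ℕ → Fin (n + 2) → ℝ} {ξ ξ' δ η κ ε : ℝ}

namespace PLFamily

theorem dir_bdd (h : PLFamily A B M lam v m K x g p ξ ξ' δ η κ ε) {k : ℕ} (hk : k ≤ K) :
    Bdd (angleFilter B (v 0) x) (fun i => prevDir (p i) k) := by
  obtain ⟨C, hC, hle⟩ := h.eig.exists_norm_sq_le h.symmB
  refine IsBigO.of_bound (Real.sqrt C) (Eventually.of_forall fun i => ?_)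
  rw [norm_one, mul_one]
  refine Real.le_sqrt_of_sq_le ((hle _).trans ?_)
  rcases (h.run i).dir_eq_zero_or h.posB hk with h0 | h1
  · rw [h0]
    simp [bInner, hC.le]
  · rw [h1, mul_one]

theorem exists_dir_lower (h : PLFamily A B M lam v m K x g p ξ ξ' δ η κ ε) :
    ∃ c : ℝ, 0 < c ∧ ∀ k ≤ K, ∀ i, prevDir (p i) k = 0 ∨
      bInner B (prevDir (p i) k) (prevDir (p i) k) = 1 ∧
      c ≤ bInner (A - lam 0 • B) (prevDir (p i) k) (prevDir (p i) k) := by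
  obtain ⟨c, hc, hco⟩ := h.exists_coercive
  set D : ℝ := ((n + 2 : ℕ) : ℝ) with hD
  have hD0 : 0 < D := by positivity
  -- A B-normalized vector satisfies 1 ≤ D ‖B‖ ‖w‖², which is combined with coercivity; the added 1
  -- keeps the denominator positive.
  refine ⟨c / (D * (‖B‖ + 1)), by positivity, fun k hk i => ?_⟩
  rcases (h.run i).dir_eq_zero_or h.posB hk with h0 | h1
  · exact Or.inl h0
  · refine Or.inr ⟨h1, ?_⟩
    have h2 := hco k hk i _ ((h.run i).prevDir_mem hk)
    set w := prevDir (p i) k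
    have h3 : 1 ≤ D * (‖B‖ + 1) * ‖w‖ ^ 2 := by
      calc 1 = bInner B w w := h1.symm
        _ ≤ D * (‖w‖ * ‖B *ᵥ w‖) :=
            (le_abs_self _).trans (norm_dotProduct_le_card _ _)
        _ ≤ D * (‖w‖ * (‖B‖ * ‖w‖)) := by
            gcongr
            exact linfty_opNorm_mulVec B w
        _ ≤ D * (‖w‖ * ((‖B‖ + 1) * ‖w‖)) := by
            gcongr
            linarith
        _ = _ := by ring
    rw [div_le_iff₀ (by positivity)]
    calc c = c * 1 := (mul_one c).symm
      _ ≤ c * (D * (‖B‖ + 1) * ‖w‖ ^ 2) := by gcongr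
      _ = (c * ‖w‖ ^ 2) * (D * (‖B‖ + 1)) := by ring
      _ ≤ _ := by gcongr

theorem dir_inv (h : PLFamily A B M lam v m K x g p ξ ξ' δ η κ ε) {k : ℕ} (hk : k ≤ K) :
    Bdd (angleFilter B (v 0) x)
      (fun i => (prevDir (p i) k ⬝ᵥ (A - lam 0 • B) *ᵥ prevDir (p i) k)⁻¹) := by
  obtain ⟨c, hc, hle⟩ := h.exists_dir_lower
  refine IsBigO.of_bound c⁻¹ (Eventually.of_forall fun i => ?_)
  rw [norm_one, mul_one]
  rcases hle k hk i with h0 | ⟨-, h1⟩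
  · rw [h0, zero_dotProduct, _root_.inv_zero, norm_zero]
    positivity
  · rw [bInner] at h1
    rw [norm_inv, Real.norm_of_nonneg (hc.le.trans h1)]
    gcongr

theorem dir_eq_zero (h : PLFamily A B M lam v m K x g p ξ ξ' δ η κ ε) {k : ℕ} (hk : k ≤ K)
    (i : ι) (h0 : prevDir (p i) k ⬝ᵥ (A - lam 0 • B) *ᵥ prevDir (p i) k = 0) :
    prevDir (p i) k = 0 := by
  obtain ⟨c, hc, hle⟩ := h.exists_dir_lower
  rcases hle k hk i with h1 | ⟨-, h1⟩
  · exact h1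
  · rw [bInner, h0] at h1
    linarith

/-- By construction p_k is exactly conjugate to p_{k-1} with respect to A - ρ_{k-1}B, which differs
from H by (ρ_{k-1} - λ₁)B = O(τ). -/
theorem conj (h : PLFamily A B M lam v m K x g p ξ ξ' δ η κ ε) {k : ℕ} (hk : k < K) :
    (fun i => prevDir (p i) k ⬝ᵥ (A - lam 0 • B) *ᵥ prevDir (p i) (k + 1))
      =O[angleFilter B (v 0) x] initialSin B (v 0) x := by
  cases k with
  | zero =>
    refine IsBigO.of_bound 1 (Eventually.of_forall fun i => ?_)
    have : prevDir (p i) 0 = 0 := rfl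
    rw [this, zero_dotProduct, norm_zero]
    positivity
  | succ j =>
    have hτ := tendsto_initialSin B (v 0) x
    have hj : j ≤ K := by omega
    obtain ⟨c, hc, hle⟩ := h.exists_dir_lower
    have hv0 : Tendsto (fun i => rayleigh A B (x i j) - lam 0) (angleFilter B (v 0) x) (𝓝 0) :=
      (h.value_small hj).trans_tendsto hτ
    have hBp : Bdd (angleFilter B (v 0) x)
        (fun i => prevDir (p i) (j + 1) ⬝ᵥ B *ᵥ prevDir (p i) (j + 1 + 1)) :=
      (h.dir_bdd hk.le).dot ((Bdd.const B).mulVec (h.dir_bdd hk))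
    refine (Bdd.small_mul (h.value_small hj) hBp).congr' ?_ EventuallyEq.rfl
    -- Once ρ_j - λ₁ < c, the denominator in the definition of the direction is nonzero unless the
    -- previous direction vanishes.
    filter_upwards [hv0.eventually_lt_const hc] with i hi
    set S := shifted A B (x i j) with hS
    have hSe : ∀ y z, bInner S y z =
        bInner (A - lam 0 • B) y z - (rayleigh A B (x i j) - lam 0) * bInner B y z := by
      intro y z
      rw [hS, shifted, bInner_sub_matrix, bInner_smul_matrix, bInner_sub_matrix,
        bInner_smul_matrix]
      ring
    have h0 : bInner S (prevDir (p i) (j + 1)) (prevDir (p i) (j + 1 + 1)) = 0 := by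
      have e : prevDir (p i) (j + 1 + 1) = p i (j + 1) := rfl
      rw [e, (h.run i).dir (j + 1) hk, bInner_smul_right, rawDir, bInner_sub_right,
        bInner_smul_right, Nat.add_sub_cancel, ← hS]
      rcases hle (j + 1) hk.le i with h1 | ⟨h1, h2⟩
      · rw [h1]
        simp [bInner]
      · have h3 : bInner S (prevDir (p i) (j + 1)) (prevDir (p i) (j + 1)) ≠ 0 := by
          rw [hSe, h1]
          linarith
        rw [div_mul_cancel₀ _ h3, sub_self, mul_zero]
    rw [hSe] at h0
    simp only [bInner] at h0
    linarith

theorem decomp (h : PLFamily A B M lam v m K x g p ξ ξ' δ η κ ε) {k : ℕ} (hk : k < K) :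
    ∃ ζ β : ι → ℝ, ∀ i, g i k = ζ i • prevDir (p i) (k + 1) + β i • prevDir (p i) k := by
  refine ⟨fun i => bNorm B (rawDir A B (x i) (g i) (p i) k), fun i =>
    bInner (shifted A B (x i (k - 1))) (prevDir (p i) k) (g i k) /
      bInner (shifted A B (x i (k - 1))) (prevDir (p i) k) (prevDir (p i) k), fun i => ?_⟩
  have h1 := (h.run i).rawDir_eq h.posB hk
  have e : prevDir (p i) (k + 1) = p i k := rfl
  simp only
  rw [e, ← h1, rawDir, sub_add_cancel]

theorem dir_of_zero (h : PLFamily A B M lam v m K x g p ξ ξ' δ η κ ε) {k : ℕ} (hk : k < K)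
    (i : ι) (h0 : g i k = 0) : prevDir (p i) (k + 1) = 0 := by
  have e : prevDir (p i) (k + 1) = p i k := rfl
  rw [e, (h.run i).dir k hk, rawDir, h0]
  simp [bInner]

/-- Up to scaling, the residual of x_{k+1} is τ Ht - (ρ_{k+1} - λ₁) B (v₁ + τ t). The last factor
ρ_{k+1} - λ₁ is O(τ²), so after division by τ an error O(τ) remains. -/
theorem ritz (h : PLFamily A B M lam v m K x g p ξ ξ' δ η κ ε) {k : ℕ} (hk : k < K)
    {w : ι → Fin (n + 2) → ℝ} (hwb : Bdd (angleFilter B (v 0) x) w)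
    (hw : ∀ i, w i ⬝ᵥ (shifted A B (x i (k + 1)) *ᵥ x i (k + 1)) = 0) :
    (fun i => w i ⬝ᵥ (A - lam 0 • B) *ᵥ err B v x (k + 1) i)
      =O[angleFilter B (v 0) x] initialSin B (v 0) x := by
  have hτ := tendsto_initialSin B (v 0) x
  have hτb : Bdd (angleFilter B (v 0) x) (initialSin B (v 0) x) := Bdd.of_small hτ (isBigO_refl _ _)
  have hX : Bdd (angleFilter B (v 0) x)
      (fun i => v 0 + initialSin B (v 0) x i • err B v x (k + 1) i) :=
    (Bdd.const _).add (hτb.smul (h.err_bdd hk))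
  have h1 := ((h.value_bdd hk).mul (hwb.dot ((Bdd.const B).mulVec hX))).mul_small
    (isBigO_refl (initialSin B (v 0) x) (angleFilter B (v 0) x))
  refine h1.congr_left fun i => ?_
  have hτ0 := (h.initialSin_pos i).ne'
  have ha := h.coef_iterate_ne_zero hk i
  have h2 := hw i
  have e1 : v 0 + initialSin B (v 0) x i • err B v x (k + 1) i =
      (bInner B (x i (k + 1)) (v 0))⁻¹ • x i (k + 1) := add_smul_scaledError B (v 0) hτ0 _
  have e2 : shifted A B (x i (k + 1)) =
      (A - lam 0 • B) - (rayleigh A B (x i (k + 1)) - lam 0) • B := by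
    rw [shifted]
    module
  have h3 : w i ⬝ᵥ (shifted A B (x i (k + 1)) *ᵥ
      (v 0 + initialSin B (v 0) x i • err B v x (k + 1) i)) = 0 := by
    rw [e1, mulVec_smul, dotProduct_smul, h2, smul_zero]
  rw [e2, sub_mulVec, smul_mulVec, dotProduct_sub, dotProduct_smul, mulVec_add _ (v 0),
    h.eig.gap_mulVec, zero_add, mulVec_smul, dotProduct_smul, smul_eq_mul, smul_eq_mul] at h3
  field_simp
  linarith

theorem bInner_err_lower (h : PLFamily A B M lam v m K x g p ξ ξ' δ η κ ε) {k : ℕ} (hk : k ≤ K)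
    (i : ι) : ξ ^ k * (lam 1 - lam 0) ≤
      bInner (A - lam 0 • B) (err B v x k i) (err B v x k i) := by
  have hτ0 := h.initialSin_pos i
  rw [h.eig.bInner_gap_scaledError h.symmA h.posB hτ0.ne' (h.coef_iterate_ne_zero hk i)]
  have h1 := h.value_lower hk i
  have h2 := h.initial_lower i
  have h3 := pow_pos h.rate_pos k
  have h4 : ξ ^ k * (lam 1 - lam 0) ≤
      (rayleigh A B (x i k) - lam 0) / initialSin B (v 0) x i ^ 2 := by
    rw [le_div_iff₀ (by positivity)]
    calc _ = ξ ^ k * ((lam 1 - lam 0) * initialSin B (v 0) x i ^ 2) := by ring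
      _ ≤ _ := by gcongr
      _ ≤ _ := h1
  have h5 : 0 ≤ rayleigh A B (x i k) - lam 0 :=
    (mul_nonneg h3.le (h.initial_pos i).le).trans h1
  have h6 := mul_nonneg h5 (bInner_self_nonneg h.posB (err B v x k i))
  linarith

/-- The scaled squared error decreases at every step. -/
theorem decrease (h : PLFamily A B M lam v m K x g p ξ ξ' δ η κ ε) {k : ℕ} (hk : k < K) :
    (fun _ => (1 : ℝ)) =O[angleFilter B (v 0) x] fun i =>
      bInner (A - lam 0 • B) (err B v x k i) (err B v x k i) -
        bInner (A - lam 0 • B) (err B v x (k + 1) i) (err B v x (k + 1) i) := by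
  have hτ := tendsto_initialSin B (v 0) x
  -- One step reduces ρ_k - λ₁ by at least the fraction 1 - ξ', while ρ_k - λ₁ ≥ ξ^k (λ₂ - λ₁) τ².
  set c := (1 - ξ') * (ξ ^ k * (lam 1 - lam 0)) with hc
  have hc0 : 0 < c := mul_pos (by linarith [h.rate_lt_one])
    (mul_pos (pow_pos h.rate_pos k) (by linarith [h.gap]))
  have hF : (fun _ => (1 : ℝ)) =O[angleFilter B (v 0) x] fun i =>
      (rayleigh A B (x i k) - rayleigh A B (x i (k + 1))) / initialSin B (v 0) x i ^ 2 := by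
    refine IsBigO.of_bound c⁻¹ (Eventually.of_forall fun i => ?_)
    have hτ0 := h.initialSin_pos i
    have h1 := h.value_lower hk.le i
    have h2 := h.initial_lower i
    have h3 := ((h.lin i).2 k (k + 1) k.lt_succ_self hk).2
    rw [Nat.add_sub_cancel_left, pow_one] at h3
    have h4 : c ≤ (rayleigh A B (x i k) - rayleigh A B (x i (k + 1))) /
        initialSin B (v 0) x i ^ 2 := by
      rw [le_div_iff₀ (by positivity)]
      have h5 : (0 : ℝ) ≤ 1 - ξ' := by linarith [h.rate_lt_one]
      have h6 := pow_pos h.rate_pos k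
      calc c * initialSin B (v 0) x i ^ 2
          = (1 - ξ') * (ξ ^ k * ((lam 1 - lam 0) * initialSin B (v 0) x i ^ 2)) := by
            rw [hc]; ring
        _ ≤ (1 - ξ') * (ξ ^ k * (rayleigh A B (x i 0) - lam 0)) := by gcongr
        _ ≤ (1 - ξ') * (rayleigh A B (x i k) - lam 0) := by gcongr
        _ ≤ _ := by linarith
    rw [norm_one, Real.norm_of_nonneg (hc0.le.trans h4), inv_mul_eq_div, one_le_div hc0]
    exact h4
  refine one_isBigO_of_sub hτ hF ?_
  have hb : ∀ j ≤ K, Bdd (angleFilter B (v 0) x)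
      (fun i => bInner B (err B v x j i) (err B v x j i)) := fun j hj =>
    (h.err_bdd hj).dot ((Bdd.const B).mulVec (h.err_bdd hj))
  have h1 := Bdd.small_mul (h.value_small hk.le) (hb k hk.le)
  have h2 := Bdd.small_mul (h.value_small hk) (hb (k + 1) hk)
  refine (h2.sub h1).congr_left fun i => ?_
  have hτ0 := (h.initialSin_pos i).ne'
  rw [h.eig.bInner_gap_scaledError h.symmA h.posB hτ0 (h.coef_iterate_ne_zero hk.le i),
    h.eig.bInner_gap_scaledError h.symmA h.posB hτ0 (h.coef_iterate_ne_zero hk i)]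
  ring

theorem step (h : PLFamily A B M lam v m K x g p ξ ξ' δ η κ ε) {k : ℕ} (hk : k < K) :
    ∃ (γ b : ι → ℝ) (w : ι → Fin (n + 2) → ℝ),
      (∀ᶠ i in angleFilter B (v 0) x, w i = γ i • g i k + b i • prevDir (p i) k) ∧
      Bdd (angleFilter B (v 0) x) w ∧ (fun _ => (1 : ℝ)) =O[angleFilter B (v 0) x] w ∧
      (fun i => (A - lam 0 • B) *ᵥ err B v x (k + 1) i - (A - lam 0 • B) *ᵥ err B v x k i -
        (A - lam 0 • B) *ᵥ w i) =O[angleFilter B (v 0) x] initialSin B (v 0) x := by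
  have hτ := tendsto_initialSin B (v 0) x
  choose α γ b hstep using fun i => (h.run i).exists_step hk
  obtain ⟨c, hwb, -, hinc⟩ := h.exists_increment hk.le hk (y := fun i => x i (k + 1)) (α := α)
    (w := fun i => γ i • g i k + b i • prevDir (p i) k)
    (fun i => (h.run i).ne_zero h.posB hk) (fun i => by linarith [h.value_upper hk i])
    (fun i => Submodule.add_mem _ (Submodule.smul_mem _ _ (mem_spaceW _ k.lt_succ_self))
      (Submodule.smul_mem _ _ (spaceW_mono _ k.le_succ ((h.run i).prevDir_mem hk.le)))) hstep
  set f : ι → ℝ := fun i => (initialSin B (v 0) x i)⁻¹ * (bInner B (x i (k + 1)) (v 0))⁻¹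
  set w : ι → Fin (n + 2) → ℝ := fun i => f i • (γ i • g i k + b i • prevDir (p i) k) with hw
  replace hinc : (fun i => err B v x (k + 1) i - err B v x k i - w i - c i • v 0)
      =O[angleFilter B (v 0) x] initialSin B (v 0) x := hinc
  have hres := (Bdd.const (A - lam 0 • B)).mulVec_small hinc
  refine ⟨fun i => f i * γ i, fun i => f i * b i, w, Eventually.of_forall fun i => ?_, hwb, ?_,
    ?_⟩
  · simp only [hw]
    module
  · have hE : Bdd (angleFilter B (v 0) x) (fun i => (A - lam 0 • B) *ᵥ err B v x (k + 1) i +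
        (A - lam 0 • B) *ᵥ err B v x k i) :=
      ((Bdd.const _).mulVec (h.err_bdd hk)).add ((Bdd.const _).mulVec (h.err_bdd hk.le))
    -- The energy difference is (t_{k+1} - t_k)ᵀH(t_{k+1} + t_k), where t_{k+1} - t_k is w up to a
    -- multiple of v₁ and O(τ). It is bounded away from zero, hence so is w.
    have h1 : (fun _ => (1 : ℝ)) =O[angleFilter B (v 0) x] fun i =>
        w i ⬝ᵥ ((A - lam 0 • B) *ᵥ err B v x (k + 1) i + (A - lam 0 • B) *ᵥ err B v x k i) := by
      refine one_isBigO_of_sub hτ (h.decrease hk).neg_right ?_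
      refine (Bdd.small_dot hinc hE).congr_left fun i => ?_
      have hs := isSymm_sub_smul h.symmA h.symmB (lam 0)
      have hv : ∀ y, v 0 ⬝ᵥ (A - lam 0 • B) *ᵥ y = 0 := fun y => by
        rw [dotProduct_mulVec_comm hs, h.eig.gap_mulVec, dotProduct_zero]
      simp only [bInner, sub_dotProduct, smul_dotProduct, dotProduct_add, hv, smul_eq_mul]
      rw [dotProduct_mulVec_comm hs (err B v x (k + 1) i) (err B v x k i)]
      ring
    have h2 := isBigO_dotProduct (isBigO_refl (fun i => w i) (angleFilter B (v 0) x)).norm_right hE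
    simpa using h1.trans h2
  · refine hres.congr_left fun i => ?_
    simp only [mulVec_sub, mulVec_smul, h.eig.gap_mulVec, smul_zero, sub_zero]

end PLFamily

end Verification

/-! ### One fixed preconditioner for all steps. -/

section Preconditioner

open Asymptotics
open scoped Matrix.Norms.Operator

variable {n : ℕ} {ι : Type*} {A B M : Matrix (Fin (n + 2)) (Fin (n + 2)) ℝ}
    {lam : Fin (n + 2) → ℝ} {v : Fin (n + 2) → Fin (n + 2) → ℝ} {m K : ℕ}
    {x g p : ι → ℕ → Fin (n + 2) → ℝ} {ξ ξ' δ η κ ε : ℝ}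

namespace PLFamily

/-- The scaled residual of the `k`-th iterates. -/
noncomputable abbrev res (A B : Matrix (Fin (n + 2)) (Fin (n + 2)) ℝ) (lam : Fin (n + 2) → ℝ)
    (v : Fin (n + 2) → Fin (n + 2) → ℝ) (x : ι → ℕ → Fin (n + 2) → ℝ) (k : ℕ) (i : ι) :
    Fin (n + 2) → ℝ :=
  scaledResidual (A - lam 0 • B) B (v 0) (initialSin B (v 0) x i) (err B v x k i)

theorem res_sub (h : PLFamily A B M lam v m K x g p ξ ξ' δ η κ ε) {k : ℕ} (hk : k ≤ K) :
    (fun i => res A B lam v x k i - (A - lam 0 • B) *ᵥ err B v x k i)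
      =O[angleFilter B (v 0) x] initialSin B (v 0) x := by
  have hτb : Bdd (angleFilter B (v 0) x) (initialSin B (v 0) x) :=
    Bdd.of_small (tendsto_initialSin B (v 0) x) (isBigO_refl _ _)
  have hX : Bdd (angleFilter B (v 0) x)
      (fun i => B *ᵥ (v 0 + initialSin B (v 0) x i • err B v x k i)) :=
    (Bdd.const _).mulVec ((Bdd.const _).add (hτb.smul (h.err_bdd hk)))
  have h1 := Bdd.small_smul ((h.value_bdd hk).mul_small
    (isBigO_refl (initialSin B (v 0) x) (angleFilter B (v 0) x))) hX
  refine h1.neg_left.congr_left fun i => ?_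
  have hτ0 := (h.initialSin_pos i).ne'
  have e : (rayleigh A B (x i k) - lam 0) / initialSin B (v 0) x i ^ 2 =
      scaledValue (A - lam 0 • B) B (initialSin B (v 0) x i) (err B v x k i) := by
    rw [h.eig.rayleigh_eq_scaledValue h.symmA h.posB hτ0 (h.coef_iterate_ne_zero hk i)]
    field_simp
  rw [e, res, scaledResidual, sub_sub_cancel_left, mul_comm]

theorem res_bdd (h : PLFamily A B M lam v m K x g p ξ ξ' δ η κ ε) {k : ℕ} (hk : k ≤ K) :
    Bdd (angleFilter B (v 0) x) (res A B lam v x k) := by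
  have h1 : Bdd (angleFilter B (v 0) x) (fun i => (A - lam 0 • B) *ᵥ err B v x k i) :=
    (Bdd.const _).mulVec (h.err_bdd hk)
  have := (Bdd.of_small (tendsto_initialSin B (v 0) x) (h.res_sub hk)).add h1
  simpa using this

theorem shifted_bdd (h : PLFamily A B M lam v m K x g p ξ ξ' δ η κ ε) {k : ℕ} (hk : k ≤ K) :
    Bdd (angleFilter B (v 0) x) (fun i => shifted A B (x i k)) := by
  have h1 := (Bdd.of_small (tendsto_initialSin B (v 0) x) (h.value_small hk)).smul
    (Bdd.const (l := angleFilter B (v 0) x) B)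
  refine ((Bdd.const (A - lam 0 • B)).sub h1).congr_left fun i => ?_
  rw [shifted]
  module

/-- The Krylov spaces contain no vector that is small relative to its coefficients. -/
theorem coeff_isBigO (h : PLFamily A B M lam v m K x g p ξ ξ' δ η κ ε) {k : ℕ} (hk : k < K)
    {q : ι → Polynomial ℝ} (hq : ∀ᶠ i in angleFilter B (v 0) x, (q i).degree < (m : WithBot ℕ)) :
    (fun i => ‖fun j : Fin m => (q i).coeff j‖) =O[angleFilter B (v 0) x]
      fun i => polyPrec A B M (q i) (x i k) *ᵥ res A B lam v x k i := by
  have hτ := tendsto_initialSin B (v 0) x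
  have hv1 := h.eig.orthonormal 0 0
  rw [if_pos rfl] at hv1
  obtain ⟨C, hC, hle⟩ := (h.err_bdd hk.le).exists_pos
  rw [isBigOWith_iff] at hle
  obtain ⟨c, hc, hlow⟩ := exists_scaledKrylov_lower (v 0)
    (isSymm_sub_smul h.symmA h.symmB (lam 0)) h.posB h.posM m h.rate_pos hv1 C
    (mul_pos (pow_pos h.rate_pos k) (by linarith [h.gap] : 0 < lam 1 - lam 0))
  refine IsBigO.of_bound c⁻¹ ?_
  filter_upwards [hq, hle, hτ.eventually_lt_const hc] with i hqi hi hτi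
  have hτ0 := h.initialSin_pos i
  have hne := h.coef_iterate_ne_zero hk.le i
  rw [norm_one, mul_one] at hi
  obtain ⟨Q, hxQ, hKQ, -, -, -, hQ⟩ := (h.run i).ritz h.symmA h.posB hk
  have hrate := ((h.lin i).2 k (k + 1) k.lt_succ_self hk).1
  rw [Nat.add_sub_cancel_left, pow_one] at hrate
  -- The lower rate ξ over a single step rules out a nearly exact solution in the current Krylov
  -- space.
  have hnf := h.eig.noFastDecrease (M := M) h.symmA h.posB hτ0.ne' hne hrate hxQ hKQ hQ
  have h1 := hlow _ hτ0.le hτi.le _ hi (h.bInner_err_lower hk.le i) hnf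
    fun j : Fin m => (q i).coeff j
  rw [norm_norm, res, h.eig.polyPrec_mulVec h.symmA h.posB hτ0.ne' hne hqi,
    le_inv_mul_iff₀ hc]
  exact h1

/-- Combined with `coeff_isBigO`, the chain ‖N_k‖ ≲ ‖q_k‖ ≲ ‖N_k r_k‖ shows that applying N_k to the
scaled residual loses no size. -/
theorem polyPrec_isBigO (h : PLFamily A B M lam v m K x g p ξ ξ' δ η κ ε) {k : ℕ} (hk : k ≤ K)
    {q : ι → Polynomial ℝ} (hq : ∀ᶠ i in angleFilter B (v 0) x, (q i).degree < (m : WithBot ℕ)) :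
    (fun i => polyPrec A B M (q i) (x i k)) =O[angleFilter B (v 0) x]
      fun i => ‖fun j : Fin m => (q i).coeff j‖ := by
  have hY : Bdd (angleFilter B (v 0) x) (fun i => shifted A B (x i k) * M) := by
    simpa using IsBigO.mul (h.shifted_bdd hk) (Bdd.const (l := angleFilter B (v 0) x) M)
  have h1 := IsBigO.mul (Bdd.const (l := angleFilter B (v 0) x) M)
    (isBigO_krylovPoly hY fun i (j : Fin m) => (q i).coeff j)
  refine h1.congr' ?_ (Eventually.of_forall fun i => one_mul _)
  filter_upwards [hq] with i hi
  rw [polyPrec, aeval_eq_krylovPoly _ hi]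

/-- The preconditioner is frozen at step 0 and normalized, since no upper bound on N_0 is assumed.
The other N_k, divided by the same norm, differ from it by O(sin θ₀), thanks to the lower bound η.
-/
theorem asymptoticCG (h : PLFamily A B M lam v m K x g p ξ ξ' δ η κ ε) :
    ∃ (N : ι → Matrix (Fin (n + 2)) (Fin (n + 2)) ℝ) (r : ℕ → ι → Fin (n + 2) → ℝ),
      AsymptoticCG (angleFilter B (v 0) x) (initialSin B (v 0) x) (A - lam 0 • B) K
        (fun k i => (A - lam 0 • B) *ᵥ err B v x k i) (fun k i => g i k) r
        (fun k i => prevDir (p i) k) (fun k i => spaceW (g i) k) N := by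
  set l := angleFilter B (v 0) x with hl
  set τ := initialSin B (v 0) x with hτdef
  have hτ : Tendsto τ l (𝓝 0) := tendsto_initialSin B (v 0) x
  have hs := isSymm_sub_smul h.symmA h.symmB (lam 0)
  have hex : ∀ i, ∃ (q : ℕ → Polynomial ℝ) (c : ℕ → ℝ), bAngle B (x i 0) (v 0) < ε →
      (∀ k < K, (q k).degree < (m : WithBot ℕ) ∧
        g i k = c k • (polyPrec A B M (q k) (x i k) *ᵥ eigResidual A B (x i k)) ∧
        ∃ a b, η ≤ |polyPrec A B M (q k) (x i k) a b|) ∧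
      ∀ j k, j < k → k < K → ∀ a b,
        |polyPrec A B M (q k) (x i k) a b - polyPrec A B M (q j) (x i j) a b|
          ≤ κ * Real.sin (bAngle B (x i j) (v 0)) := by
    intro i
    by_cases hi : bAngle B (x i 0) (v 0) < ε
    · obtain ⟨q, c, hqc⟩ := h.poly i hi
      exact ⟨q, c, fun _ => hqc⟩
    · exact ⟨0, 0, fun h' => absurd h' hi⟩
  choose q c hqc using hex
  have hsmall : ∀ᶠ i in l, bAngle B (x i 0) (v 0) < ε :=
    tendsto_comap.eventually_lt_const h.eps_pos
  have hspec := hsmall.mono fun i hi => hqc i hi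
  set P : ℕ → ι → Matrix (Fin (n + 2)) (Fin (n + 2)) ℝ :=
    fun k i => polyPrec A B M (q i k) (x i k) with hP
  have hdeg : ∀ k < K, ∀ᶠ i in l, (q i k).degree < (m : WithBot ℕ) := fun k hk =>
    hspec.mono fun i hi => (hi.1 k hk).1
  have hlow : ∀ k < K, ∀ᶠ i in l, η ≤ ‖P 0 i‖ := fun k hk => by
    filter_upwards [hspec] with i hi
    obtain ⟨a, b, hab⟩ := (hi.1 0 (by omega)).2.2
    exact hab.trans (entry_le_matrix_norm _ a b)
  have hPP : ∀ k < K, (fun i => ‖P 0 i‖⁻¹ • (P k i - P 0 i)) =O[l] τ := by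
    intro k hk
    refine IsBigO.of_bound (η⁻¹ * (((n + 2 : ℕ) : ℝ) * |κ|)) ?_
    filter_upwards [hspec, hlow k hk] with i hi hlo
    have hτ0 : 0 < τ i := h.initialSin_pos i
    have h1 : ‖P k i - P 0 i‖ ≤ ((n + 2 : ℕ) : ℝ) * (|κ| * τ i) := by
      refine matrix_norm_le_of_entry _ (by positivity) fun a b => ?_
      rcases Nat.eq_zero_or_pos k with rfl | h0
      · simp only [sub_self, Matrix.zero_apply, abs_zero]
        positivity
      · refine (hi.2 0 k h0 hk a b).trans ?_
        exact mul_le_mul_of_nonneg_right (le_abs_self κ) hτ0.le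
    rw [norm_smul, norm_inv, norm_norm, Real.norm_of_nonneg hτ0.le]
    have hη := h.scale_pos
    calc ‖P 0 i‖⁻¹ * ‖P k i - P 0 i‖ ≤ η⁻¹ * (((n + 2 : ℕ) : ℝ) * (|κ| * τ i)) := by gcongr
      _ = _ := by ring
  have hNb : Bdd l (fun i => ‖P 0 i‖⁻¹ • P 0 i) := by
    refine IsBigO.of_bound 1 (Eventually.of_forall fun i => ?_)
    rw [norm_smul, norm_inv, norm_norm, norm_one, mul_one]
    exact inv_mul_le_one
  have hrp : ∀ k < K, (fun i => (‖P 0 i‖⁻¹ • P k i) *ᵥ res A B lam v x k i -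
      (‖P 0 i‖⁻¹ • P 0 i) *ᵥ ((A - lam 0 • B) *ᵥ err B v x k i)) =O[l] τ := by
    intro k hk
    refine ((Bdd.small_mulVec (hPP k hk) (h.res_bdd hk.le)).add
      (hNb.mulVec_small (h.res_sub hk.le))).congr_left fun i => ?_
    rw [smul_sub, sub_mulVec, mulVec_sub]
    abel
  refine ⟨fun i => ‖P 0 i‖⁻¹ • P 0 i, fun k i => (‖P 0 i‖⁻¹ • P k i) *ᵥ res A B lam v x k i, ?_⟩
  exact {
    tendsto := hτ
    symm := hs
    space_zero := fun i => spaceW_zero _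
    space_succ := fun k i => spaceW_succ _ k
    dir_zero := fun i => rfl
    dir_mem := fun k hk i => (h.run i).prevDir_mem hk
    dir_bdd := fun k hk => h.dir_bdd hk
    dir_inv := fun k hk => h.dir_inv hk
    dir_eq_zero := fun k hk i => h.dir_eq_zero hk i
    conj := fun k hk => h.conj hk
    decomp := fun k hk => h.decomp hk
    dir_of_zero := fun k hk i => h.dir_of_zero hk i
    res_bdd := fun k hk => (Bdd.const _).mulVec (h.err_bdd hk)
    ritz_prev := fun k hk => h.ritz hk (h.dir_bdd hk.le) fun i => by
      obtain ⟨Q, -, -, hp, -, hQ, -⟩ := (h.run i).ritz h.symmA h.posB hk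
      exact hQ _ hp
    ritz_dir := fun k hk => h.ritz hk (h.dir_bdd hk) fun i => by
      obtain ⟨Q, -, -, -, hp, hQ, -⟩ := (h.run i).ritz h.symmA h.posB hk
      exact hQ _ hp
    step := fun k hk => h.step hk
    prec_bdd := hNb
    prec_symm := Eventually.of_forall fun i =>
      (polyPrec_isSymm h.symmA h.symmB (isSymm_of_posDef h.posM) _ _).smul _
    krylov := fun k hk => by
      -- This undoes the scaling of the residual and the normalization of the preconditioner.
      refine ⟨fun i => c i k * (bInner B (x i k) (v 0) * τ i) * ‖P 0 i‖, ?_⟩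
      filter_upwards [hspec, hlow k hk] with i hi hlo
      have hP0 : ‖P 0 i‖ ≠ 0 := (h.scale_pos.trans_le hlo).ne'
      rw [(hi.1 k hk).2.1, h.eig.eigResidual_eq h.symmA h.posB (h.initialSin_pos i).ne'
        (h.coef_iterate_ne_zero hk.le i), mulVec_smul, smul_smul, smul_mulVec, smul_smul,
        mul_assoc _ _ (‖P 0 i‖⁻¹), mul_inv_cancel₀ hP0, mul_one]
    res_prec := hrp
    res_lower := fun k hk => by
      have hN1 : (fun _ => (1 : ℝ)) =O[l] fun i => ‖‖P 0 i‖⁻¹ • P 0 i‖ := by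
        refine IsBigO.of_bound 1 ?_
        filter_upwards [hlow k hk] with i hlo
        have hP0 : ‖P 0 i‖ ≠ 0 := (h.scale_pos.trans_le hlo).ne'
        rw [norm_norm, norm_smul, norm_inv, norm_norm, inv_mul_cancel₀ hP0, norm_one, mul_one]
      have h1 : (fun _ => (1 : ℝ)) =O[l] fun i => ‖‖P 0 i‖⁻¹ • P k i‖ := by
        refine one_isBigO_of_sub hτ hN1 (IsBigO.trans ?_ (hPP k hk))
        refine IsBigO.of_bound 1 (Eventually.of_forall fun i => ?_)
        rw [one_mul, smul_sub, norm_sub_rev]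
        exact abs_norm_sub_norm_le _ _
      -- The normalized P_k is bounded below, being close to a matrix of norm one; the chain through
      -- the polynomial coefficients passes this on to its product with the residual.
      have h2 := ((isBigO_refl (fun i => ‖P 0 i‖⁻¹) l).smul
        ((h.polyPrec_isBigO hk.le (hdeg k hk)).trans (h.coeff_isBigO hk (hdeg k hk))))
      refine (h1.trans h2.norm_left).congr_right fun i => ?_
      rw [smul_mulVec] }

end PLFamily

end Preconditioner

/-! ### Comparison with the global minimizers. -/

section QuasiOptimality

open Asymptotics
open scoped Matrix.Norms.Operator

variable {n : ℕ} {ι : Type*} {A B M : Matrix (Fin (n + 2)) (Fin (n + 2)) ℝ}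
    {lam : Fin (n + 2) → ℝ} {v : Fin (n + 2) → Fin (n + 2) → ℝ} {m K : ℕ}
    {x g p : ι → ℕ → Fin (n + 2) → ℝ} {ξ ξ' δ η κ ε : ℝ}

namespace PLFamily

theorem initial_mem_spaceU (x g : ℕ → Fin (n + 2) → ℝ) (k : ℕ) : x 0 ∈ spaceU x g k :=
  Submodule.mem_sup_left (Submodule.mem_span_singleton_self _)

/-- Up to third order, the iterates are optimal over the spaces `U_k`. -/
theorem exists_quasiOptimal_eventually (h : PLFamily A B M lam v m K x g p ξ ξ' δ η κ ε) {k : ℕ}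
    (hk : k ≤ K) {y : ι → Fin (n + 2) → ℝ}
    (hy : ∀ i, IsRayleighMin A B (spaceU (x i) (g i) k) (y i)) :
    ∃ D : ℝ, ∀ᶠ i in angleFilter B (v 0) x,
      rayleigh A B (x i k) - rayleigh A B (y i) ≤ D * initialSin B (v 0) x i ^ 3 := by
  set l := angleFilter B (v 0) x with hl
  set τ := initialSin B (v 0) x with hτdef
  have hs := isSymm_sub_smul h.symmA h.symmB (lam 0)
  have hy0 : ∀ i, y i ≠ 0 := fun i => (hy i).2.1
  have hle : ∀ i, rayleigh A B (y i) ≤ rayleigh A B (x i 0) := fun i =>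
    (hy i).2.2 _ (initial_mem_spaceU _ _ _) ((h.run i).ne_zero h.posB (Nat.zero_le K))
  have hdec : ∀ i, ∀ z ∈ spaceU (x i) (g i) k, ∃ (α : ℝ) (w : Fin (n + 2) → ℝ),
      w ∈ spaceW (g i) k ∧ z = α • x i 0 + w := by
    intro i z hz
    obtain ⟨a, ha, w, hw, rfl⟩ := Submodule.mem_sup.1 hz
    obtain ⟨α, rfl⟩ := Submodule.mem_span_singleton.1 ha
    exact ⟨α, w, hw, rfl⟩
  choose α₁ w₁ hw₁ he₁ using fun i => hdec i _ (hy i).1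
  choose α₂ w₂ hw₂ he₂ using fun i => hdec i _ ((h.run i).mem_spaceU hk)
  obtain ⟨b₁, hu₁, -, hr₁⟩ := h.exists_increment (Nat.zero_le K) hk hy0 hle hw₁ he₁
  obtain ⟨b₂, hu₂, -, hr₂⟩ := h.exists_increment (Nat.zero_le K) hk
    (fun i => (h.run i).ne_zero h.posB hk) (fun i => by linarith [h.value_upper hk i]) hw₂ he₂
  have hsb : Bdd l (fun i => scaledError B (v 0) (τ i) (y i)) := h.scaledError_bdd hy0 hle
  set s : ι → Fin (n + 2) → ℝ := fun i => scaledError B (v 0) (τ i) (y i) with hsdef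
  set t := err B v x k with ht
  obtain ⟨N, r, hCG⟩ := h.asymptoticCG
  -- Relative to t_0, both t_k and the minimizer's scaled error are given by increments in W_k;
  -- their difference is a bounded family to which global orthogonality applies.
  have horth := (hCG.orth hk).orth _
    (Eventually.of_forall fun i => Submodule.sub_mem _ (Submodule.smul_mem _ _ (hw₂ i))
      (Submodule.smul_mem _ _ (hw₁ i))) (hu₂.sub hu₁)
  have hHt : Bdd l (fun i => (A - lam 0 • B) *ᵥ t i) := (Bdd.const _).mulVec (h.err_bdd hk)
  have hG : (fun i => (t i - s i) ⬝ᵥ (A - lam 0 • B) *ᵥ t i) =O[l] τ := by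
    refine (horth.add (Bdd.small_dot (hr₂.sub hr₁) hHt)).congr_left fun i => ?_
    have hv : v 0 ⬝ᵥ (A - lam 0 • B) *ᵥ t i = 0 := by
      rw [dotProduct_mulVec_comm hs, h.eig.gap_mulVec, dotProduct_zero]
    simp only [sub_dotProduct, smul_dotProduct, smul_eq_mul, hv, mul_zero]
    ring
  have hBs : (fun i => (rayleigh A B (x i 0) - lam 0) * bInner B (s i) (s i)) =O[l] τ :=
    Bdd.small_mul (h.value_small (Nat.zero_le K)) (hsb.dot ((Bdd.const B).mulVec hsb))
  obtain ⟨D, hD⟩ := ((Bdd.const (2 : ℝ)).mul_small hG |>.add hBs).bound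
  refine ⟨D, hD.mono fun i hi => ?_⟩
  have hτ0 : 0 < τ i := h.initialSin_pos i
  have f1 := h.eig.bInner_gap_scaledError h.symmA h.posB hτ0.ne' (h.coef_iterate_ne_zero hk i)
  have f2 := h.eig.bInner_gap_scaledError h.symmA h.posB hτ0.ne' (h.coef_ne_zero (hy0 i) (hle i))
  have f3 : 0 ≤ (rayleigh A B (x i k) - lam 0) * bInner B (t i) (t i) :=
    mul_nonneg ((mul_nonneg (pow_nonneg h.rate_pos.le k) (h.initial_pos i).le).trans
      (h.value_lower hk i)) (bInner_self_nonneg h.posB _)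
  have f4 : (rayleigh A B (y i) - lam 0) * bInner B (s i) (s i) ≤
      (rayleigh A B (x i 0) - lam 0) * bInner B (s i) (s i) :=
    mul_le_mul_of_nonneg_right (by linarith [hle i]) (bInner_self_nonneg h.posB _)
  -- The right side exceeds the left by (t - s)ᵀH(t - s) ≥ 0.
  have f5 : bInner (A - lam 0 • B) (t i) (t i) - bInner (A - lam 0 • B) (s i) (s i) ≤
      2 * ((t i - s i) ⬝ᵥ (A - lam 0 • B) *ᵥ t i) := by
    have h1 := h.eig.gap_nonneg h.symmB (t i - s i)
    rw [bInner_sub_right, bInner_sub_left _ _ _ (s i)] at h1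
    have h2 : bInner (A - lam 0 • B) (t i - s i) (t i) =
        bInner (A - lam 0 • B) (t i) (t i) - bInner (A - lam 0 • B) (t i) (s i) := by
      rw [bInner_sub_left, bInner_comm hs (s i)]
    change _ ≤ 2 * bInner (A - lam 0 • B) (t i - s i) (t i)
    linarith
  have f6 := (le_abs_self _).trans hi
  rw [Real.norm_of_nonneg hτ0.le] at f6
  -- Passing from energies back to Rayleigh errors, the correction for x_k has a favourable sign and
  -- the one for the minimizer is bounded through ρ₀ - λ₁.
  have f7 : (rayleigh A B (x i k) - rayleigh A B (y i)) / τ i ^ 2 ≤ D * τ i := by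
    have : (rayleigh A B (x i k) - rayleigh A B (y i)) / τ i ^ 2 =
        (rayleigh A B (x i k) - lam 0) / τ i ^ 2 - (rayleigh A B (y i) - lam 0) / τ i ^ 2 := by
      ring
    rw [this]
    linarith
  rw [div_le_iff₀ (by positivity)] at f7
  calc _ ≤ D * τ i * τ i ^ 2 := f7
    _ = _ := by ring

/-- This is what trades one factor sin θ₀ of the cubic bound for sin θ_k. -/
theorem sin_lower (h : PLFamily A B M lam v m K x g p ξ ξ' δ η κ ε) {k : ℕ} (hk : k ≤ K) (i : ι) :
    Real.sqrt (ξ ^ k * (lam 1 - lam 0) / (lam (Fin.last _) - lam 0)) * initialSin B (v 0) x i ≤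
      Real.sin (bAngle B (x i k) (v 0)) := by
  have h1 := (h.eig.rayleigh_bounds h.posB (h.bNorm_eq_one hk i)).2
  have h2 := h.value_lower hk i
  have h3 := h.initial_lower i
  have h4 := pow_pos h.rate_pos k
  have hg : lam 0 < lam (Fin.last _) := h.gap.trans_le (h.eig.mono (Fin.le_last _))
  have hg1 := h.gap
  have hΛ : 0 < lam (Fin.last (n + 1)) - lam 0 := by linarith
  have h5 : 0 ≤ ξ ^ k * (lam 1 - lam 0) / (lam (Fin.last _) - lam 0) :=
    div_nonneg (mul_nonneg h4.le (by linarith)) hΛ.le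
  refine abs_le_of_sq_le_sq' ?_ (sin_bAngle_nonneg _ _ _) |>.2
  rw [mul_pow, Real.sq_sqrt h5, div_mul_eq_mul_div, div_le_iff₀ hΛ]
  calc _ = ξ ^ k * ((lam 1 - lam 0) * initialSin B (v 0) x i ^ 2) := by ring
    _ ≤ ξ ^ k * (rayleigh A B (x i 0) - lam 0) := by gcongr
    _ ≤ _ := by linarith

theorem sin_upper (h : PLFamily A B M lam v m K x g p ξ ξ' δ η κ ε) {k : ℕ} (hk : k ≤ K) (i : ι) :
    Real.sin (bAngle B (x i k) (v 0)) ≤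
      Real.sqrt ((lam (Fin.last _) - lam 0) / (lam 1 - lam 0)) * initialSin B (v 0) x i := by
  have h1 := (h.eig.rayleigh_bounds h.posB (h.bNorm_eq_one hk i)).1
  have h2 := h.value_upper hk i
  have h3 := h.initial_upper i
  have hg : lam 0 < lam (Fin.last _) := h.gap.trans_le (h.eig.mono (Fin.le_last _))
  have hγ : 0 < lam 1 - lam 0 := by linarith [h.gap]
  have h5 : 0 ≤ (lam (Fin.last (n + 1)) - lam 0) / (lam 1 - lam 0) :=
    div_nonneg (by linarith) hγ.le
  refine abs_le_of_sq_le_sq' ?_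
    (mul_nonneg (Real.sqrt_nonneg _) (h.initialSin_pos i).le) |>.2
  rw [mul_pow, Real.sq_sqrt h5, div_mul_eq_mul_div, le_div_iff₀ hγ]
  linarith

theorem exists_quasiOptimal (h : PLFamily A B M lam v m K x g p ξ ξ' δ η κ ε)
    (hsign : ∀ i, 0 ≤ bInner B (x i 0) (v 0)) {k : ℕ}
    (hk : k ≤ K) {y : ι → Fin (n + 2) → ℝ}
    (hy : ∀ i, IsRayleighMin A B (spaceU (x i) (g i) k) (y i)) :
    ∃ C : ℝ, 0 ≤ C ∧ ∀ i, rayleigh A B (x i k) - rayleigh A B (y i) ≤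
      C * Real.sin (bAngle B (x i k) (v 0)) * initialSin B (v 0) x i ^ 2 := by
  obtain ⟨D, hD⟩ := h.exists_quasiOptimal_eventually hk hy
  obtain ⟨U, hU, hUD⟩ := mem_comap.1 hD
  obtain ⟨r, hr, hrU⟩ := Metric.mem_nhds_iff.1 hU
  have hπ := Real.pi_pos
  have hγ : 0 < lam 1 - lam 0 := by linarith [h.gap]
  have hg : lam 0 < lam (Fin.last _) := h.gap.trans_le (h.eig.mono (Fin.le_last _))
  -- Up to π / 2 the sine is increasing, so a lower bound on the angle is one on its sine.
  set r' := min r (Real.pi / 2) with hr'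
  have hr'0 : 0 < r' := lt_min hr (by positivity)
  have hr'2 : r' ≤ Real.pi / 2 := min_le_right _ _
  set σ := Real.sin r' with hσ
  have hσ0 : 0 < σ := Real.sin_pos_of_pos_of_lt_pi hr'0 (by linarith)
  set E := |D| + (lam 1 - lam 0) / σ ^ 3 with hE
  have hE0 : 0 ≤ E := by positivity
  have hall : ∀ i, rayleigh A B (x i k) - rayleigh A B (y i) ≤
      E * initialSin B (v 0) x i ^ 3 := by
    intro i
    have hτ0 := h.initialSin_pos i
    by_cases hi : bAngle B (x i 0) (v 0) < r
    · have h0 : 0 ≤ bAngle B (x i 0) (v 0) := Real.arccos_nonneg _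
      have hmem : bAngle B (x i 0) (v 0) ∈ Metric.ball (0 : ℝ) r := by
        rw [mem_ball_zero_iff, Real.norm_of_nonneg h0]
        exact hi
      have h1 : rayleigh A B (x i k) - rayleigh A B (y i) ≤ D * initialSin B (v 0) x i ^ 3 :=
        hUD (hrU hmem)
      refine h1.trans ?_
      gcongr
      rw [hE]
      have : 0 ≤ (lam 1 - lam 0) / σ ^ 3 := by positivity
      linarith [le_abs_self D]
    -- For runs with a large initial angle the crude bound λ₂ - λ₁ suffices, because the sign
    -- normalization keeps θ₀ away from π and hence sin θ₀ ≥ σ.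
    · have h1 : bAngle B (x i 0) (v 0) ≤ Real.pi / 2 := by
        refine Real.arccos_le_pi_div_two.2 (div_nonneg (hsign i) ?_)
        exact mul_nonneg (Real.sqrt_nonneg _) (Real.sqrt_nonneg _)
      have h2 : σ ≤ initialSin B (v 0) x i :=
        Real.sin_le_sin_of_le_of_le_pi_div_two (by linarith) h1
          ((min_le_left _ _).trans (not_lt.1 hi))
      have h3 : lam 0 ≤ rayleigh A B (y i) := by
        have h4 := rayleigh_sub_eq (A := A) h.posB (hy i).2.1 (lam 0)
        have h5 := div_nonneg (h.eig.gap_nonneg h.symmB (y i)) (bInner_self_nonneg h.posB (y i))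
        linarith
      have h4 := h.value_upper hk i
      have h5 := (h.lin i).1.2
      calc rayleigh A B (x i k) - rayleigh A B (y i) ≤ lam 1 - lam 0 := by linarith
        _ = (lam 1 - lam 0) / σ ^ 3 * σ ^ 3 := by field_simp
        _ ≤ E * initialSin B (v 0) x i ^ 3 := by
          gcongr
          rw [hE]
          linarith [abs_nonneg D]
  set c := Real.sqrt (ξ ^ k * (lam 1 - lam 0) / (lam (Fin.last _) - lam 0)) with hc
  have hc0 : 0 < c :=
    Real.sqrt_pos.2 (div_pos (mul_pos (pow_pos h.rate_pos k) hγ) (by linarith))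
  refine ⟨E / c, by positivity, fun i => (hall i).trans ?_⟩
  have hτ0 := h.initialSin_pos i
  calc E * initialSin B (v 0) x i ^ 3
      = E / c * (c * initialSin B (v 0) x i) * initialSin B (v 0) x i ^ 2 := by field_simp
    _ ≤ _ := by
      gcongr
      exact h.sin_lower hk i

end PLFamily

end QuasiOptimality

/-- Asymptotic global quasi-optimality of the preconditioned Lanczos+1 method, for a family (indexed
by `ι`) of runs of `K` steps that satisfy the assumptions with common constants. -/
theorem mainTheorem1 {n : ℕ} (A B M : Matrix (Fin (n + 2)) (Fin (n + 2)) ℝ)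
    (hA : A.IsSymm) (hB : B.PosDef) (hM : M.PosDef)
    (lam : Fin (n + 2) → ℝ) (v : Fin (n + 2) → Fin (n + 2) → ℝ)
    (heig : IsEigensystem A B lam v) (hgap : lam 0 < lam 1)
    (m K : ℕ) (hm : 0 < m)
    {ι : Type*} (x g p : ι → ℕ → Fin (n + 2) → ℝ)
    (hrun : ∀ i, IsPLRun A B M m K (x i) (g i) (p i))
    (hsign : ∀ i, 0 ≤ bInner B (x i 0) (v 0))
    -- precisely linear convergence
    (ξ ξ' : ℝ) (hξ : 0 < ξ) (hξξ' : ξ < ξ') (hξ' : ξ' < 1)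
    (hlin : ∀ i, LinearConvergence A B (lam 0) (lam 1) ξ ξ' K (x i))
    -- angle between the first eigenvector and the search spaces
    (δ : ℝ) (hδ : 0 < δ) (hangle : ∀ i, AngleBound (v 0) δ K (g i))
    -- same polynomial, for sufficiently small initial angle
    (η κ ε : ℝ) (hη : 0 < η) (hε : 0 < ε)
    (hpoly : ∀ i, bAngle B (x i 0) (v 0) < ε →
      SamePolynomial A B M (v 0) m η κ K (x i) (g i))
    -- global minimizers over the spaces `U_k`
    (y : ι → ℕ → Fin (n + 2) → ℝ)
    (hy : ∀ i k, k ≤ K → IsRayleighMin A B (spaceU (x i) (g i) k) (y i k)) :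
    ∃ C : ℕ → ℝ,
      (∀ k, 2 ≤ k → k < K → ∀ i,
        rayleigh A B (x i (k + 1)) - rayleigh A B (y i (k + 1)) ≤
          rayleigh A B (x i k) - rayleigh A B (y i k) +
            C (k + 1) * Real.sin (bAngle B (x i (k + 1)) (v 0)) *
              Real.sin (bAngle B (x i 0) (v 0)) ^ 2) ∧
      ∀ k, 3 ≤ k → k ≤ K →
        (∀ i, rayleigh A B (x i k) - rayleigh A B (y i k) ≤
          ∑ j ∈ Finset.Icc 3 k, C j * Real.sin (bAngle B (x i j) (v 0)) *
            Real.sin (bAngle B (x i 0) (v 0)) ^ 2) ∧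
        (∀ i, (rayleigh A B (x i k) - rayleigh A B (y i k)) /
            (rayleigh A B (x i k) - lam 0) ≤
          (ξ⁻¹) ^ k * (∑ j ∈ Finset.Icc 3 k, C j * Real.sin (bAngle B (x i j) (v 0))) /
            (lam 1 - lam 0)) ∧
        Tendsto (fun i => (ξ⁻¹) ^ k *
            (∑ j ∈ Finset.Icc 3 k, C j * Real.sin (bAngle B (x i j) (v 0))) / (lam 1 - lam 0))
          (comap (fun i => bAngle B (x i 0) (v 0)) (𝓝 0)) (𝓝 0) ∧
        Tendsto (fun i => (rayleigh A B (x i k) - rayleigh A B (y i k)) /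
            (rayleigh A B (x i k) - lam 0))
          (comap (fun i => bAngle B (x i 0) (v 0)) (𝓝 0)) (𝓝 0) := by
  have h : PLFamily A B M lam v m K x g p ξ ξ' δ η κ ε :=
    ⟨hA, hB, hM, heig, hgap, hrun, hξ, hξξ', hξ', hlin, hδ, hangle, hη, hε, hpoly⟩
  have hγ : 0 < lam 1 - lam 0 := by linarith
  -- The bound holds at each index by itself; since all terms are nonnegative, the recursion and the
  -- sums only weaken it. Indices beyond K receive the constant 0.
  have hC : ∀ k, ∃ C : ℝ, 0 ≤ C ∧ (k ≤ K → ∀ i, rayleigh A B (x i k) - rayleigh A B (y i k) ≤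
      C * Real.sin (bAngle B (x i k) (v 0)) * Real.sin (bAngle B (x i 0) (v 0)) ^ 2) := by
    intro k
    by_cases hk : k ≤ K
    · obtain ⟨C, hC0, hC⟩ := h.exists_quasiOptimal hsign hk fun i => hy i k hk
      exact ⟨C, hC0, fun _ => hC⟩
    · exact ⟨0, le_rfl, fun h' => absurd h' hk⟩
  choose C hC0 hC using hC
  have hnn : ∀ k ≤ K, ∀ i, 0 ≤ rayleigh A B (x i k) - rayleigh A B (y i k) := fun k hk i =>
    sub_nonneg.2 ((hy i k hk).2.2 _ ((h.run i).mem_spaceU hk) ((h.run i).ne_zero hB hk))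
  have hterm : ∀ j i, 0 ≤ C j * Real.sin (bAngle B (x i j) (v 0)) := fun j i =>
    mul_nonneg (hC0 j) (sin_bAngle_nonneg _ _ _)
  have hsum : ∀ k, 3 ≤ k → k ≤ K → ∀ i, rayleigh A B (x i k) - rayleigh A B (y i k) ≤
      (∑ j ∈ Finset.Icc 3 k, C j * Real.sin (bAngle B (x i j) (v 0))) *
        Real.sin (bAngle B (x i 0) (v 0)) ^ 2 := by
    intro k h3 hk i
    refine (hC k hk i).trans (mul_le_mul_of_nonneg_right ?_ (sq_nonneg _))
    exact Finset.single_le_sum (f := fun j => C j * Real.sin (bAngle B (x i j) (v 0)))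
      (fun j _ => hterm j i) (Finset.mem_Icc.2 ⟨h3, le_rfl⟩)
  have hratio : ∀ k, 3 ≤ k → k ≤ K → ∀ i, (rayleigh A B (x i k) - rayleigh A B (y i k)) /
      (rayleigh A B (x i k) - lam 0) ≤
      (ξ⁻¹) ^ k * (∑ j ∈ Finset.Icc 3 k, C j * Real.sin (bAngle B (x i j) (v 0))) /
        (lam 1 - lam 0) := by
    intro k h3 hk i
    have hpow := pow_pos hξ k
    have hlow : ξ ^ k * ((lam 1 - lam 0) * Real.sin (bAngle B (x i 0) (v 0)) ^ 2) ≤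
        rayleigh A B (x i k) - lam 0 :=
      (mul_le_mul_of_nonneg_left (h.initial_lower i) hpow.le).trans (h.value_lower hk i)
    have hpos : 0 < rayleigh A B (x i k) - lam 0 :=
      (mul_pos hpow (h.initial_pos i)).trans_le (h.value_lower hk i)
    have hS : 0 ≤ ∑ j ∈ Finset.Icc 3 k, C j * Real.sin (bAngle B (x i j) (v 0)) :=
      Finset.sum_nonneg fun j _ => hterm j i
    rw [div_le_iff₀ hpos]
    refine (hsum k h3 hk i).trans ?_
    set S := ∑ j ∈ Finset.Icc 3 k, C j * Real.sin (bAngle B (x i j) (v 0))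
    -- The denominator is at least ξ^k (λ₂ - λ₁) sin²θ₀, which cancels the factor sin²θ₀.
    calc S * Real.sin (bAngle B (x i 0) (v 0)) ^ 2
        = (ξ⁻¹) ^ k * S / (lam 1 - lam 0) *
          (ξ ^ k * ((lam 1 - lam 0) * Real.sin (bAngle B (x i 0) (v 0)) ^ 2)) := by
          rw [inv_pow]
          field_simp
      _ ≤ _ := by gcongr
  have htend : ∀ k, 3 ≤ k → k ≤ K → Tendsto (fun i => (ξ⁻¹) ^ k *
      (∑ j ∈ Finset.Icc 3 k, C j * Real.sin (bAngle B (x i j) (v 0))) / (lam 1 - lam 0))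
      (comap (fun i => bAngle B (x i 0) (v 0)) (𝓝 0)) (𝓝 0) := by
    intro k h3 hk
    have hτ := tendsto_initialSin B (v 0) x
    have h1 : ∀ j ∈ Finset.Icc 3 k, Tendsto (fun i => C j * Real.sin (bAngle B (x i j) (v 0)))
        (angleFilter B (v 0) x) (𝓝 0) := by
      intro j hj
      have hjK : j ≤ K := (Finset.mem_Icc.1 hj).2.trans hk
      have h2 : Tendsto (fun i => Real.sin (bAngle B (x i j) (v 0)))
          (angleFilter B (v 0) x) (𝓝 0) := by
        refine squeeze_zero (fun i => sin_bAngle_nonneg _ _ _) (fun i => h.sin_upper hjK i) ?_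
        simpa using hτ.const_mul (Real.sqrt ((lam (Fin.last _) - lam 0) / (lam 1 - lam 0)))
      simpa using h2.const_mul (C j)
    have h2 := tendsto_finsetSum _ h1
    change Tendsto _ (angleFilter B (v 0) x) _
    simpa using (h2.const_mul ((ξ⁻¹) ^ k)).div_const (lam 1 - lam 0)
  refine ⟨C, fun k _ hk i => ?_, fun k h3 hk => ⟨fun i => ?_, hratio k h3 hk, htend k h3 hk, ?_⟩⟩
  · have h1 := hC (k + 1) hk i
    have h2 := hnn k hk.le i
    linarith
  · rw [← Finset.sum_mul]
    exact hsum k h3 hk i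
  · refine squeeze_zero (fun i => div_nonneg (hnn k hk i) ?_) (hratio k h3 hk) (htend k h3 hk)
    exact (mul_nonneg (pow_nonneg hξ.le k) (h.initial_pos i).le).trans (h.value_lower hk i)
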